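/- Let $N\ge 1$ and $p>1$. Let $\gamma_N$ be the Gaussian measure on $\mathbb R^N$, $d\gamma_N=\phi_N\,dx$ with $\phi_N(x)=(2\pi)^{-N/2}e^{-|x|^2/2}$, and let $\Omega\subset\mathbb R^N$ be a nonempty (possibly unbounded) open set with $\gamma_N(\Omega)<1$. Let $W^{1,p}(\Omega,\phi_N)$ be the space of $\psi\in W^{1,1}_{\rm loc}(\Omega)$ with $\psi,|D\psi|\in L^p(\Omega,\gamma_N)$, normed by $\|\psi\|_{L^p(\Omega,\gamma_N)}+\|D\psi\|_{L^p(\Omega,\gamma_N)}$, and let $W^{1,p}_0(\Omega,\phi_N)$ be the closure of $C_c^\infty(\Omega)$ in it. Put $$\lambda_1(\Omega)=\inf_{w\in W^{1,p}_0(\Omega,\phi_N)\setminus\{0\}}\frac{\int_\Omega|Dw|^p\,d\gamma_N}{\int_\Omega|w|^p\,d\gamma_N},$$ $$Q_p(\alpha,\Omega)=\sup_{w\in W^{1,p}_0(\Omega,\phi_N)}\left\{-\int_\Omega|Dw|^p\,d\gamma_N+\alpha\int_\Omega|w|^p\,d\gamma_N+p\int_\Omega w\,d\gamma_N\right\}.$$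 For every $\alpha\in(-\infty,\lambda_1(\Omega))$ the supremum $Q_p(\alpha,\Omega)$ is finite, and there is a unique (up to equality a.e.) weak solution $v_{(\alpha)}$ of $$-\mathrm{div}\left(\phi_N|Dv|^{p-2}Dv\right)=\alpha\,\phi_N|v|^{p-2}v+\phi_N\ \text{ in }\Omega,\qquad v=0\ \text{ on }\partial\Omega,$$ that is, $v\in W^{1,p}_0(\Omega,\phi_N)$ and $\int_\Omega|Dv|^{p-2}Dv\cdot D\varphi\,d\gamma_N=\alpha\int_\Omega|v|^{p-2}v\,\varphi\,d\gamma_N+\int_\Omega\varphi\,d\gamma_N$ for all $\varphi\in W^{1,p}_0(\Omega,\phi_N)$. Moreover: (a) if $-\infty<\alpha<\beta<\lambda_1(\Omega)$, then $v_{(\alpha)}(x)\le v_{(\beta)}(x)$ for a.e. $x\in\Omega$; (b) $\alpha\mapsto Q_p(\alpha,\Omega)$ is strictly increasing and differentiable on $(-\infty,\lambda_1(\Omega))$, with $$\frac{d}{d\alpha}Q_p(\alpha,\Omega)=\int_\Omega|v_{(\alpha)}|^p\,d\gamma_N;$$ (c) $\displaystyle\lim_{\alpha\to-\infty}Q_p(\alpha,\Omega)=0$;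 (d) $\displaystyle\lim_{\alpha\to\lambda_1(\Omega)^-}Q_p(\alpha,\Omega)=+\infty$. -/

import Mathlib

open MeasureTheory Filter Topology Set
open scoped ContDiff ENNReal

/-- The `N`-dimensional Gaussian density `(2π)^{-N/2} exp (-|x|²/2)`. -/
noncomputable def gaussDensity (N : ℕ) (x : EuclideanSpace ℝ (Fin N)) : ℝ :=
  1 / (2 * Real.pi) ^ ((N : ℝ) / 2) * Real.exp (-(‖x‖ ^ 2) / 2)

/-- The Gaussian measure `γ_N` on `ℝ^N`: the measure with density `gaussDensity N`. -/
noncomputable def gaussMeasure (N : ℕ) : Measure (EuclideanSpace ℝ (Fin N)) :=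
  volume.withDensity (fun x => ENNReal.ofReal (gaussDensity N x))

/-- `φ` is a smooth function with compact support contained in `Ω`. -/
def IsTestFunction {N : ℕ} (Ω : Set (EuclideanSpace ℝ (Fin N)))
    (φ : EuclideanSpace ℝ (Fin N) → ℝ) : Prop :=
  ContDiff ℝ ∞ φ ∧ HasCompactSupport φ ∧ tsupport φ ⊆ Ω

/-- `u ∈ W^{1,1}_loc(Ω)` with weak (distributional) gradient `g`:
`u` and `g` are locally integrable on `Ω`, and `∫_Ω u ∂_e φ dx = - ∫_Ω (g · e) φ dx` for all
directions `e` and all test functions `φ`. -/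
def HasWeakGradient {N : ℕ} (Ω : Set (EuclideanSpace ℝ (Fin N)))
    (u : EuclideanSpace ℝ (Fin N) → ℝ)
    (g : EuclideanSpace ℝ (Fin N) → EuclideanSpace ℝ (Fin N)) : Prop :=
  LocallyIntegrableOn u Ω volume ∧ LocallyIntegrableOn g Ω volume ∧
    ∀ φ : EuclideanSpace ℝ (Fin N) → ℝ, IsTestFunction Ω φ →
      ∀ e : EuclideanSpace ℝ (Fin N),
        ∫ x in Ω, u x * fderiv ℝ φ x e = - ∫ x in Ω, inner ℝ (g x) e * φ x

/-- `u` belongs to the weighted Sobolev space `W^{1,p}(Ω, φ_N)` and `g` is its weak gradient. -/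
def MemW1p {N : ℕ} (p : ℝ) (Ω : Set (EuclideanSpace ℝ (Fin N)))
    (u : EuclideanSpace ℝ (Fin N) → ℝ)
    (g : EuclideanSpace ℝ (Fin N) → EuclideanSpace ℝ (Fin N)) : Prop :=
  HasWeakGradient Ω u g ∧
    MemLp u (ENNReal.ofReal p) ((gaussMeasure N).restrict Ω) ∧
    MemLp g (ENNReal.ofReal p) ((gaussMeasure N).restrict Ω)

/-- `u` belongs to `W_0^{1,p}(Ω, φ_N)`, the closure of `C_c^∞(Ω)` in `W^{1,p}(Ω, φ_N)` for the norm
`‖u‖_{L^p(Ω, φ_N)} + ‖Du‖_{L^p(Ω, φ_N)}`, and `g` is its weak gradient. -/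
def MemW1pZero {N : ℕ} (p : ℝ) (Ω : Set (EuclideanSpace ℝ (Fin N)))
    (u : EuclideanSpace ℝ (Fin N) → ℝ)
    (g : EuclideanSpace ℝ (Fin N) → EuclideanSpace ℝ (Fin N)) : Prop :=
  MemW1p p Ω u g ∧
    ∀ ε : ℝ≥0∞, 0 < ε → ∃ φ : EuclideanSpace ℝ (Fin N) → ℝ, IsTestFunction Ω φ ∧
      eLpNorm (fun x => u x - φ x) (ENNReal.ofReal p) ((gaussMeasure N).restrict Ω) +
        eLpNorm (fun x => g x - gradient φ x) (ENNReal.ofReal p)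
          ((gaussMeasure N).restrict Ω) < ε

/-- The first eigenvalue `λ_1(Ω)`: the infimum of the Rayleigh quotients
`∫_Ω |Dw|^p dγ_N / ∫_Ω |w|^p dγ_N` over the nonzero elements `w` of `W_0^{1,p}(Ω, φ_N)`. -/
noncomputable def lambdaOne {N : ℕ} (p : ℝ) (Ω : Set (EuclideanSpace ℝ (Fin N))) : ℝ :=
  sInf {r : ℝ | ∃ w g, MemW1pZero p Ω w g ∧ ¬ (∀ᵐ x ∂(volume.restrict Ω), w x = 0) ∧
    r = (∫ x in Ω, ‖g x‖ ^ p ∂(gaussMeasure N)) / (∫ x in Ω, |w x| ^ p ∂(gaussMeasure N))}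

/-- The functional `F_α(w) = -∫_Ω |Dw|^p dγ_N + α ∫_Ω |w|^p dγ_N + p ∫_Ω w dγ_N`, where `g = Dw`. -/
noncomputable def torsionFunctional {N : ℕ} (p α : ℝ) (Ω : Set (EuclideanSpace ℝ (Fin N)))
    (w : EuclideanSpace ℝ (Fin N) → ℝ)
    (g : EuclideanSpace ℝ (Fin N) → EuclideanSpace ℝ (Fin N)) : ℝ :=
  -(∫ x in Ω, ‖g x‖ ^ p ∂(gaussMeasure N)) + α * (∫ x in Ω, |w x| ^ p ∂(gaussMeasure N))
    + p * ∫ x in Ω, w x ∂(gaussMeasure N)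

/-- The set of values of `F_α` on `W_0^{1,p}(Ω, φ_N)`. -/
def torsionValues {N : ℕ} (p α : ℝ) (Ω : Set (EuclideanSpace ℝ (Fin N))) : Set ℝ :=
  {r : ℝ | ∃ w g, MemW1pZero p Ω w g ∧ r = torsionFunctional p α Ω w g}

/-- The generalized torsional rigidity `Q_p(α, Ω)`, the supremum of `F_α` over `W_0^{1,p}(Ω, φ_N)`
(a genuine supremum whenever the set of values is bounded above). -/
noncomputable def genTorsion {N : ℕ} (p α : ℝ) (Ω : Set (EuclideanSpace ℝ (Fin N))) : ℝ :=
  sSup (torsionValues p α Ω)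

/-- `v` is a weak solution in `W_0^{1,p}(Ω, φ_N)` of
`-div (φ_N |Dv|^{p-2} Dv) = α φ_N |v|^{p-2} v + φ_N` in `Ω`, `v = 0` on `∂Ω`. -/
def IsTorsionFunction {N : ℕ} (p α : ℝ) (Ω : Set (EuclideanSpace ℝ (Fin N)))
    (v : EuclideanSpace ℝ (Fin N) → ℝ) : Prop :=
  ∃ g, MemW1pZero p Ω v g ∧ ∀ φ h, MemW1pZero p Ω φ h →
    ∫ x in Ω, ‖g x‖ ^ (p - 2) * inner ℝ (g x) (h x) ∂(gaussMeasure N) =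
      α * (∫ x in Ω, |v x| ^ (p - 2) * v x * φ x ∂(gaussMeasure N))
        + ∫ x in Ω, φ x ∂(gaussMeasure N)

/-! The core is a maximality principle. If `v ≥ 0` solves the equation at level `α`, testing it with
(a regularization of) `|φ|^p v^(1-p)` and using Picone's inequality gives `α ∫|φ|^p + ∫|φ|^p v^(1-p)
≤ ∫|Dφ|^p`. Young's inequality `|φ|^p v^(1-p) ≥ p|φ| - (p-1)v` turns this into `F_α(φ) ≤ (p-1) ∫v`,
and testing with `v` itself gives `F_α(v) = (p-1) ∫v`. Below `λ₁` every solution is nonnegative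
(test with its negative part), so each one is a maximizer and `Q_p(α) = (p-1) ∫v`
(`IsResolventSolution.torsionFunctional_le`, `IsResolventSolution.genTorsion_eq`).

Existence needs no compact embedding. Adding `κ|v|^(p-2)v` to both sides makes the left side
coercive and monotone and the right side increasing. Starting from `0`, the solutions of the frozen
problems increase, stay bounded because `α < λ₁`, and converge strongly in `L^p` together with their
gradients. The limit lies below every solution at any level `β ≥ α` (`exists_minimal_solution`).
Since all solutions at one level have the same integral, each of them equals the minimal one: this
gives uniqueness and (a) (`IsResolventSolution.ae_le`).

For (b), `Q_p` is a supremum of functions affine in `α` with slopes `∫|w|^p`, so `∫|v_α|^p` is a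
subgradient at `α`; it is positive, and it is continuous in `α` by ordering and dominated
convergence, whence the derivative. For (c), `p t ≤ ε + C|t|^p` absorbs the linear term once `α ≤
-C`.

For (d), boundedness of `Q_p` near `λ₁` would bound `F_{λ₁}`. Large multiples of a nonnegative
almost minimizer `w` of the Rayleigh quotient with `∫|w|^p = 1` contradict this as soon as `∫w`
stays away from `0`. That lower bound comes from a super-Poincaré inequality, which replaces
compactness: the `L^p` mass is at most a small multiple of the energy plus a multiple of the `L^1`
mass (`exists_integral_gaussRpow_le`). -/

theorem continuous_norm_rpow {F : Type*} [SeminormedAddCommGroup F] {p : ℝ} (hp : 1 < p) :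
    Continuous fun b : F => ‖b‖ ^ p :=
  continuous_norm.rpow_const fun _ => Or.inr (by linarith)

/-! ### Strict convexity of `‖·‖ ^ p` and its Bregman distance -/

section Flux

variable {F : Type*} [NormedAddCommGroup F] [InnerProductSpace ℝ F]

/-- The `p`-Laplacian flux `|b|^{p-2} b`. -/
noncomputable def pFlux (p : ℝ) (b : F) : F := ‖b‖ ^ (p - 2) • b

/-- The Bregman distance of `‖·‖ ^ p`. -/
noncomputable def bregman (p : ℝ) (a b : F) : ℝ :=
  ‖a‖ ^ p - ‖b‖ ^ p - p * inner ℝ (pFlux p b) (a - b)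

theorem inner_pFlux (p : ℝ) (b h : F) :
    inner ℝ (pFlux p b) h = ‖b‖ ^ (p - 2) * inner ℝ b h := by
  simp [pFlux, inner_smul_left]

theorem pFlux_zero (p : ℝ) : pFlux p (0 : F) = 0 := by simp [pFlux]

theorem norm_pFlux {p : ℝ} (hp : 1 < p) (b : F) : ‖pFlux p b‖ = ‖b‖ ^ (p - 1) := by
  rcases eq_or_ne b 0 with rfl | hb
  · simp [pFlux, Real.zero_rpow (sub_ne_zero.2 hp.ne')]
  · have hb' : 0 < ‖b‖ := norm_pos_iff.2 hb
    rw [pFlux, norm_smul, Real.norm_of_nonneg (by positivity)]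
    conv_lhs => rw [← Real.rpow_one ‖b‖, ← Real.rpow_mul hb'.le, ← Real.rpow_add hb']
    congr 1
    ring

theorem inner_pFlux_self {p : ℝ} (hp : 1 < p) (b : F) : inner ℝ (pFlux p b) b = ‖b‖ ^ p := by
  rcases eq_or_ne b 0 with rfl | hb
  · simp [pFlux, Real.zero_rpow (show p ≠ 0 by linarith)]
  · have hb' : 0 < ‖b‖ := norm_pos_iff.2 hb
    rw [inner_pFlux, real_inner_self_eq_norm_sq, ← Real.rpow_natCast, ← Real.rpow_add hb']
    congr 1
    push_cast
    ring

theorem continuous_pFlux {p : ℝ} (hp : 1 < p) : Continuous (pFlux p : F → F) := by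
  rw [continuous_iff_continuousAt]
  intro b
  rcases eq_or_ne b 0 with rfl | hb
  · rw [ContinuousAt, pFlux_zero, tendsto_zero_iff_norm_tendsto_zero]
    simp_rw [norm_pFlux hp]
    have h : Continuous fun b : F => ‖b‖ ^ (p - 1) :=
      continuous_norm.rpow_const fun _ => Or.inr (by linarith)
    simpa [Real.zero_rpow (sub_ne_zero.2 hp.ne')] using h.tendsto 0
  · exact (continuous_norm.continuousAt.rpow_const (Or.inl (norm_ne_zero_iff.2 hb))).smul
      continuousAt_id

theorem pFlux_smul {p t : ℝ} (ht : 0 < t) (b : F) : pFlux p (t • b) = t ^ (p - 1) • pFlux p b := by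
  rw [pFlux, pFlux, norm_smul, Real.norm_of_nonneg ht.le, Real.mul_rpow ht.le (norm_nonneg _),
    smul_smul, smul_smul]
  congr 1
  rw [show p - 1 = (p - 2) + 1 by ring, Real.rpow_add ht, Real.rpow_one]
  ring

theorem continuous_bregman {p : ℝ} (hp : 1 < p) :
    Continuous fun x : F × F => bregman p x.1 x.2 := by
  unfold bregman
  have h1 := continuous_norm_rpow (F := F) hp
  have h2 := continuous_pFlux (F := F) hp
  exact ((h1.comp continuous_fst).sub (h1.comp continuous_snd)).sub
    (continuous_const.mul ((h2.comp continuous_snd).inner (continuous_fst.sub continuous_snd)))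

/-- Strict Bernoulli inequality at `x / y`, multiplied by `y ^ p`. The equality case supplies the
strictness of all later convexity statements. -/
theorem young_rpow {p : ℝ} (hp : 1 < p) {x y : ℝ} (hx : 0 ≤ x) (hy : 0 ≤ y) :
    p * (y ^ (p - 1) * x) ≤ x ^ p + (p - 1) * y ^ p ∧
      (p * (y ^ (p - 1) * x) = x ^ p + (p - 1) * y ^ p → x = y) := by
  rcases hy.eq_or_lt with rfl | hy
  · rw [Real.zero_rpow (sub_ne_zero.2 hp.ne'), Real.zero_rpow (by linarith)]
    constructor
    · have := Real.rpow_nonneg hx p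
      linarith
    · intro h
      have h' : x ^ p = 0 := by linarith
      exact (Real.rpow_eq_zero hx (by linarith)).1 h'
  · have key : x ≠ y → p * (y ^ (p - 1) * x) < x ^ p + (p - 1) * y ^ p := by
      intro hne
      have h1 := one_add_mul_self_lt_rpow_one_add (s := x / y - 1) (by
        have := div_nonneg hx hy.le
        linarith) (by
        intro h
        apply hne
        field_simp at h
        linarith) hp
      have h2 : (0 : ℝ) < y ^ p := Real.rpow_pos_of_pos hy _
      have h3 : y ^ (p - 1) * y = y ^ p := by
        rw [← Real.rpow_add_one hy.ne']
        ring_nf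
      rw [add_sub_cancel, Real.div_rpow hx hy.le, lt_div_iff₀ h2, ← h3] at h1
      have h4 : (1 + p * (x / y - 1)) * (y ^ (p - 1) * y) =
          p * (y ^ (p - 1) * x) + (1 - p) * (y ^ (p - 1) * y) := by
        field_simp
        ring
      rw [h4] at h1
      rw [← h3]
      linarith
    constructor
    · rcases eq_or_ne x y with rfl | hne
      · have h3 : x ^ (p - 1) * x = x ^ p := by
          rw [← Real.rpow_add_one hy.ne']
          ring_nf
        rw [h3]
        linarith
      · exact (key hne).le
    · intro h
      by_contra hne
      exact (key hne).ne h

theorem bregman_eq {p : ℝ} (hp : 1 < p) (a b : F) :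
    bregman p a b = ‖a‖ ^ p + (p - 1) * ‖b‖ ^ p - p * inner ℝ (pFlux p b) a := by
  rw [bregman, inner_sub_right, inner_pFlux_self hp]
  ring

theorem inner_pFlux_le {p : ℝ} (hp : 1 < p) (a b : F) :
    inner ℝ (pFlux p b) a ≤ ‖b‖ ^ (p - 1) * ‖a‖ :=
  (real_inner_le_norm _ _).trans_eq (by rw [norm_pFlux hp])

theorem bregman_nonneg {p : ℝ} (hp : 1 < p) (a b : F) : 0 ≤ bregman p a b := by
  rw [bregman_eq hp]
  have h1 := inner_pFlux_le hp a b
  have h2 := (young_rpow hp (norm_nonneg a) (norm_nonneg b)).1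
  nlinarith

/-- A vanishing distance forces equality both in Young's inequality, so the norms agree, and in
Cauchy–Schwarz, so the directions agree. -/
theorem eq_of_bregman_eq_zero {p : ℝ} (hp : 1 < p) {a b : F} (h : bregman p a b = 0) :
    a = b := by
  rw [bregman_eq hp] at h
  have h1 := inner_pFlux_le hp a b
  obtain ⟨h2, h3⟩ := young_rpow hp (norm_nonneg a) (norm_nonneg b)
  have h4 : ‖a‖ = ‖b‖ := h3 (by nlinarith)
  have h5 : inner ℝ (pFlux p b) a = ‖b‖ ^ (p - 1) * ‖a‖ := by nlinarith
  rcases eq_or_ne b 0 with rfl | hb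
  · simpa using h4
  · have hb' : 0 < ‖b‖ := norm_pos_iff.2 hb
    have h6 : inner ℝ b a = ‖b‖ * ‖a‖ := by
      rw [inner_pFlux, show p - 1 = (p - 2) + 1 by ring, Real.rpow_add hb', Real.rpow_one,
        mul_assoc] at h5
      exact mul_left_cancel₀ (Real.rpow_pos_of_pos hb' _).ne' h5
    have h7 : ‖a - b‖ ^ 2 = 0 := by
      rw [norm_sub_sq_real, real_inner_comm, h6, h4]
      ring
    exact sub_eq_zero.1 (norm_eq_zero.1 (pow_eq_zero_iff two_ne_zero |>.1 h7))

theorem bregman_smul {p t : ℝ} (ht : 0 < t) (a b : F) :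
    bregman p (t • a) (t • b) = t ^ p * bregman p a b := by
  have h : t ^ (p - 1) * t = t ^ p := by
    rw [← Real.rpow_add_one ht.ne']
    ring_nf
  rw [bregman, bregman, pFlux_smul ht, ← smul_sub, inner_smul_left, inner_smul_right, norm_smul,
    norm_smul, Real.norm_of_nonneg ht.le, Real.mul_rpow ht.le (norm_nonneg _),
    Real.mul_rpow ht.le (norm_nonneg _), ← h]
  simp
  ring

/-- Through this identity, strict monotonicity of the flux follows from positivity of the Bregman
distance. -/
theorem bregman_add_bregman {p : ℝ} (a b : F) :
    bregman p a b + bregman p b a = p * inner ℝ (pFlux p a - pFlux p b) (a - b) := by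
  rw [bregman, bregman, inner_sub_left, ← neg_sub a b, inner_neg_right]
  ring

/-- The two deviations from the midpoint are opposite, so the first-order terms cancel: the midpoint
convexity defect is a sum of Bregman distances. -/
theorem bregman_midpoint {p : ℝ} (a b : F) :
    bregman p a ((1 / 2 : ℝ) • (a + b)) + bregman p b ((1 / 2 : ℝ) • (a + b)) =
      ‖a‖ ^ p + ‖b‖ ^ p - 2 * ‖(1 / 2 : ℝ) • (a + b)‖ ^ p := by
  have h : b - (1 / 2 : ℝ) • (a + b) = -(a - (1 / 2 : ℝ) • (a + b)) := by module
  rw [bregman, bregman, h, inner_neg_right]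
  ring

theorem inner_pFlux_sub_nonneg {p : ℝ} (hp : 1 < p) (a b : F) :
    0 ≤ inner ℝ (pFlux p a - pFlux p b) (a - b) := by
  have h := bregman_add_bregman (p := p) a b
  have h1 := bregman_nonneg hp a b
  have h2 := bregman_nonneg hp b a
  by_contra h3
  push Not at h3
  nlinarith

theorem eq_of_inner_pFlux_sub_eq_zero {p : ℝ} (hp : 1 < p) {a b : F}
    (h0 : inner ℝ (pFlux p a - pFlux p b) (a - b) = 0) : a = b := by
  have h := bregman_add_bregman (p := p) a b
  have h1 := bregman_nonneg hp a b
  have h2 := bregman_nonneg hp b a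
  rw [h0] at h
  exact eq_of_bregman_eq_zero hp (by linarith)

end Flux

/-- A homogeneous function is controlled by another one up to a small multiple of the norm, as soon
as it is nonpositive on the zero set of the latter. -/
theorem exists_le_of_homogeneous {X : Type*} [NormedAddCommGroup X] [NormedSpace ℝ X]
    [FiniteDimensional ℝ X] {p : ℝ} (hp : 1 < p) {f g : X → ℝ} (hf : Continuous f)
    (hg : Continuous g) (hfh : ∀ t : ℝ, 0 < t → ∀ x, f (t • x) = t ^ p * f x)
    (hgh : ∀ t : ℝ, 0 < t → ∀ x, g (t • x) = t ^ p * g x) (hg0 : ∀ x, 0 ≤ g x)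
    (hfg : ∀ x, g x = 0 → f x ≤ 0) {η : ℝ} (hη : 0 < η) :
    ∃ C : ℝ, 0 ≤ C ∧ ∀ x, f x ≤ η * ‖x‖ ^ p + C * g x := by
  have : ProperSpace X := FiniteDimensional.proper ℝ X
  -- On this compact part of the sphere `g` cannot vanish, because `f ≥ η > 0` there; the maximum of
  -- `f / g` on it serves as `C`. On the rest of the sphere the term `η` suffices.
  set K : Set X := Metric.sphere 0 1 ∩ {x | η ≤ f x} with hK
  have hKc : IsCompact K := (isCompact_sphere 0 1).inter_right (isClosed_le continuous_const hf)
  obtain ⟨C, hC0, hC⟩ : ∃ C : ℝ, 0 ≤ C ∧ ∀ x ∈ K, f x ≤ C * g x := by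
    rcases K.eq_empty_or_nonempty with h | h
    · exact ⟨0, le_rfl, by simp [h]⟩
    · have hpos : ∀ x ∈ K, 0 < g x := fun x hx => (hg0 x).lt_of_ne fun h0 => by
        have h1 := hfg x h0.symm
        have h2 : η ≤ f x := hx.2
        linarith
      obtain ⟨x₀, hx₀, hmax⟩ := hKc.exists_isMaxOn h
        (f := fun x => f x / g x) (hf.continuousOn.div hg.continuousOn fun x hx => (hpos x hx).ne')
      refine ⟨f x₀ / g x₀, div_nonneg (hη.le.trans hx₀.2) (hg0 _), fun x hx => ?_⟩
      rw [← div_le_iff₀ (hpos x hx)]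
      exact hmax hx
  refine ⟨C, hC0, fun x => ?_⟩
  rcases eq_or_ne x 0 with rfl | hx
  · have hf0 : f 0 = 0 := by
      have h := hfh 2 two_pos 0
      have h2 : (1 : ℝ) < 2 ^ p := Real.one_lt_rpow (by norm_num) (by linarith)
      rw [smul_zero] at h
      nlinarith
    rw [hf0]
    have := mul_nonneg hC0 (hg0 0)
    positivity
  · have hx' : 0 < ‖x‖ := norm_pos_iff.2 hx
    have hxy : x = ‖x‖ • (‖x‖⁻¹ • x) := by rw [smul_smul, mul_inv_cancel₀ hx'.ne', one_smul]
    set y := ‖x‖⁻¹ • x with hy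
    have hy1 : ‖y‖ = 1 := by rw [hy, norm_smul, norm_inv, norm_norm, inv_mul_cancel₀ hx'.ne']
    have key : f y ≤ η + C * g y := by
      by_cases h : η ≤ f y
      · have := hC y ⟨by simp [hy1], h⟩
        linarith
      · have := mul_nonneg hC0 (hg0 y)
        linarith
    have hfx : f x = ‖x‖ ^ p * f y := by
      conv_lhs => rw [hxy]
      exact hfh _ hx' y
    have hgx : g x = ‖x‖ ^ p * g y := by
      conv_lhs => rw [hxy]
      exact hgh _ hx' y
    rw [hfx, hgx]
    have := mul_le_mul_of_nonneg_left key (Real.rpow_nonneg hx'.le p)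
    linarith

/-! ### Pointwise inequalities with a small parameter, by homogeneity and compactness -/

section Estimates

variable {F : Type*} [NormedAddCommGroup F] [InnerProductSpace ℝ F]

theorem max_rpow_le {p x y : ℝ} (hx : 0 ≤ x) (hy : 0 ≤ y) :
    max x y ^ p ≤ x ^ p + y ^ p := by
  have h1 := Real.rpow_nonneg hx p
  have h2 := Real.rpow_nonneg hy p
  rcases max_cases x y with ⟨h, _⟩ | ⟨h, _⟩ <;> rw [h] <;> linarith

theorem norm_add_rpow_le {G : Type*} [SeminormedAddCommGroup G] {p : ℝ} (hp : 1 < p) (a b : G) :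
    ‖a + b‖ ^ p ≤ 2 ^ p * (‖a‖ ^ p + ‖b‖ ^ p) := by
  have h1 : ‖a + b‖ ≤ 2 * max ‖a‖ ‖b‖ := by
    have := norm_add_le a b
    have := le_max_left ‖a‖ ‖b‖
    have := le_max_right ‖a‖ ‖b‖
    linarith
  calc ‖a + b‖ ^ p ≤ (2 * max ‖a‖ ‖b‖) ^ p :=
        Real.rpow_le_rpow (norm_nonneg _) h1 (by linarith)
    _ = 2 ^ p * max ‖a‖ ‖b‖ ^ p := Real.mul_rpow (by norm_num) (by positivity)
    _ ≤ _ := by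
        gcongr
        exact max_rpow_le (norm_nonneg _) (norm_nonneg _)

theorem norm_sub_rpow_le {G : Type*} [SeminormedAddCommGroup G] {p : ℝ} (hp : 1 < p) (a b : G) :
    ‖a - b‖ ^ p ≤ 2 ^ p * (‖a‖ ^ p + ‖b‖ ^ p) := by
  simpa [sub_eq_add_neg] using norm_add_rpow_le hp a (-b)

variable [FiniteDimensional ℝ F]

/-- Uniform convexity in a form valid for every `p > 1`: for `p < 2` no bound by the Bregman
distance alone is possible, and the `η` term repairs this. -/
theorem exists_norm_sub_rpow_le_bregman {p : ℝ} (hp : 1 < p) {η : ℝ} (hη : 0 < η) :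
    ∃ C : ℝ, 0 ≤ C ∧ ∀ a b : F,
      ‖a - b‖ ^ p ≤ η * (‖a‖ ^ p + ‖b‖ ^ p) + C * bregman p a b := by
  have hc := continuous_norm_rpow (F := F) hp
  obtain ⟨C, hC0, hC⟩ := exists_le_of_homogeneous (X := F × F) hp
    (f := fun x => ‖x.1 - x.2‖ ^ p) (g := fun x => bregman p x.1 x.2)
    (hc.comp (continuous_fst.sub continuous_snd)) (continuous_bregman hp)
    (fun t ht x => by
      rw [Prod.smul_fst, Prod.smul_snd, ← smul_sub, norm_smul, Real.norm_of_nonneg ht.le,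
        Real.mul_rpow ht.le (norm_nonneg _)])
    (fun t ht x => bregman_smul ht _ _) (fun x => bregman_nonneg hp _ _)
    (fun x hx => by
      rw [eq_of_bregman_eq_zero hp hx, sub_self, norm_zero, Real.zero_rpow (by linarith)]) hη
  refine ⟨C, hC0, fun a b => (hC (a, b)).trans ?_⟩
  gcongr
  exact max_rpow_le (norm_nonneg _) (norm_nonneg _)

/-- The left side vanishes when `a = b`, so it is small plus a multiple of `‖a - b‖ ^ p`. This
yields continuity of the flux pairing under `L^p` convergence without Hölder's inequality. -/
theorem exists_inner_pFlux_sub_le {p : ℝ} (hp : 1 < p) {η : ℝ} (hη : 0 < η) :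
    ∃ C : ℝ, 0 ≤ C ∧ ∀ a b h : F, |inner ℝ (pFlux p a - pFlux p b) h| ≤
      η * (‖a‖ ^ p + ‖b‖ ^ p + ‖h‖ ^ p) + C * ‖a - b‖ ^ p := by
  have hc := continuous_norm_rpow (F := F) hp
  have hA := continuous_pFlux (F := F) hp
  obtain ⟨C, hC0, hC⟩ := exists_le_of_homogeneous (X := (F × F) × F) hp
    (f := fun x => |inner ℝ (pFlux p x.1.1 - pFlux p x.1.2) x.2|)
    (g := fun x => ‖x.1.1 - x.1.2‖ ^ p) (by fun_prop)
    (hc.comp ((continuous_fst.comp continuous_fst).sub (continuous_snd.comp continuous_fst)))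
    (fun t ht x => by
      have h : t ^ p = t ^ (p - 1) * t := by
        rw [← Real.rpow_add_one ht.ne']
        ring_nf
      rw [Prod.smul_fst, Prod.smul_snd, Prod.smul_fst, Prod.smul_snd, pFlux_smul ht,
        pFlux_smul ht, ← smul_sub, inner_smul_left, inner_smul_right, abs_mul, abs_mul,
        abs_of_pos ht, h]
      simp only [conj_trivial]
      rw [abs_of_pos (Real.rpow_pos_of_pos ht _)]
      ring)
    (fun t ht x => by
      rw [Prod.smul_fst, Prod.smul_fst, Prod.smul_snd, ← smul_sub, norm_smul,
        Real.norm_of_nonneg ht.le, Real.mul_rpow ht.le (norm_nonneg _)])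
    (fun x => by positivity)
    (fun x hx => by
      have h0 := (Real.rpow_eq_zero (norm_nonneg _) (by linarith)).1 hx
      rw [sub_eq_zero.1 (norm_eq_zero.1 h0)]
      simp) hη
  refine ⟨C, hC0, fun a b h => (hC ((a, b), h)).trans ?_⟩
  gcongr
  refine (max_rpow_le (p := p) (norm_nonneg _) (norm_nonneg _)).trans ?_
  gcongr
  exact max_rpow_le (norm_nonneg _) (norm_nonneg _)

theorem exists_inner_pFlux_le_left {p : ℝ} (hp : 1 < p) {η : ℝ} (hη : 0 < η) :
    ∃ C : ℝ, 0 ≤ C ∧ ∀ a h : F, |inner ℝ (pFlux p a) h| ≤ η * ‖h‖ ^ p + C * ‖a‖ ^ p := by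
  obtain ⟨C, hC0, hC⟩ := exists_inner_pFlux_sub_le (F := F) hp hη
  refine ⟨η + C, by positivity, fun a h => ?_⟩
  have := hC a 0 h
  rw [pFlux_zero, sub_zero, sub_zero, norm_zero, Real.zero_rpow (by linarith)] at this
  linarith

theorem exists_inner_pFlux_le_right {p : ℝ} (hp : 1 < p) {η : ℝ} (hη : 0 < η) :
    ∃ C : ℝ, 0 ≤ C ∧ ∀ a h : F, |inner ℝ (pFlux p a) h| ≤ η * ‖a‖ ^ p + C * ‖h‖ ^ p := by
  have hc := continuous_norm_rpow (F := F) hp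
  have hA := continuous_pFlux (F := F) hp
  obtain ⟨C, hC0, hC⟩ := exists_le_of_homogeneous (X := F × F) hp
    (f := fun x => |inner ℝ (pFlux p x.1) x.2|)
    (g := fun x => ‖x.2‖ ^ p) (by fun_prop) (hc.comp continuous_snd)
    (fun t ht x => by
      have h : t ^ p = t ^ (p - 1) * t := by
        rw [← Real.rpow_add_one ht.ne']
        ring_nf
      rw [Prod.smul_fst, Prod.smul_snd, pFlux_smul ht, inner_smul_left, inner_smul_right, abs_mul,
        abs_mul, abs_of_pos ht, h]
      simp only [conj_trivial]
      rw [abs_of_pos (Real.rpow_pos_of_pos ht _)]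
      ring)
    (fun t ht x => by
      rw [Prod.smul_snd, norm_smul, Real.norm_of_nonneg ht.le,
        Real.mul_rpow ht.le (norm_nonneg _)])
    (fun x => by positivity)
    (fun x hx => by
      have h0 := (Real.rpow_eq_zero (norm_nonneg _) (by linarith)).1 hx
      rw [norm_eq_zero.1 h0]
      simp) hη
  refine ⟨η + C, by positivity, fun a h => (hC (a, h)).trans ?_⟩
  have := mul_le_mul_of_nonneg_left (max_rpow_le (p := p) (norm_nonneg a) (norm_nonneg h)) hη.le
  change η * max ‖a‖ ‖h‖ ^ p + C * ‖h‖ ^ p ≤ _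
  linarith

theorem exists_abs_norm_rpow_sub_le {p : ℝ} (hp : 1 < p) {η : ℝ} (hη : 0 < η) :
    ∃ C : ℝ, 0 ≤ C ∧ ∀ a b : F, |‖a‖ ^ p - ‖b‖ ^ p| ≤ η * ‖b‖ ^ p + C * ‖a - b‖ ^ p := by
  have hc := continuous_norm_rpow (F := F) hp
  obtain ⟨C, hC0, hC⟩ := exists_le_of_homogeneous (X := F × F) hp
    (f := fun x => |‖x.1 + x.2‖ ^ p - ‖x.2‖ ^ p|) (g := fun x => ‖x.1‖ ^ p)
    ((hc.comp (continuous_fst.add continuous_snd)).sub (hc.comp continuous_snd)).abs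
    (hc.comp continuous_fst)
    (fun t ht x => by
      rw [Prod.smul_fst, Prod.smul_snd, ← smul_add, norm_smul, norm_smul,
        Real.norm_of_nonneg ht.le, Real.mul_rpow ht.le (norm_nonneg _),
        Real.mul_rpow ht.le (norm_nonneg _), ← mul_sub, abs_mul,
        abs_of_pos (Real.rpow_pos_of_pos ht _)])
    (fun t ht x => by
      rw [Prod.smul_fst, norm_smul, Real.norm_of_nonneg ht.le,
        Real.mul_rpow ht.le (norm_nonneg _)])
    (fun x => by positivity)
    (fun x hx => by
      have h0 := (Real.rpow_eq_zero (norm_nonneg _) (by linarith)).1 hx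
      rw [norm_eq_zero.1 h0]
      simp) hη
  refine ⟨η + C, by positivity, fun a b => ?_⟩
  have h1 := hC (a - b, b)
  have h2 := mul_le_mul_of_nonneg_left (max_rpow_le (p := p) (norm_nonneg (a - b)) (norm_nonneg b)) hη.le
  simp only [sub_add_cancel] at h1
  refine h1.trans ?_
  change η * max ‖a - b‖ ‖b‖ ^ p + C * ‖a - b‖ ^ p ≤ _
  linarith

end Estimates

/-! ### `L^p` convergence expressed through integrals of `p`-th powers -/

section LpTools

variable {α : Type*} {mα : MeasurableSpace α} {μ : Measure α}
variable {F : Type*} [NormedAddCommGroup F]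

theorem memLp_ofReal_iff {p : ℝ} (hp : 1 < p) {u : α → F} :
    MemLp u (ENNReal.ofReal p) μ ↔
      AEStronglyMeasurable u μ ∧ Integrable (fun x => ‖u x‖ ^ p) μ := by
  have h0 : ENNReal.ofReal p ≠ 0 := by simpa using by linarith
  have h1 : (ENNReal.ofReal p).toReal = p := ENNReal.toReal_ofReal (by linarith)
  constructor
  · intro h
    refine ⟨h.1, ?_⟩
    have := h.integrable_norm_rpow h0 ENNReal.ofReal_ne_top
    rwa [h1] at this
  · rintro ⟨h, h2⟩
    rw [← integrable_norm_rpow_iff h h0 ENNReal.ofReal_ne_top, h1]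
    exact h2

theorem integrable_rpow_of_memLp {p : ℝ} (hp : 1 < p) {u : α → F}
    (hu : MemLp u (ENNReal.ofReal p) μ) : Integrable (fun x => ‖u x‖ ^ p) μ :=
  ((memLp_ofReal_iff hp).1 hu).2

theorem eLpNorm_ofReal_eq {p : ℝ} (hp : 1 < p) {u : α → F}
    (hu : MemLp u (ENNReal.ofReal p) μ) :
    eLpNorm u (ENNReal.ofReal p) μ = ENNReal.ofReal ((∫ x, ‖u x‖ ^ p ∂μ) ^ p⁻¹) := by
  have h0 : ENNReal.ofReal p ≠ 0 := by simpa using by linarith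
  have h1 : (ENNReal.ofReal p).toReal = p := ENNReal.toReal_ofReal (by linarith)
  rw [hu.eLpNorm_eq_integral_rpow_norm h0 ENNReal.ofReal_ne_top, h1]

theorem integral_norm_rpow_nonneg {p : ℝ} {u : α → F} : 0 ≤ ∫ x, ‖u x‖ ^ p ∂μ :=
  integral_nonneg fun _ => by positivity

theorem tendsto_eLpNorm_iff {p : ℝ} (hp : 1 < p) {u : ℕ → α → F}
    (hu : ∀ n, MemLp (u n) (ENNReal.ofReal p) μ) :
    Tendsto (fun n => eLpNorm (u n) (ENNReal.ofReal p) μ) atTop (𝓝 0) ↔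
      Tendsto (fun n => ∫ x, ‖u n x‖ ^ p ∂μ) atTop (𝓝 0) := by
  have hp0 : 0 < p := by linarith
  simp_rw [fun n => eLpNorm_ofReal_eq hp (hu n)]
  constructor
  · intro h
    have h1 := (ENNReal.continuousAt_toReal ENNReal.zero_ne_top).tendsto.comp h
    have h2 : Tendsto (fun n => (∫ x, ‖u n x‖ ^ p ∂μ) ^ p⁻¹) atTop (𝓝 0) := by
      refine h1.congr fun n => ?_
      exact ENNReal.toReal_ofReal (Real.rpow_nonneg integral_norm_rpow_nonneg _)
    have h3 := (h2.rpow_const (p := p) (Or.inr hp0.le))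
    rw [Real.zero_rpow hp0.ne'] at h3
    refine h3.congr fun n => ?_
    rw [← Real.rpow_mul integral_norm_rpow_nonneg, inv_mul_cancel₀ hp0.ne', Real.rpow_one]
  · intro h
    have h2 := ENNReal.tendsto_ofReal (h.rpow_const (p := p⁻¹) (Or.inr (by positivity)))
    rwa [Real.zero_rpow (by positivity), ENNReal.ofReal_zero] at h2

/-- Given a tolerance, `η` is fixed first against the bounded integrals of `X`; then the integrals
of `Y` make the term with the possibly large constant `C` small. -/
theorem tendsto_integral_of_forall_abs_sub_le {f : ℕ → α → ℝ} {g : α → ℝ} {X Y : ℕ → α → ℝ}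
    (hf : ∀ n, Integrable (f n) μ) (hg : Integrable g μ) (hX : ∀ n, Integrable (X n) μ)
    (hY : ∀ n, Integrable (Y n) μ) {B : ℝ} (hXB : ∀ n, ∫ x, X n x ∂μ ≤ B)
    (hY0 : Tendsto (fun n => ∫ x, Y n x ∂μ) atTop (𝓝 0))
    (h : ∀ η : ℝ, 0 < η → ∃ C : ℝ, ∀ n x, |f n x - g x| ≤ η * X n x + C * Y n x) :
    Tendsto (fun n => ∫ x, f n x ∂μ) atTop (𝓝 (∫ x, g x ∂μ)) := by
  rw [Metric.tendsto_atTop]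
  intro ε hε
  have hB : 0 < |B| + 1 := by positivity
  obtain ⟨C, hC⟩ := h (ε / (2 * (|B| + 1))) (by positivity)
  have h1 : Tendsto (fun n => C * ∫ x, Y n x ∂μ) atTop (𝓝 0) := by
    simpa using hY0.const_mul C
  obtain ⟨n₀, hn₀⟩ := eventually_atTop.1 (h1.eventually_lt_const (half_pos hε))
  refine ⟨n₀, fun n hn => ?_⟩
  rw [Real.dist_eq, ← integral_sub (hf n) hg]
  calc |∫ x, f n x - g x ∂μ| ≤ ∫ x, |f n x - g x| ∂μ := abs_integral_le_integral_abs
    _ ≤ ∫ x, ε / (2 * (|B| + 1)) * X n x + C * Y n x ∂μ :=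
        integral_mono ((hf n).sub hg).abs (((hX n).const_mul _).add ((hY n).const_mul _)) (hC n)
    _ = ε / (2 * (|B| + 1)) * ∫ x, X n x ∂μ + C * ∫ x, Y n x ∂μ := by
        rw [integral_add ((hX n).const_mul _) ((hY n).const_mul _), integral_const_mul,
          integral_const_mul]
    _ < ε / (2 * (|B| + 1)) * (|B| + 1) + ε / 2 := by
        have h2 : ∫ x, X n x ∂μ ≤ |B| + 1 := by
          have := hXB n
          have := le_abs_self B
          linarith
        have h3 := hn₀ n hn
        have h4 := mul_le_mul_of_nonneg_left h2 (show 0 ≤ ε / (2 * (|B| + 1)) by positivity)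
        linarith
    _ = ε := by field_simp; ring

theorem integral_norm_add_rpow_le {p : ℝ} (hp : 1 < p) {u v : α → F}
    (hu : MemLp u (ENNReal.ofReal p) μ) (hv : MemLp v (ENNReal.ofReal p) μ) :
    ∫ x, ‖u x + v x‖ ^ p ∂μ ≤ 2 ^ p * (∫ x, ‖u x‖ ^ p ∂μ + ∫ x, ‖v x‖ ^ p ∂μ) := by
  rw [← integral_add (integrable_rpow_of_memLp hp hu) (integrable_rpow_of_memLp hp hv),
    ← integral_const_mul]
  exact integral_mono (integrable_rpow_of_memLp hp (hu.add hv))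
    (((integrable_rpow_of_memLp hp hu).add (integrable_rpow_of_memLp hp hv)).const_mul _)
    fun x => norm_add_rpow_le hp _ _

theorem integral_norm_sub_comm_rpow {p : ℝ} {u v : α → F} :
    ∫ x, ‖u x - v x‖ ^ p ∂μ = ∫ x, ‖v x - u x‖ ^ p ∂μ := by
  simp_rw [norm_sub_rev]

theorem exists_integral_norm_rpow_le {p : ℝ} (hp : 1 < p) {u : ℕ → α → F} {v : α → F}
    (hu : ∀ n, MemLp (u n) (ENNReal.ofReal p) μ) (hv : MemLp v (ENNReal.ofReal p) μ)
    (h : Tendsto (fun n => ∫ x, ‖u n x - v x‖ ^ p ∂μ) atTop (𝓝 0)) :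
    ∃ B : ℝ, ∀ n, ∫ x, ‖u n x‖ ^ p ∂μ ≤ B := by
  obtain ⟨B, hB⟩ := h.bddAbove_range
  refine ⟨2 ^ p * (B + ∫ x, ‖v x‖ ^ p ∂μ), fun n => ?_⟩
  have h1 := integral_norm_add_rpow_le hp ((hu n).sub hv) hv
  simp only [Pi.sub_apply, sub_add_cancel] at h1
  refine h1.trans ?_
  have := hB ⟨n, rfl⟩
  gcongr

theorem exists_memLp_limit [CompleteSpace F] {p : ℝ} (hp : 1 < p) {u : ℕ → α → F}
    (hu : ∀ n, MemLp (u n) (ENNReal.ofReal p) μ)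
    (h : ∀ ε : ℝ, 0 < ε → ∃ n₀, ∀ m ≥ n₀, ∀ n ≥ n₀, ∫ x, ‖u m x - u n x‖ ^ p ∂μ < ε) :
    ∃ v, MemLp v (ENNReal.ofReal p) μ ∧
      Tendsto (fun n => ∫ x, ‖u n x - v x‖ ^ p ∂μ) atTop (𝓝 0) := by
  have : Fact (1 ≤ ENNReal.ofReal p) := ⟨by simpa using hp.le⟩
  have hp0 : 0 < p := by linarith
  set U : ℕ → Lp F (ENNReal.ofReal p) μ := fun n => (hu n).toLp (u n) with hU
  have hc : CauchySeq U := by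
    rw [Metric.cauchySeq_iff]
    intro ε hε
    obtain ⟨n₀, hn₀⟩ := h (ε ^ p) (by positivity)
    refine ⟨n₀, fun m hm n hn => ?_⟩
    rw [dist_eq_norm, hU]
    simp only
    rw [← MemLp.toLp_sub, Lp.norm_toLp, eLpNorm_ofReal_eq hp ((hu m).sub (hu n)),
      ENNReal.toReal_ofReal (Real.rpow_nonneg integral_norm_rpow_nonneg _)]
    have h1 := Real.rpow_lt_rpow integral_norm_rpow_nonneg (hn₀ m hm n hn)
      (show 0 < p⁻¹ by positivity)
    rwa [← Real.rpow_mul hε.le, mul_inv_cancel₀ hp0.ne', Real.rpow_one] at h1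
  obtain ⟨V, hV⟩ := cauchySeq_tendsto_of_complete hc
  refine ⟨V, Lp.memLp V, ?_⟩
  rw [← Lp.toLp_coeFn V (Lp.memLp V)] at hV
  have h2 := (Lp.tendsto_Lp_iff_tendsto_eLpNorm'' u hu V (Lp.memLp V)).1 hV
  exact (tendsto_eLpNorm_iff hp fun n => (hu n).sub (Lp.memLp V)).1 h2

theorem exists_subseq_tendsto_ae {p : ℝ} (hp : 1 < p) {u : ℕ → α → F} {v : α → F}
    (hu : ∀ n, MemLp (u n) (ENNReal.ofReal p) μ) (hv : MemLp v (ENNReal.ofReal p) μ)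
    (h : Tendsto (fun n => ∫ x, ‖u n x - v x‖ ^ p ∂μ) atTop (𝓝 0)) :
    ∃ ns : ℕ → ℕ, StrictMono ns ∧
      ∀ᵐ x ∂μ, Tendsto (fun n => u (ns n) x) atTop (𝓝 (v x)) := by
  have h0 : ENNReal.ofReal p ≠ 0 := by simpa using by linarith
  exact (tendstoInMeasure_of_tendsto_eLpNorm h0 (fun n => (hu n).1) hv.1
    ((tendsto_eLpNorm_iff hp fun n => (hu n).sub hv).2 h)).exists_seq_tendsto_ae

theorem tendsto_integral_norm_sub_of_dominated {p : ℝ} (hp : 1 < p) {u : ℕ → α → F} {v : α → F}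
    (hu : ∀ n, AEStronglyMeasurable (u n) μ) {V : α → ℝ} (hV : Integrable (fun x => ‖V x‖ ^ p) μ)
    (hb : ∀ n, ∀ᵐ x ∂μ, ‖u n x‖ ≤ V x)
    (h : ∀ᵐ x ∂μ, Tendsto (fun n => u n x) atTop (𝓝 (v x))) :
    Tendsto (fun n => ∫ x, ‖u n x - v x‖ ^ p ∂μ) atTop (𝓝 0) := by
  have hp0 : 0 < p := by linarith
  have hv : AEStronglyMeasurable v μ := aestronglyMeasurable_of_tendsto_ae _ hu h
  have key := tendsto_integral_of_dominated_convergence (μ := μ)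
    (F := fun n x => ‖u n x - v x‖ ^ p) (f := fun _ => 0)
    (fun x => 2 ^ p * (‖V x‖ ^ p + ‖V x‖ ^ p))
    (fun n => (continuous_norm_rpow hp).comp_aestronglyMeasurable ((hu n).sub hv))
    ((hV.add hV).const_mul _) (fun n => ?_) ?_
  · simpa using key
  · filter_upwards [ae_all_iff.2 hb, h] with x hx hx2
    have h1 : ‖v x‖ ≤ V x := le_of_tendsto hx2.norm (Eventually.of_forall fun n => hx n)
    rw [Real.norm_of_nonneg (by positivity)]
    refine (norm_sub_rpow_le hp _ _).trans ?_
    have h2 : V x ≤ ‖V x‖ := le_abs_self _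
    have := hx n
    gcongr <;> linarith
  · filter_upwards [h] with x hx
    have h1 := ((continuous_norm_rpow (F := F) hp).tendsto 0).comp
      (tendsto_sub_nhds_zero_iff.2 hx)
    rw [norm_zero, Real.zero_rpow hp0.ne'] at h1
    exact h1

theorem tendsto_integral_norm_sub_trans {p : ℝ} (hp : 1 < p) {u v : ℕ → α → F} {w : α → F}
    (huv : ∀ n, MemLp (fun x => u n x - v n x) (ENNReal.ofReal p) μ)
    (hvw : ∀ n, MemLp (fun x => v n x - w x) (ENNReal.ofReal p) μ)
    (h1 : Tendsto (fun n => ∫ x, ‖u n x - v n x‖ ^ p ∂μ) atTop (𝓝 0))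
    (h2 : Tendsto (fun n => ∫ x, ‖v n x - w x‖ ^ p ∂μ) atTop (𝓝 0)) :
    Tendsto (fun n => ∫ x, ‖u n x - w x‖ ^ p ∂μ) atTop (𝓝 0) := by
  have h3 := (h1.add h2).const_mul (2 ^ p)
  rw [add_zero, mul_zero] at h3
  refine squeeze_zero (fun n => integral_norm_rpow_nonneg) (fun n => ?_) h3
  have := integral_norm_add_rpow_le hp (huv n) (hvw n)
  simpa only [sub_add_sub_cancel] using this

theorem memLp_smul_of_bounded [NormedSpace ℝ F] {p : ℝ} {c : α → ℝ} {w : α → F} {C : ℝ}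
    (hc : AEStronglyMeasurable c μ) (hC : ∀ᵐ x ∂μ, |c x| ≤ C)
    (hw : MemLp w (ENNReal.ofReal p) μ) :
    MemLp (fun x => c x • w x) (ENNReal.ofReal p) μ := by
  refine (hw.const_smul C).mono (hc.smul hw.1) ?_
  filter_upwards [hC] with x hx
  rw [Pi.smul_apply, norm_smul, norm_smul, Real.norm_eq_abs, Real.norm_eq_abs]
  exact mul_le_mul_of_nonneg_right (hx.trans (le_abs_self C)) (norm_nonneg _)

theorem memLp_smul_of_tendsto [NormedSpace ℝ F] {p : ℝ} {c : ℕ → α → ℝ} {d : α → ℝ}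
    {w : α → F} {C : ℝ} (hc : ∀ n, AEStronglyMeasurable (c n) μ) (hC : ∀ n x, |c n x| ≤ C)
    (hcd : ∀ᵐ x ∂μ, Tendsto (fun n => c n x) atTop (𝓝 (d x)))
    (hw : MemLp w (ENNReal.ofReal p) μ) :
    MemLp (fun x => d x • w x) (ENNReal.ofReal p) μ := by
  refine memLp_smul_of_bounded (aestronglyMeasurable_of_tendsto_ae _ hc hcd) ?_ hw (C := C)
  filter_upwards [hcd] with x hx
  exact le_of_tendsto hx.abs (Eventually.of_forall fun n => hC n x)

/-- Splitting `c_n u_n - d v = c_n (u_n - v) + (c_n - d) v`: boundedness of `c_n` handles the first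
term, dominated convergence the second. -/
theorem tendsto_integral_smul_of_bounded [NormedSpace ℝ F] {p : ℝ} (hp : 1 < p)
    {u : ℕ → α → F} {v : α → F} {c : ℕ → α → ℝ} {d : α → ℝ} {C : ℝ}
    (hu : ∀ n, MemLp (u n) (ENNReal.ofReal p) μ) (hv : MemLp v (ENNReal.ofReal p) μ)
    (hc : ∀ n, AEStronglyMeasurable (c n) μ) (hC : ∀ n x, |c n x| ≤ C)
    (h : Tendsto (fun n => ∫ x, ‖u n x - v x‖ ^ p ∂μ) atTop (𝓝 0))
    (hcd : ∀ᵐ x ∂μ, Tendsto (fun n => c n x) atTop (𝓝 (d x))) :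
    Tendsto (fun n => ∫ x, ‖c n x • u n x - d x • v x‖ ^ p ∂μ) atTop (𝓝 0) := by
  have h1 : Tendsto (fun n => ∫ x, ‖c n x • u n x - c n x • v x‖ ^ p ∂μ) atTop (𝓝 0) := by
    have h2 := h.const_mul (|C| ^ p)
    rw [mul_zero] at h2
    refine squeeze_zero (fun n => integral_norm_rpow_nonneg) (fun n => ?_) h2
    rw [← integral_const_mul]
    refine integral_mono_of_nonneg (Eventually.of_forall fun x => by positivity)
      ((integrable_rpow_of_memLp hp ((hu n).sub hv)).const_mul _)
      (Eventually.of_forall fun x => ?_)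
    simp only
    rw [← smul_sub, norm_smul, Real.mul_rpow (norm_nonneg _) (norm_nonneg _), Real.norm_eq_abs]
    have := (hC n x).trans (le_abs_self C)
    gcongr
  have h2 : Tendsto (fun n => ∫ x, ‖c n x • v x - d x • v x‖ ^ p ∂μ) atTop (𝓝 0) := by
    refine tendsto_integral_norm_sub_of_dominated hp (V := fun x => |C| * ‖v x‖)
      (fun n => (hc n).smul hv.1) ?_ (fun n => Eventually.of_forall fun x => ?_) ?_
    · exact integrable_rpow_of_memLp hp (hv.norm.const_mul |C|)
    · rw [norm_smul, Real.norm_eq_abs]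
      have := (hC n x).trans (le_abs_self C)
      gcongr
    · filter_upwards [hcd] with x hx
      exact hx.smul_const _
  have hcn := fun n => memLp_smul_of_bounded (hc n) (Eventually.of_forall (hC n)) hv
  exact tendsto_integral_norm_sub_trans hp
    (fun n => (memLp_smul_of_bounded (hc n) (Eventually.of_forall (hC n)) (hu n)).sub (hcn n))
    (fun n => (hcn n).sub (memLp_smul_of_tendsto hc hC hcd hv)) h1 h2

theorem integrable_of_memLp_ofReal [IsFiniteMeasure μ] {p : ℝ} (hp : 1 < p) {u : α → F}
    (hu : MemLp u (ENNReal.ofReal p) μ) : Integrable u μ :=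
  hu.integrable (by simpa using hp.le)

end LpTools

/-! ### Continuity of flux pairings along `L^p` limits -/

section FluxIntegrals

variable {α : Type*} {mα : MeasurableSpace α} {μ : Measure α}
variable {F : Type*} [NormedAddCommGroup F] [InnerProductSpace ℝ F] [FiniteDimensional ℝ F]

theorem integrable_inner_pFlux {p : ℝ} (hp : 1 < p) {u h : α → F}
    (hu : MemLp u (ENNReal.ofReal p) μ) (hh : MemLp h (ENNReal.ofReal p) μ) :
    Integrable (fun x => inner ℝ (pFlux p (u x)) (h x)) μ := by
  obtain ⟨C, hC0, hC⟩ := exists_inner_pFlux_le_left (F := F) hp one_pos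
  refine Integrable.mono' (((integrable_rpow_of_memLp hp hh).const_mul 1).add
    ((integrable_rpow_of_memLp hp hu).const_mul C))
    (((continuous_pFlux hp).comp_aestronglyMeasurable hu.1).inner hh.1)
    (Eventually.of_forall fun x => hC _ _)

theorem tendsto_integral_norm_rpow {p : ℝ} (hp : 1 < p) {u : ℕ → α → F} {v : α → F}
    (hu : ∀ n, MemLp (u n) (ENNReal.ofReal p) μ) (hv : MemLp v (ENNReal.ofReal p) μ)
    (h : Tendsto (fun n => ∫ x, ‖u n x - v x‖ ^ p ∂μ) atTop (𝓝 0)) :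
    Tendsto (fun n => ∫ x, ‖u n x‖ ^ p ∂μ) atTop (𝓝 (∫ x, ‖v x‖ ^ p ∂μ)) := by
  refine tendsto_integral_of_forall_abs_sub_le (X := fun _ x => ‖v x‖ ^ p)
    (Y := fun n x => ‖u n x - v x‖ ^ p) (fun n => integrable_rpow_of_memLp hp (hu n))
    (integrable_rpow_of_memLp hp hv) (fun n => integrable_rpow_of_memLp hp hv)
    (fun n => integrable_rpow_of_memLp hp ((hu n).sub hv)) (fun n => le_rfl) h fun η hη => ?_
  obtain ⟨C, -, hC⟩ := exists_abs_norm_rpow_sub_le (F := F) hp hη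
  exact ⟨C, fun n x => hC _ _⟩

theorem tendsto_integral_inner_pFlux {p : ℝ} (hp : 1 < p) {u : ℕ → α → F} {v h : α → F}
    (hu : ∀ n, MemLp (u n) (ENNReal.ofReal p) μ) (hv : MemLp v (ENNReal.ofReal p) μ)
    (hh : MemLp h (ENNReal.ofReal p) μ)
    (hlim : Tendsto (fun n => ∫ x, ‖u n x - v x‖ ^ p ∂μ) atTop (𝓝 0)) :
    Tendsto (fun n => ∫ x, inner ℝ (pFlux p (u n x)) (h x) ∂μ) atTop
      (𝓝 (∫ x, inner ℝ (pFlux p (v x)) (h x) ∂μ)) := by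
  obtain ⟨B, hB⟩ := exists_integral_norm_rpow_le hp hu hv hlim
  have hui := fun n => integrable_rpow_of_memLp hp (hu n)
  have hvi := integrable_rpow_of_memLp hp hv
  have hhi := integrable_rpow_of_memLp hp hh
  refine tendsto_integral_of_forall_abs_sub_le
    (X := fun n x => ‖u n x‖ ^ p + ‖v x‖ ^ p + ‖h x‖ ^ p)
    (Y := fun n x => ‖u n x - v x‖ ^ p) (fun n => integrable_inner_pFlux hp (hu n) hh)
    (integrable_inner_pFlux hp hv hh) (fun n => ((hui n).add hvi).add hhi)
    (fun n => integrable_rpow_of_memLp hp ((hu n).sub hv))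
    (B := B + ∫ x, ‖v x‖ ^ p ∂μ + ∫ x, ‖h x‖ ^ p ∂μ) (fun n => ?_) hlim fun η hη => ?_
  · have huv : Integrable (fun x => ‖u n x‖ ^ p + ‖v x‖ ^ p) μ := (hui n).add hvi
    rw [integral_add huv hhi, integral_add (hui n) hvi]
    have := hB n
    linarith
  · obtain ⟨C, -, hC⟩ := exists_inner_pFlux_sub_le (F := F) hp hη
    refine ⟨C, fun n x => ?_⟩
    rw [← inner_sub_left]
    exact hC _ _ _

theorem tendsto_integral_inner_pFlux_right {p : ℝ} (hp : 1 < p) {u : ℕ → α → F} {v h : α → F}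
    (hu : ∀ n, MemLp (u n) (ENNReal.ofReal p) μ) (hv : MemLp v (ENNReal.ofReal p) μ)
    (hh : MemLp h (ENNReal.ofReal p) μ)
    (hlim : Tendsto (fun n => ∫ x, ‖u n x - v x‖ ^ p ∂μ) atTop (𝓝 0)) :
    Tendsto (fun n => ∫ x, inner ℝ (pFlux p (h x)) (u n x) ∂μ) atTop
      (𝓝 (∫ x, inner ℝ (pFlux p (h x)) (v x) ∂μ)) := by
  refine tendsto_integral_of_forall_abs_sub_le (X := fun _ x => ‖h x‖ ^ p)
    (Y := fun n x => ‖u n x - v x‖ ^ p) (fun n => integrable_inner_pFlux hp hh (hu n))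
    (integrable_inner_pFlux hp hh hv) (fun n => integrable_rpow_of_memLp hp hh)
    (fun n => integrable_rpow_of_memLp hp ((hu n).sub hv)) (fun n => le_rfl) hlim fun η hη => ?_
  obtain ⟨C, -, hC⟩ := exists_inner_pFlux_le_right (F := F) hp hη
  refine ⟨C, fun n x => ?_⟩
  rw [← inner_sub_right]
  exact hC _ _

/-- The integral is the pairing with the flux of the constant `1`, which belongs to `L^p` of a
finite measure. -/
theorem tendsto_integral_of_tendsto_rpow [IsFiniteMeasure μ] {p : ℝ} (hp : 1 < p)
    {u : ℕ → α → ℝ} {v : α → ℝ}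
    (hu : ∀ n, MemLp (u n) (ENNReal.ofReal p) μ) (hv : MemLp v (ENNReal.ofReal p) μ)
    (h : Tendsto (fun n => ∫ x, ‖u n x - v x‖ ^ p ∂μ) atTop (𝓝 0)) :
    Tendsto (fun n => ∫ x, u n x ∂μ) atTop (𝓝 (∫ x, v x ∂μ)) := by
  have h1 := tendsto_integral_inner_pFlux_right hp hu hv (memLp_const (1 : ℝ)) h
  simpa [pFlux] using h1

end FluxIntegrals

/-! ### The Gaussian measure against Lebesgue measure -/

section GaussBasics

variable {N : ℕ}

theorem continuous_gaussDensity : Continuous (gaussDensity N) := by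
  unfold gaussDensity
  fun_prop

theorem gaussDensity_pos (x : EuclideanSpace ℝ (Fin N)) : 0 < gaussDensity N x := by
  unfold gaussDensity
  positivity

theorem measurable_ofReal_gaussDensity :
    Measurable fun x => ENNReal.ofReal (gaussDensity N x) :=
  continuous_gaussDensity.measurable.ennreal_ofReal

theorem integrableOn_gaussMeasure_iff {F : Type*} [NormedAddCommGroup F] [NormedSpace ℝ F]
    {s : Set (EuclideanSpace ℝ (Fin N))} (hs : MeasurableSet s)
    {f : EuclideanSpace ℝ (Fin N) → F} :
    IntegrableOn f s (gaussMeasure N) ↔ IntegrableOn (fun x => gaussDensity N x • f x) s := by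
  rw [IntegrableOn, gaussMeasure, restrict_withDensity hs,
    integrable_withDensity_iff_integrable_smul' measurable_ofReal_gaussDensity (by simp)]
  simp_rw [fun x => ENNReal.toReal_ofReal (gaussDensity_pos (N := N) x).le]
  rfl

theorem setIntegral_gaussMeasure {F : Type*} [NormedAddCommGroup F] [NormedSpace ℝ F]
    {s : Set (EuclideanSpace ℝ (Fin N))} (hs : MeasurableSet s)
    (f : EuclideanSpace ℝ (Fin N) → F) :
    ∫ x in s, f x ∂(gaussMeasure N) = ∫ x in s, gaussDensity N x • f x := by
  rw [gaussMeasure, restrict_withDensity hs,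
    integral_withDensity_eq_integral_toReal_smul measurable_ofReal_gaussDensity (by simp)]
  simp_rw [fun x => ENNReal.toReal_ofReal (gaussDensity_pos (N := N) x).le]

theorem gaussMeasure_absolutelyContinuous : gaussMeasure N ≪ volume :=
  withDensity_absolutelyContinuous _ _

theorem absolutelyContinuous_gaussMeasure :
    (volume : Measure (EuclideanSpace ℝ (Fin N))) ≪ gaussMeasure N :=
  withDensity_absolutelyContinuous' measurable_ofReal_gaussDensity.aemeasurable
    (Eventually.of_forall fun x => by simpa using gaussDensity_pos x)

theorem ae_restrict_gaussMeasure_iff {Ω : Set (EuclideanSpace ℝ (Fin N))}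
    {P : EuclideanSpace ℝ (Fin N) → Prop} :
    (∀ᵐ x ∂((gaussMeasure N).restrict Ω), P x) ↔ ∀ᵐ x ∂(volume.restrict Ω), P x :=
  ⟨fun h => (absolutelyContinuous_gaussMeasure.restrict Ω).ae_le h,
    fun h => (gaussMeasure_absolutelyContinuous.restrict Ω).ae_le h⟩

/-- On a compact set the reciprocal of the density is continuous, so multiplying by it preserves
integrability. -/
theorem locallyIntegrableOn_of_integrableOn_gaussMeasure {F : Type*} [NormedAddCommGroup F]
    [NormedSpace ℝ F] {Ω : Set (EuclideanSpace ℝ (Fin N))} (hΩ : IsOpen Ω)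
    {f : EuclideanSpace ℝ (Fin N) → F} (hf : IntegrableOn f Ω (gaussMeasure N)) :
    LocallyIntegrableOn f Ω volume := by
  rw [locallyIntegrableOn_iff hΩ.isLocallyClosed]
  intro k hk hkc
  have h1 := (integrableOn_gaussMeasure_iff hkc.measurableSet).1 (hf.mono_set hk)
  have h2 := h1.continuousOn_smul (f := fun x => (gaussDensity N x)⁻¹)
    (continuous_gaussDensity.inv₀ fun x => (gaussDensity_pos x).ne').continuousOn hkc
  simpa only [smul_smul, inv_mul_cancel₀ (gaussDensity_pos _).ne', one_smul] using h2

end GaussBasics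

/-! ### Calculus rules for gradients -/

section GradientCalculus

variable {F : Type*} [NormedAddCommGroup F] [InnerProductSpace ℝ F] [CompleteSpace F]

theorem gradient_fun_add {f g : F → ℝ} {x : F} (hf : DifferentiableAt ℝ f x)
    (hg : DifferentiableAt ℝ g x) :
    gradient (fun y => f y + g y) x = gradient f x + gradient g x := by
  refine ext_inner_right ℝ fun e => ?_
  rw [inner_add_left, inner_gradient_left, inner_gradient_left, inner_gradient_left,
    fderiv_fun_add hf hg]
  rfl

theorem gradient_fun_mul {f g : F → ℝ} {x : F} (hf : DifferentiableAt ℝ f x)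
    (hg : DifferentiableAt ℝ g x) :
    gradient (fun y => f y * g y) x = f x • gradient g x + g x • gradient f x := by
  refine ext_inner_right ℝ fun e => ?_
  rw [inner_add_left, inner_smul_left, inner_smul_left, inner_gradient_left, inner_gradient_left,
    inner_gradient_left, fderiv_fun_mul hf hg]
  rfl

theorem gradient_comp_deriv {G : ℝ → ℝ} {G' : ℝ} {f : F → ℝ} {x : F}
    (hG : HasDerivAt G G' (f x)) (hf : DifferentiableAt ℝ f x) :
    gradient (fun y => G (f y)) x = G' • gradient f x := by
  refine ext_inner_right ℝ fun e => ?_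
  have h := hG.comp_hasFDerivAt x hf.hasFDerivAt
  rw [inner_smul_left, inner_gradient_left, inner_gradient_left, show (fun y => G (f y)) = G ∘ f
    from rfl, h.fderiv]
  simp

theorem continuous_gradient {f : F → ℝ} (hf : ContDiff ℝ 1 f) : Continuous (gradient f) :=
  (InnerProductSpace.toDual ℝ F).symm.continuous.comp (hf.continuous_fderiv one_ne_zero)

theorem norm_gradient (f : F → ℝ) (x : F) : ‖gradient f x‖ = ‖fderiv ℝ f x‖ :=
  (InnerProductSpace.toDual ℝ F).symm.norm_map _

end GradientCalculus

/-! ### Test functions -/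

section TestFunctions

variable {N : ℕ} {Ω : Set (EuclideanSpace ℝ (Fin N))} {φ ψ : EuclideanSpace ℝ (Fin N) → ℝ}

theorem IsTestFunction.contDiff_one (h : IsTestFunction Ω φ) : ContDiff ℝ 1 φ :=
  h.1.of_le (by exact_mod_cast le_top)

theorem IsTestFunction.differentiable (h : IsTestFunction Ω φ) : Differentiable ℝ φ :=
  h.contDiff_one.differentiable one_ne_zero

theorem IsTestFunction.add (hφ : IsTestFunction Ω φ) (hψ : IsTestFunction Ω ψ) :
    IsTestFunction Ω (fun x => φ x + ψ x) :=
  ⟨hφ.1.add hψ.1, hφ.2.1.add hψ.2.1,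
    (tsupport_add φ ψ).trans (union_subset hφ.2.2 hψ.2.2)⟩

theorem IsTestFunction.of_zero (hφ : IsTestFunction Ω φ) (hψ : ContDiff ℝ ∞ ψ)
    (h : ∀ x, φ x = 0 → ψ x = 0) : IsTestFunction Ω ψ := by
  have hs : Function.support ψ ⊆ Function.support φ := fun x hx hx' => hx (h x hx')
  have ht : tsupport ψ ⊆ tsupport φ := closure_mono hs
  exact ⟨hψ, hφ.2.1.mono hs, ht.trans hφ.2.2⟩

theorem IsTestFunction.const_mul (hφ : IsTestFunction Ω φ) (c : ℝ) :
    IsTestFunction Ω (fun x => c * φ x) :=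
  hφ.of_zero (contDiff_const.mul hφ.1) fun x hx => by simp [hx]

theorem IsTestFunction.comp {G : ℝ → ℝ} (hφ : IsTestFunction Ω φ) (hG : ContDiff ℝ ∞ G)
    (hG0 : G 0 = 0) : IsTestFunction Ω (fun x => G (φ x)) :=
  hφ.of_zero (hG.comp hφ.1) fun x hx => by simp [hx, hG0]

theorem IsTestFunction.hasCompactSupport_gradient (hφ : IsTestFunction Ω φ) :
    HasCompactSupport (gradient φ) :=
  (hφ.2.1.fderiv ℝ).comp_left (map_zero (InnerProductSpace.toDual ℝ _).symm)

theorem IsTestFunction.memLp {μ : Measure (EuclideanSpace ℝ (Fin N))} [IsFiniteMeasure μ]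
    (hφ : IsTestFunction Ω φ) (q : ℝ≥0∞) : MemLp φ q μ := by
  obtain ⟨C, hC⟩ := hφ.2.1.exists_bound_of_continuous hφ.1.continuous
  exact MemLp.of_bound hφ.1.continuous.aestronglyMeasurable C (Eventually.of_forall hC)

theorem IsTestFunction.memLp_gradient {μ : Measure (EuclideanSpace ℝ (Fin N))}
    [IsFiniteMeasure μ] (hφ : IsTestFunction Ω φ) (q : ℝ≥0∞) : MemLp (gradient φ) q μ := by
  have hc := continuous_gradient hφ.contDiff_one
  obtain ⟨C, hC⟩ := hφ.hasCompactSupport_gradient.exists_bound_of_continuous hc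
  exact MemLp.of_bound hc.aestronglyMeasurable C (Eventually.of_forall hC)

theorem IsTestFunction.eq_zero_of_notMem (hφ : IsTestFunction Ω φ) {x : EuclideanSpace ℝ (Fin N)}
    (hx : x ∉ Ω) : φ x = 0 :=
  image_eq_zero_of_notMem_tsupport fun h => hx (hφ.2.2 h)

theorem IsTestFunction.fderiv_eq_zero_of_notMem (hφ : IsTestFunction Ω φ)
    {x : EuclideanSpace ℝ (Fin N)} (hx : x ∉ Ω) : fderiv ℝ φ x = 0 :=
  image_eq_zero_of_notMem_tsupport fun h => hx (hφ.2.2 (tsupport_fderiv_subset ℝ h))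

theorem IsTestFunction.integral_mul_fderiv (hφ : IsTestFunction Ω φ) (hψ : IsTestFunction Ω ψ)
    (e : EuclideanSpace ℝ (Fin N)) :
    ∫ x in Ω, φ x * fderiv ℝ ψ x e = -∫ x in Ω, inner ℝ (gradient φ x) e * ψ x := by
  rw [setIntegral_eq_integral_of_forall_compl_eq_zero (fun x hx => by
      rw [hφ.eq_zero_of_notMem hx, zero_mul]),
    setIntegral_eq_integral_of_forall_compl_eq_zero (fun x hx => by
      rw [hψ.eq_zero_of_notMem hx, mul_zero])]
  simp_rw [inner_gradient_left]
  have hc : ∀ {χ : EuclideanSpace ℝ (Fin N) → ℝ}, IsTestFunction Ω χ →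
      Continuous fun x => fderiv ℝ χ x e := fun h =>
    (h.contDiff_one.continuous_fderiv one_ne_zero).clm_apply continuous_const
  refine integral_mul_fderiv_eq_neg_fderiv_mul_of_integrable ?_ ?_ ?_
    (fun x _ => hφ.differentiable x) (fun x _ => hψ.differentiable x)
  · exact ((hc hφ).mul hψ.1.continuous).integrable_of_hasCompactSupport hψ.2.1.mul_left
  · exact (hφ.1.continuous.mul (hc hψ)).integrable_of_hasCompactSupport hφ.2.1.mul_right
  · exact (hφ.1.continuous.mul hψ.1.continuous).integrable_of_hasCompactSupport hφ.2.1.mul_right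

end TestFunctions

/-! ### `W_0^{1,p}` as sequential limits of classes of test functions -/

section Approximation

variable {N : ℕ}

/-- `(u, g)` is the limit in `L^p(Ω, γ_N)` of pairs `(φ, Dφ)` with `φ ∈ S`. -/
def ApproxBy (S : Set (EuclideanSpace ℝ (Fin N) → ℝ)) (p : ℝ)
    (Ω : Set (EuclideanSpace ℝ (Fin N))) (u : EuclideanSpace ℝ (Fin N) → ℝ)
    (g : EuclideanSpace ℝ (Fin N) → EuclideanSpace ℝ (Fin N)) : Prop :=
  MemLp u (ENNReal.ofReal p) ((gaussMeasure N).restrict Ω) ∧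
    MemLp g (ENNReal.ofReal p) ((gaussMeasure N).restrict Ω) ∧
    ∃ φ : ℕ → EuclideanSpace ℝ (Fin N) → ℝ, (∀ n, φ n ∈ S) ∧
      Tendsto (fun n => ∫ x in Ω, ‖φ n x - u x‖ ^ p ∂(gaussMeasure N)) atTop (𝓝 0) ∧
      Tendsto (fun n => ∫ x in Ω, ‖gradient (φ n) x - g x‖ ^ p ∂(gaussMeasure N)) atTop (𝓝 0)

variable {Ω : Set (EuclideanSpace ℝ (Fin N))} {p : ℝ}
  {S : Set (EuclideanSpace ℝ (Fin N) → ℝ)} {u v : EuclideanSpace ℝ (Fin N) → ℝ}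
  {g h : EuclideanSpace ℝ (Fin N) → EuclideanSpace ℝ (Fin N)}

theorem ApproxBy.mono {T : Set (EuclideanSpace ℝ (Fin N) → ℝ)} (hST : S ⊆ T)
    (hu : ApproxBy S p Ω u g) : ApproxBy T p Ω u g := by
  obtain ⟨h1, h2, φ, h3, h4⟩ := hu
  exact ⟨h1, h2, φ, fun n => hST (h3 n), h4⟩

theorem ApproxBy.congr_ae (hu : ApproxBy S p Ω u g)
    (huv : ∀ᵐ x ∂((gaussMeasure N).restrict Ω), u x = v x)
    (hgh : ∀ᵐ x ∂((gaussMeasure N).restrict Ω), g x = h x) : ApproxBy S p Ω v h := by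
  obtain ⟨h1, h2, φ, h3, h4, h5⟩ := hu
  refine ⟨h1.ae_eq huv, h2.ae_eq hgh, φ, h3, h4.congr fun n => integral_congr_ae ?_,
    h5.congr fun n => integral_congr_ae ?_⟩
  · filter_upwards [huv] with x hx
    rw [hx]
  · filter_upwards [hgh] with x hx
    rw [hx]

variable [IsFiniteMeasure ((gaussMeasure N).restrict Ω)]

theorem IsTestFunction.approxBy (hp : 1 < p) {φ : EuclideanSpace ℝ (Fin N) → ℝ}
    (hφ : IsTestFunction Ω φ) (hS : φ ∈ S) : ApproxBy S p Ω φ (gradient φ) := by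
  have h0 : (0 : ℝ) ^ p = 0 := Real.zero_rpow (by linarith)
  exact ⟨hφ.memLp _, hφ.memLp_gradient _, fun _ => φ, fun _ => hS, by simp [h0], by simp [h0]⟩

/-- The set of pairs approximable by `S` is closed in `L^p`. -/
theorem approxBy_of_tendsto (hp : 1 < p) (hS : ∀ φ ∈ S, IsTestFunction Ω φ)
    {us : ℕ → EuclideanSpace ℝ (Fin N) → ℝ}
    {gs : ℕ → EuclideanSpace ℝ (Fin N) → EuclideanSpace ℝ (Fin N)}
    (hs : ∀ n, ApproxBy S p Ω (us n) (gs n))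
    (hu : MemLp u (ENNReal.ofReal p) ((gaussMeasure N).restrict Ω))
    (hg : MemLp g (ENNReal.ofReal p) ((gaussMeasure N).restrict Ω))
    (hul : Tendsto (fun n => ∫ x in Ω, ‖us n x - u x‖ ^ p ∂(gaussMeasure N)) atTop (𝓝 0))
    (hgl : Tendsto (fun n => ∫ x in Ω, ‖gs n x - g x‖ ^ p ∂(gaussMeasure N)) atTop (𝓝 0)) :
    ApproxBy S p Ω u g := by
  have key : ∀ n : ℕ, ∃ φ ∈ S, ∫ x in Ω, ‖φ x - us n x‖ ^ p ∂(gaussMeasure N) < 1 / ((n : ℝ) + 1) ∧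
      ∫ x in Ω, ‖gradient φ x - gs n x‖ ^ p ∂(gaussMeasure N) < 1 / ((n : ℝ) + 1) := by
    intro n
    obtain ⟨-, -, φ, hφS, h1, h2⟩ := hs n
    have hn : (0 : ℝ) < 1 / ((n : ℝ) + 1) := by positivity
    obtain ⟨m, hm1, hm2⟩ := ((h1.eventually_lt_const hn).and (h2.eventually_lt_const hn)).exists
    exact ⟨φ m, hφS m, hm1, hm2⟩
  choose φ hφS hφ1 hφ2 using key
  have ht := fun n => hS (φ n) (hφS n)
  refine ⟨hu, hg, φ, hφS, ?_, ?_⟩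
  · exact tendsto_integral_norm_sub_trans hp (fun n => ((ht n).memLp _).sub (hs n).1)
      (fun n => (hs n).1.sub hu)
      (squeeze_zero (fun n => integral_norm_rpow_nonneg) (fun n => (hφ1 n).le)
        tendsto_one_div_add_atTop_nhds_zero_nat) hul
  · exact tendsto_integral_norm_sub_trans hp (fun n => ((ht n).memLp_gradient _).sub (hs n).2.1)
      (fun n => (hs n).2.1.sub hg)
      (squeeze_zero (fun n => integral_norm_rpow_nonneg) (fun n => (hφ2 n).le)
        tendsto_one_div_add_atTop_nhds_zero_nat) hgl

/-- The Lebesgue pairing with `w` is the Gaussian integral against `w` divided by the density, a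
bounded factor because `w` has compact support. -/
theorem tendsto_setIntegral_mul_of_tendsto (hΩ : IsOpen Ω) (hp : 1 < p)
    {us : ℕ → EuclideanSpace ℝ (Fin N) → ℝ} {w : EuclideanSpace ℝ (Fin N) → ℝ}
    (hus : ∀ n, MemLp (us n) (ENNReal.ofReal p) ((gaussMeasure N).restrict Ω))
    (hu : MemLp u (ENNReal.ofReal p) ((gaussMeasure N).restrict Ω))
    (hul : Tendsto (fun n => ∫ x in Ω, ‖us n x - u x‖ ^ p ∂(gaussMeasure N)) atTop (𝓝 0))
    (hw : Continuous w) (hwc : HasCompactSupport w) :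
    Tendsto (fun n => ∫ x in Ω, us n x * w x) atTop (𝓝 (∫ x in Ω, u x * w x)) := by
  set c : EuclideanSpace ℝ (Fin N) → ℝ := fun x => (gaussDensity N x)⁻¹ * w x with hc
  have hcc : Continuous c :=
    (continuous_gaussDensity.inv₀ fun x => (gaussDensity_pos x).ne').mul hw
  obtain ⟨C, hC⟩ := (hwc.mul_left (f := fun x => (gaussDensity N x)⁻¹)).exists_bound_of_continuous
    hcc
  have hcm : AEStronglyMeasurable c ((gaussMeasure N).restrict Ω) := hcc.aestronglyMeasurable
  have h1 := tendsto_integral_smul_of_bounded hp hus hu (c := fun _ => c) (d := c) (fun _ => hcm)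
    (fun n x => hC x) hul (Eventually.of_forall fun x => tendsto_const_nhds)
  have h2 := tendsto_integral_of_tendsto_rpow hp
    (fun n => memLp_smul_of_bounded hcm (Eventually.of_forall hC) (hus n))
    (memLp_smul_of_bounded hcm (Eventually.of_forall hC) hu) h1
  have key : ∀ f : EuclideanSpace ℝ (Fin N) → ℝ,
      ∫ x in Ω, c x • f x ∂(gaussMeasure N) = ∫ x in Ω, f x * w x := by
    intro f
    rw [setIntegral_gaussMeasure hΩ.measurableSet]
    refine integral_congr_ae (Eventually.of_forall fun x => ?_)
    have := (gaussDensity_pos x).ne'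
    simp only [hc, smul_eq_mul]
    field_simp
  simpa only [key] using h2

/-- Classical integration by parts for the approximating test functions passes to the limit on both
sides. -/
theorem hasWeakGradient_of_approxBy (hΩ : IsOpen Ω) (hp : 1 < p)
    (hu : ApproxBy {φ | IsTestFunction Ω φ} p Ω u g) : HasWeakGradient Ω u g := by
  obtain ⟨hu, hg, φ, hφ, h1, h2⟩ := hu
  refine ⟨locallyIntegrableOn_of_integrableOn_gaussMeasure hΩ (integrable_of_memLp_ofReal hp hu),
    locallyIntegrableOn_of_integrableOn_gaussMeasure hΩ (integrable_of_memLp_ofReal hp hg),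
    fun ψ hψ e => ?_⟩
  have hd : Continuous fun x => fderiv ℝ ψ x e :=
    (hψ.contDiff_one.continuous_fderiv one_ne_zero).clm_apply continuous_const
  have hds : HasCompactSupport fun x => fderiv ℝ ψ x e :=
    (hψ.2.1.fderiv ℝ).comp_left (g := fun L : EuclideanSpace ℝ (Fin N) →L[ℝ] ℝ => L e) rfl
  have h3 := tendsto_setIntegral_mul_of_tendsto hΩ hp (fun n => (hφ n).memLp _) hu h1 hd hds
  have h4 : Tendsto (fun n => ∫ x in Ω, ‖inner ℝ (gradient (φ n) x) e - inner ℝ (g x) e‖ ^ p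
      ∂(gaussMeasure N)) atTop (𝓝 0) := by
    have h5 := h2.mul_const (‖e‖ ^ p)
    rw [zero_mul] at h5
    refine squeeze_zero (fun n => integral_norm_rpow_nonneg) (fun n => ?_) h5
    rw [← integral_mul_const]
    refine integral_mono_of_nonneg (Eventually.of_forall fun x => by positivity)
      ((integrable_rpow_of_memLp hp (((hφ n).memLp_gradient _).sub hg)).mul_const _)
      (Eventually.of_forall fun x => ?_)
    simp only
    rw [← inner_sub_left, ← Real.mul_rpow (norm_nonneg _) (norm_nonneg _)]
    exact Real.rpow_le_rpow (norm_nonneg _) (norm_inner_le_norm _ _) (by linarith)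
  have h5 := tendsto_setIntegral_mul_of_tendsto hΩ hp
    (fun n => ((hφ n).memLp_gradient _).inner_const e) (hg.inner_const e) h4 hψ.1.continuous hψ.2.1
  refine tendsto_nhds_unique h3 ?_
  simpa only [fun n => (hφ n).integral_mul_fderiv hψ e] using h5.neg

/-- Lets the whole argument work with approximating sequences only; the weak gradient relation is
automatic for such limits. -/
theorem memW1pZero_iff (hΩ : IsOpen Ω) (hp : 1 < p) :
    MemW1pZero p Ω u g ↔ ApproxBy {φ | IsTestFunction Ω φ} p Ω u g := by
  constructor
  · rintro ⟨⟨-, hu, hg⟩, h⟩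
    have key : ∀ n : ℕ, ∃ φ, IsTestFunction Ω φ ∧
        eLpNorm (fun x => u x - φ x) (ENNReal.ofReal p) ((gaussMeasure N).restrict Ω) +
          eLpNorm (fun x => g x - gradient φ x) (ENNReal.ofReal p)
            ((gaussMeasure N).restrict Ω) < ((n : ℝ≥0∞) + 1)⁻¹ := fun n => h _ (by simp)
    choose φ hφ hlt using key
    have hlim : Tendsto (fun n : ℕ => ((n : ℝ≥0∞) + 1)⁻¹) atTop (𝓝 0) := by
      have := (tendsto_add_atTop_iff_nat 1).2 ENNReal.tendsto_inv_nat_nhds_zero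
      simpa using this
    refine ⟨hu, hg, φ, hφ, ?_, ?_⟩
    · have h1 : Tendsto (fun n => eLpNorm (fun x => u x - φ n x) (ENNReal.ofReal p)
          ((gaussMeasure N).restrict Ω)) atTop (𝓝 0) :=
        tendsto_of_tendsto_of_tendsto_of_le_of_le tendsto_const_nhds hlim (fun _ => zero_le)
          fun n => le_self_add.trans (hlt n).le
      have h2 := (tendsto_eLpNorm_iff hp fun n => hu.sub ((hφ n).memLp _)).1 h1
      simp_rw [norm_sub_rev (φ _ _)]
      exact h2
    · have h1 : Tendsto (fun n => eLpNorm (fun x => g x - gradient (φ n) x) (ENNReal.ofReal p)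
          ((gaussMeasure N).restrict Ω)) atTop (𝓝 0) :=
        tendsto_of_tendsto_of_tendsto_of_le_of_le tendsto_const_nhds hlim (fun _ => zero_le)
          fun n => le_add_self.trans (hlt n).le
      have h2 := (tendsto_eLpNorm_iff hp fun n => hg.sub ((hφ n).memLp_gradient _)).1 h1
      simp_rw [norm_sub_rev (gradient (φ _) _)]
      exact h2
  · intro h
    have hw := hasWeakGradient_of_approxBy hΩ hp h
    obtain ⟨hu, hg, φ, hφ, h1, h2⟩ := h
    refine ⟨⟨hw, hu, hg⟩, fun ε hε => ?_⟩
    have h3 := (tendsto_eLpNorm_iff hp fun n => hu.sub ((hφ n).memLp _)).2 (by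
      simpa only [Pi.sub_apply, norm_sub_rev (φ _ _)] using h1)
    have h4 := (tendsto_eLpNorm_iff hp fun n => hg.sub ((hφ n).memLp_gradient _)).2 (by
      simpa only [Pi.sub_apply, norm_sub_rev (gradient (φ _) _)] using h2)
    have h5 := h3.add h4
    rw [add_zero] at h5
    obtain ⟨n, hn⟩ := (h5.eventually_lt_const hε).exists
    exact ⟨φ n, hφ n, hn⟩

end Approximation

/-! ### A smooth positive part with uniformly bounded derivative -/

section SmoothPositivePart

/-- A smooth approximation of the positive part, as `k → ∞`. -/
noncomputable def smoothPos (k t : ℝ) : ℝ := t * Real.smoothTransition (k * t)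

theorem contDiff_smoothPos (k : ℝ) : ContDiff ℝ ∞ (smoothPos k) :=
  contDiff_id.mul (Real.smoothTransition.contDiff.comp (contDiff_const.mul contDiff_id))

theorem smoothPos_nonneg {k : ℝ} (hk : 0 ≤ k) (t : ℝ) : 0 ≤ smoothPos k t := by
  rcases le_total 0 t with h | h
  · exact mul_nonneg h (Real.smoothTransition.nonneg _)
  · rw [smoothPos, Real.smoothTransition.zero_of_nonpos (mul_nonpos_of_nonneg_of_nonpos hk h),
      mul_zero]

theorem abs_smoothPos_le (k t : ℝ) : |smoothPos k t| ≤ |t| := by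
  rw [smoothPos, abs_mul, abs_of_nonneg (Real.smoothTransition.nonneg _)]
  exact mul_le_of_le_one_right (abs_nonneg _) (Real.smoothTransition.le_one _)

theorem differentiable_smoothTransition : Differentiable ℝ Real.smoothTransition :=
  (Real.smoothTransition.contDiff (n := 1)).differentiable (by simp)

theorem deriv_smoothTransition_of_neg {t : ℝ} (ht : t < 0) :
    deriv Real.smoothTransition t = 0 := by
  have h : Real.smoothTransition =ᶠ[𝓝 t] fun _ => 0 := by
    filter_upwards [Iio_mem_nhds ht] with s hs using Real.smoothTransition.zero_of_nonpos hs.le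
  rw [h.deriv_eq, deriv_const]

theorem deriv_smoothTransition_of_one_lt {t : ℝ} (ht : 1 < t) :
    deriv Real.smoothTransition t = 0 := by
  have h : Real.smoothTransition =ᶠ[𝓝 t] fun _ => 1 := by
    filter_upwards [Ioi_mem_nhds ht] with s hs using Real.smoothTransition.one_of_one_le hs.le
  rw [h.deriv_eq, deriv_const]

theorem deriv_smoothPos (k t : ℝ) : deriv (smoothPos k) t =
    Real.smoothTransition (k * t) + k * t * deriv Real.smoothTransition (k * t) := by
  have h1 : HasDerivAt (fun s : ℝ => k * s) k t := by simpa using (hasDerivAt_id t).const_mul k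
  have h2 := (differentiable_smoothTransition (k * t)).hasDerivAt.comp t h1
  have h3 := ((hasDerivAt_id t).mul h2).deriv
  have h4 : smoothPos k = id * (Real.smoothTransition ∘ fun s : ℝ => k * s) := rfl
  rw [h4, h3]
  simp only [Function.comp_apply, id_eq, one_mul]
  ring

/-- The derivative depends on `k * t` only and is constant on either side of `[0, 1]`, which is why
the bound is uniform in `k`. -/
theorem exists_abs_deriv_smoothPos_le : ∃ C : ℝ, ∀ k t, |deriv (smoothPos k) t| ≤ C := by
  have hc : Continuous fun s => Real.smoothTransition s + s * deriv Real.smoothTransition s :=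
    Real.smoothTransition.continuous.add (continuous_id.mul
      ((Real.smoothTransition.contDiff (n := 1)).continuous_deriv (by simp)))
  obtain ⟨C, hC⟩ := (isCompact_Icc (a := (0 : ℝ)) (b := 1)).exists_bound_of_continuousOn
    hc.continuousOn
  refine ⟨max C 1, fun k t => ?_⟩
  rw [deriv_smoothPos]
  set s := k * t
  rcases lt_or_ge s 0 with h | h
  · rw [Real.smoothTransition.zero_of_nonpos h.le, deriv_smoothTransition_of_neg h]
    simp
  · rcases le_or_gt s 1 with h1 | h1
    · exact (hC s ⟨h, h1⟩).trans (le_max_left _ _)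
    · rw [Real.smoothTransition.one_of_one_le h1.le, deriv_smoothTransition_of_one_lt h1]
      simp

theorem tendsto_smoothPos (t : ℝ) :
    Tendsto (fun k : ℕ => smoothPos k t) atTop (𝓝 (max t 0)) := by
  rcases le_or_gt t 0 with h | h
  · rw [max_eq_right h]
    refine tendsto_const_nhds.congr fun k => ?_
    rw [smoothPos, Real.smoothTransition.zero_of_nonpos
      (mul_nonpos_of_nonneg_of_nonpos k.cast_nonneg h), mul_zero]
  · rw [max_eq_left h.le]
    refine tendsto_const_nhds.congr' ?_
    have h1 : Tendsto (fun k : ℕ => (k : ℝ) * t) atTop atTop :=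
      tendsto_natCast_atTop_atTop.atTop_mul_const h
    filter_upwards [h1.eventually_ge_atTop 1] with k hk
    rw [smoothPos, Real.smoothTransition.one_of_one_le hk, mul_one]

/-- The limit exists at every point, including `t = 0`, so the chain rule for the positive part
needs no statement about level sets of `u`. -/
theorem tendsto_deriv_smoothPos (t : ℝ) :
    Tendsto (fun k : ℕ => deriv (smoothPos k) t) atTop (𝓝 (if 0 < t then 1 else 0)) := by
  simp_rw [deriv_smoothPos]
  rcases lt_trichotomy t 0 with h | rfl | h
  · rw [if_neg h.not_gt]
    refine tendsto_const_nhds.congr' ?_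
    filter_upwards [eventually_gt_atTop 0] with k hk
    have hk' : (k : ℝ) * t < 0 := mul_neg_of_pos_of_neg (by exact_mod_cast hk) h
    rw [Real.smoothTransition.zero_of_nonpos hk'.le, deriv_smoothTransition_of_neg hk']
    simp
  · simp
  · rw [if_pos h]
    refine tendsto_const_nhds.congr' ?_
    have h1 : Tendsto (fun k : ℕ => (k : ℝ) * t) atTop atTop :=
      tendsto_natCast_atTop_atTop.atTop_mul_const h
    filter_upwards [h1.eventually_gt_atTop 1] with k hk
    rw [Real.smoothTransition.one_of_one_le hk.le, deriv_smoothTransition_of_one_lt hk]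
    simp

end SmoothPositivePart

/-! ### Chain and product rules in `W_0^{1,p}` -/

section ChainRule

variable {N : ℕ} {Ω : Set (EuclideanSpace ℝ (Fin N))} {p : ℝ}
  {S : Set (EuclideanSpace ℝ (Fin N) → ℝ)} {u v : EuclideanSpace ℝ (Fin N) → ℝ}
  {g h : EuclideanSpace ℝ (Fin N) → EuclideanSpace ℝ (Fin N)}
  [IsFiniteMeasure ((gaussMeasure N).restrict Ω)]

theorem ApproxBy.exists_seq_ae (hp : 1 < p) (hS : ∀ φ ∈ S, IsTestFunction Ω φ)
    (hu : ApproxBy S p Ω u g) : ∃ φ : ℕ → EuclideanSpace ℝ (Fin N) → ℝ, (∀ n, φ n ∈ S) ∧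
      Tendsto (fun n => ∫ x in Ω, ‖φ n x - u x‖ ^ p ∂(gaussMeasure N)) atTop (𝓝 0) ∧
      Tendsto (fun n => ∫ x in Ω, ‖gradient (φ n) x - g x‖ ^ p ∂(gaussMeasure N)) atTop (𝓝 0) ∧
      ∀ᵐ x ∂((gaussMeasure N).restrict Ω), Tendsto (fun n => φ n x) atTop (𝓝 (u x)) := by
  obtain ⟨hu, hg, φ, hφ, h1, h2⟩ := hu
  obtain ⟨ns, hns, hae⟩ := exists_subseq_tendsto_ae hp (fun n => (hS _ (hφ n)).memLp _) hu h1
  exact ⟨fun n => φ (ns n), fun n => hφ _, h1.comp hns.tendsto_atTop, h2.comp hns.tendsto_atTop,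
    hae⟩

theorem ApproxBy.add (hp : 1 < p) (hS : ∀ φ ∈ S, IsTestFunction Ω φ)
    (hadd : ∀ φ ∈ S, ∀ ψ ∈ S, (fun x => φ x + ψ x) ∈ S)
    (hu : ApproxBy S p Ω u g) (hv : ApproxBy S p Ω v h) :
    ApproxBy S p Ω (fun x => u x + v x) (fun x => g x + h x) := by
  obtain ⟨hu, hg, φ, hφ, h1, h2⟩ := hu
  obtain ⟨hv, hh, ψ, hψ, h3, h4⟩ := hv
  have hφt := fun n => hS _ (hφ n)
  have hψt := fun n => hS _ (hψ n)
  refine ⟨hu.add hv, hg.add hh, fun n x => φ n x + ψ n x, fun n => hadd _ (hφ n) _ (hψ n), ?_, ?_⟩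
  · have h5 := (h1.add h3).const_mul (2 ^ p)
    rw [add_zero, mul_zero] at h5
    refine squeeze_zero (fun n => integral_norm_rpow_nonneg) (fun n => ?_) h5
    have := integral_norm_add_rpow_le hp (((hφt n).memLp _).sub hu) (((hψt n).memLp _).sub hv)
    simpa only [Pi.sub_apply, sub_add_sub_comm] using this
  · have h5 := (h2.add h4).const_mul (2 ^ p)
    rw [add_zero, mul_zero] at h5
    refine squeeze_zero (fun n => integral_norm_rpow_nonneg) (fun n => ?_) h5
    have := integral_norm_add_rpow_le hp (((hφt n).memLp_gradient _).sub hg)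
      (((hψt n).memLp_gradient _).sub hh)
    simpa only [Pi.sub_apply, sub_add_sub_comm,
      fun x => gradient_fun_add ((hφt n).differentiable x) ((hψt n).differentiable x)] using this

/-- The functions converge by the Lipschitz bound. For the gradients the factor `deriv G (φ n x)`
must converge pointwise, hence the passage to an a.e. convergent subsequence. -/
theorem ApproxBy.comp {T : Set (EuclideanSpace ℝ (Fin N) → ℝ)} {G : ℝ → ℝ} {C : ℝ} (hp : 1 < p)
    (hS : ∀ φ ∈ S, IsTestFunction Ω φ) (hG : ContDiff ℝ ∞ G)
    (hC : ∀ t, |deriv G t| ≤ C) (hST : ∀ φ ∈ S, (fun x => G (φ x)) ∈ T)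
    (hT : ∀ φ ∈ T, IsTestFunction Ω φ) (hu : ApproxBy S p Ω u g) :
    ApproxBy T p Ω (fun x => G (u x)) (fun x => deriv G (u x) • g x) := by
  have hGd : Differentiable ℝ G := hG.differentiable (by simp)
  have hGc : Continuous (deriv G) := hG.continuous_deriv (by simp)
  have hlip : ∀ s t : ℝ, ‖G s - G t‖ ≤ C * ‖s - t‖ := fun s t =>
    Convex.norm_image_sub_le_of_norm_deriv_le (fun x _ => hGd x) (fun x _ => hC x) convex_univ
      (mem_univ t) (mem_univ s)
  have hC0 : 0 ≤ C := (abs_nonneg _).trans (hC 0)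
  have hum := hu.1
  have hgm := hu.2.1
  obtain ⟨φ, hφ, h1, h2, hae⟩ := hu.exists_seq_ae hp hS
  have hφt := fun n => hS _ (hφ n)
  have hGφ := fun n => hT _ (hST _ (hφ n))
  have hG0 : ∀ᵐ x ∂((gaussMeasure N).restrict Ω), ‖G (u x)‖ ≤ ‖(‖G 0‖ + C * ‖u x‖ : ℝ)‖ := by
    refine Eventually.of_forall fun x => ?_
    have h3 := hlip (u x) 0
    have h4 := norm_sub_norm_le (G (u x)) (G 0)
    rw [sub_zero] at h3
    refine le_trans ?_ (le_abs_self _)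
    linarith
  refine ⟨?_, ?_, fun n x => G (φ n x), fun n => hST _ (hφ n), ?_, ?_⟩
  · exact MemLp.mono ((memLp_const ‖G 0‖).add (hum.norm.const_mul C))
      (hG.continuous.comp_aestronglyMeasurable hum.1) hG0
  · exact memLp_smul_of_bounded (hGc.comp_aestronglyMeasurable hum.1)
      (Eventually.of_forall fun x => hC (u x)) hgm
  · have h3 := h1.const_mul (C ^ p)
    rw [mul_zero] at h3
    refine squeeze_zero (fun n => integral_norm_rpow_nonneg) (fun n => ?_) h3
    rw [← integral_const_mul]
    refine integral_mono_of_nonneg (Eventually.of_forall fun x => by positivity)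
      ((integrable_rpow_of_memLp hp (((hφt n).memLp _).sub hum)).const_mul _)
      (Eventually.of_forall fun x => ?_)
    simp only
    rw [← Real.mul_rpow hC0 (norm_nonneg _)]
    exact Real.rpow_le_rpow (norm_nonneg _) (hlip _ _) (by linarith)
  · have h3 := tendsto_integral_smul_of_bounded hp (fun n => (hφt n).memLp_gradient _) hgm
      (c := fun n x => deriv G (φ n x)) (d := fun x => deriv G (u x))
      (fun n => (hGc.comp (hφt n).1.continuous).aestronglyMeasurable) (fun n x => hC _) h2 (by
        filter_upwards [hae] with x hx
        exact (hGc.tendsto _).comp hx)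
    simpa only [fun n x => gradient_comp_deriv (hGd (φ n x)).hasDerivAt
      ((hφt n).differentiable x)] using h3

/-- The nonnegative test functions on `Ω`. -/
def nonnegTest (Ω : Set (EuclideanSpace ℝ (Fin N))) : Set (EuclideanSpace ℝ (Fin N) → ℝ) :=
  {φ | IsTestFunction Ω φ ∧ ∀ x, 0 ≤ φ x}

/-- Composition with `smoothPos k`, then `k → ∞`. The approximants land in `nonnegTest Ω`, which
`ApproxBy.test_mul_rpow` needs in order to take negative powers. -/
theorem ApproxBy.pos (hp : 1 < p) (hu : ApproxBy {φ | IsTestFunction Ω φ} p Ω u g) :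
    ApproxBy (nonnegTest Ω) p Ω (fun x => max (u x) 0)
      (fun x => (if 0 < u x then (1 : ℝ) else 0) • g x) := by
  obtain ⟨C, hC⟩ := exists_abs_deriv_smoothPos_le
  have hum := hu.1
  have hgm := hu.2.1
  have hk : ∀ k : ℕ, ApproxBy (nonnegTest Ω) p Ω (fun x => smoothPos k (u x))
      (fun x => deriv (smoothPos k) (u x) • g x) := fun k =>
    hu.comp hp (fun _ h => h) (contDiff_smoothPos k) (hC k)
      (fun φ hφ => ⟨IsTestFunction.comp hφ (contDiff_smoothPos k) (by simp [smoothPos]),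
        fun x => smoothPos_nonneg k.cast_nonneg _⟩) (fun φ hφ => hφ.1)
  have hae : ∀ᵐ x ∂((gaussMeasure N).restrict Ω), Tendsto (fun k : ℕ => deriv (smoothPos k) (u x))
      atTop (𝓝 (if 0 < u x then 1 else 0)) :=
    Eventually.of_forall fun x => tendsto_deriv_smoothPos (u x)
  have hdm : ∀ k : ℕ, AEStronglyMeasurable (fun x => deriv (smoothPos k) (u x))
      ((gaussMeasure N).restrict Ω) := fun k =>
    ((contDiff_smoothPos k).continuous_deriv (by simp)).comp_aestronglyMeasurable hum.1
  refine approxBy_of_tendsto hp (fun φ hφ => hφ.1) hk ?_ ?_ ?_ ?_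
  · exact hum.mono ((continuous_id.max continuous_const).comp_aestronglyMeasurable hum.1)
      (Eventually.of_forall fun x => by
        rw [Real.norm_eq_abs, Real.norm_eq_abs, abs_of_nonneg (le_max_right _ _)]
        exact max_le (le_abs_self _) (abs_nonneg _))
  · exact memLp_smul_of_tendsto hdm (fun k x => hC k _) hae hgm
  · exact tendsto_integral_norm_sub_of_dominated hp (V := fun x => ‖u x‖)
      (fun k => (contDiff_smoothPos k).continuous.comp_aestronglyMeasurable hum.1)
      (integrable_rpow_of_memLp hp hum.norm)
      (fun k => Eventually.of_forall fun x => abs_smoothPos_le _ _)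
      (Eventually.of_forall fun x => tendsto_smoothPos _)
  · have h0 : (0 : ℝ) ^ p = 0 := Real.zero_rpow (by linarith)
    exact tendsto_integral_smul_of_bounded hp (fun _ => hgm) hgm hdm (fun k x => hC k _)
      (by simp [h0]) hae

/-- Product of a test function with a negative power of a nonnegative Sobolev function. -/
theorem ApproxBy.test_mul_rpow {ψ : EuclideanSpace ℝ (Fin N) → ℝ} {ε : ℝ} (hp : 1 < p)
    (hψ : IsTestFunction Ω ψ) (hε : 0 < ε) (hv : ApproxBy (nonnegTest Ω) p Ω v g) :
    ApproxBy {φ | IsTestFunction Ω φ} p Ω (fun x => (v x + ε) ^ (1 - p) * ψ x)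
      (fun x => (v x + ε) ^ (1 - p) • gradient ψ x +
        (ψ x * ((1 - p) * (v x + ε) ^ (-p))) • g x) := by
  have hvm := hv.1
  have hgm := hv.2.1
  -- With nonnegative approximants of `v` the base `φ n x + ε` stays above `ε`, so its negative
  -- powers are smooth and uniformly bounded.
  obtain ⟨φ, hφ, -, h2, hae⟩ := hv.exists_seq_ae hp (fun φ hφ => hφ.1)
  have hφt := fun n => (hφ n).1
  have hφ0 := fun n => (hφ n).2
  have hpos : ∀ n x, 0 < φ n x + ε := fun n x => add_pos_of_nonneg_of_pos (hφ0 n x) hε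
  have hle : ∀ n x, ε ≤ φ n x + ε := fun n x => le_add_of_nonneg_left (hφ0 n x)
  obtain ⟨M, hM⟩ := hψ.2.1.exists_bound_of_continuous hψ.1.continuous
  have hcont : ∀ n (q : ℝ), Continuous fun x => (φ n x + ε) ^ q := fun n q =>
    ((hφt n).1.continuous.add continuous_const).rpow_const fun x => Or.inl (hpos n x).ne'
  have hlim : ∀ q : ℝ, ∀ᵐ x ∂((gaussMeasure N).restrict Ω),
      Tendsto (fun n => (φ n x + ε) ^ q) atTop (𝓝 ((v x + ε) ^ q)) := by
    intro q
    filter_upwards [hae] with x hx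
    have h0 : 0 ≤ v x := ge_of_tendsto hx (Eventually.of_forall fun n => hφ0 n x)
    exact (hx.add_const ε).rpow_const (Or.inl (by linarith))
  have hb : ∀ {q : ℝ}, q ≤ 0 → ∀ n x, |(φ n x + ε) ^ q| ≤ ε ^ q := fun hq n x => by
    rw [abs_of_pos (Real.rpow_pos_of_pos (hpos n x) _)]
    exact Real.rpow_le_rpow_of_nonpos hε (hle n x) hq
  have hb1 := hb (show 1 - p ≤ 0 by linarith)
  have hm1 := fun n => (hcont n (1 - p)).aestronglyMeasurable (μ := (gaussMeasure N).restrict Ω)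
  have hc2 : ∀ n, Continuous fun x => ψ x * ((1 - p) * (φ n x + ε) ^ (-p)) := fun n =>
    hψ.1.continuous.mul (continuous_const.mul (hcont n _))
  have hm2 := fun n => (hc2 n).aestronglyMeasurable (μ := (gaussMeasure N).restrict Ω)
  have hb2 : ∀ n x, |ψ x * ((1 - p) * (φ n x + ε) ^ (-p))| ≤ M * (|1 - p| * ε ^ (-p)) := by
    intro n x
    rw [abs_mul, abs_mul]
    have h1 := hb (show -p ≤ 0 by linarith) n x
    have h2 : |ψ x| ≤ M := hM x
    have h3 := (abs_nonneg _).trans h2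
    gcongr
  have hl1 := hlim (1 - p)
  have hl2 : ∀ᵐ x ∂((gaussMeasure N).restrict Ω),
      Tendsto (fun n => ψ x * ((1 - p) * (φ n x + ε) ^ (-p))) atTop
        (𝓝 (ψ x * ((1 - p) * (v x + ε) ^ (-p)))) := by
    filter_upwards [hlim (-p)] with x hx
    exact (hx.const_mul _).const_mul _
  have h0 : (0 : ℝ) ^ p = 0 := Real.zero_rpow (by linarith)
  have hψm : MemLp ψ (ENNReal.ofReal p) ((gaussMeasure N).restrict Ω) := hψ.memLp _
  have hψg : MemLp (gradient ψ) (ENNReal.ofReal p) ((gaussMeasure N).restrict Ω) :=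
    hψ.memLp_gradient _
  have hA := memLp_smul_of_tendsto hm1 hb1 hl1 hψg
  have hB := memLp_smul_of_tendsto hm2 hb2 hl2 hgm
  refine ⟨memLp_smul_of_tendsto hm1 hb1 hl1 hψm, hA.add hB,
    fun n x => (φ n x + ε) ^ (1 - p) * ψ x, fun n => ?_, ?_, ?_⟩
  · refine hψ.of_zero (ContDiff.mul (ContDiff.rpow_const_of_ne ((hφt n).1.add contDiff_const)
      fun x => (hpos n x).ne') hψ.1) fun x hx => by simp [hx]
  · exact tendsto_integral_smul_of_bounded hp (fun _ => hψm) hψm hm1 hb1 (by simp [h0]) hl1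
  · have h5 := tendsto_integral_smul_of_bounded hp (fun _ => hψg) hψg hm1 hb1 (by simp [h0]) hl1
    have h6 := tendsto_integral_smul_of_bounded hp (fun n => (hφt n).memLp_gradient _) hgm hm2 hb2
      h2 hl2
    have h7 := (h5.add h6).const_mul (2 ^ p)
    rw [add_zero, mul_zero] at h7
    refine squeeze_zero (fun n => integral_norm_rpow_nonneg) (fun n => ?_) h7
    have h8 := integral_norm_add_rpow_le hp
      ((memLp_smul_of_bounded (hm1 n) (Eventually.of_forall (hb1 n)) hψg).sub hA)
      ((memLp_smul_of_bounded (hm2 n) (Eventually.of_forall (hb2 n))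
        ((hφt n).memLp_gradient _)).sub hB)
    have h9 : ∀ x, gradient (fun x => (φ n x + ε) ^ (1 - p) * ψ x) x =
        (φ n x + ε) ^ (1 - p) • gradient ψ x +
          (ψ x * ((1 - p) * (φ n x + ε) ^ (-p))) • gradient (φ n) x := by
      intro x
      have hd : HasDerivAt (fun t : ℝ => (t + ε) ^ (1 - p)) ((1 - p) * (φ n x + ε) ^ (-p))
          (φ n x) := by
        have := ((hasDerivAt_id (φ n x)).add_const ε).rpow_const (p := 1 - p)
          (Or.inl (hpos n x).ne')
        simpa [show 1 - p - 1 = -p by ring] using this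
      rw [gradient_fun_mul (f := fun x => (φ n x + ε) ^ (1 - p))
        (hd.differentiableAt.comp x ((hφt n).differentiable x)) (hψ.differentiable x),
        gradient_comp_deriv hd ((hφt n).differentiable x), smul_smul]
    simpa only [Pi.sub_apply, sub_add_sub_comm, h9] using h8

end ChainRule

/-! ### Uniform convexity of `L^p` -/

section MidpointCauchy

variable {α : Type*} {mα : MeasurableSpace α} {μ : Measure α}
variable {F : Type*} [NormedAddCommGroup F] [InnerProductSpace ℝ F] [FiniteDimensional ℝ F]

theorem integrable_bregman {p : ℝ} (hp : 1 < p) {u v : α → F}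
    (hu : MemLp u (ENNReal.ofReal p) μ) (hv : MemLp v (ENNReal.ofReal p) μ) :
    Integrable (fun x => bregman p (u x) (v x)) μ :=
  ((integrable_rpow_of_memLp hp hu).sub (integrable_rpow_of_memLp hp hv)).sub
    ((integrable_inner_pFlux hp hv (hu.sub hv)).const_mul p)

theorem integral_bregman_midpoint {p : ℝ} (hp : 1 < p) {u v : α → F}
    (hu : MemLp u (ENNReal.ofReal p) μ) (hv : MemLp v (ENNReal.ofReal p) μ) :
    ∫ x, bregman p (u x) ((1 / 2 : ℝ) • (u x + v x)) ∂μ +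
      ∫ x, bregman p (v x) ((1 / 2 : ℝ) • (u x + v x)) ∂μ =
      ∫ x, ‖u x‖ ^ p ∂μ + ∫ x, ‖v x‖ ^ p ∂μ - 2 * ∫ x, ‖(1 / 2 : ℝ) • (u x + v x)‖ ^ p ∂μ := by
  have hm : MemLp (fun x => (1 / 2 : ℝ) • (u x + v x)) (ENNReal.ofReal p) μ :=
    (hu.add hv).const_smul (1 / 2 : ℝ)
  have hi := (integrable_rpow_of_memLp hp hu).add (integrable_rpow_of_memLp hp hv)
  have hi' : Integrable (fun x => ‖u x‖ ^ p + ‖v x‖ ^ p) μ := hi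
  rw [← integral_add (integrable_bregman hp hu hm) (integrable_bregman hp hv hm),
    ← integral_add (integrable_rpow_of_memLp hp hu) (integrable_rpow_of_memLp hp hv),
    ← integral_const_mul, ← integral_sub hi' ((integrable_rpow_of_memLp hp hm).const_mul 2)]
  simp_rw [bregman_midpoint]

theorem integral_midpoint_rpow_le {p : ℝ} (hp : 1 < p) {u v : α → F}
    (hu : MemLp u (ENNReal.ofReal p) μ) (hv : MemLp v (ENNReal.ofReal p) μ) :
    2 * ∫ x, ‖(1 / 2 : ℝ) • (u x + v x)‖ ^ p ∂μ ≤ ∫ x, ‖u x‖ ^ p ∂μ + ∫ x, ‖v x‖ ^ p ∂μ := by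
  have h := integral_bregman_midpoint hp hu hv
  have h1 : 0 ≤ ∫ x, bregman p (u x) ((1 / 2 : ℝ) • (u x + v x)) ∂μ :=
    integral_nonneg fun _ => bregman_nonneg hp _ _
  have h2 : 0 ≤ ∫ x, bregman p (v x) ((1 / 2 : ℝ) • (u x + v x)) ∂μ :=
    integral_nonneg fun _ => bregman_nonneg hp _ _
  linarith

/-- Uniform convexity of `L^p`: a bounded sequence with vanishing midpoint defects is Cauchy. -/
theorem cauchy_of_midpoint_defect {p : ℝ} (hp : 1 < p) {u : ℕ → α → F}
    (hu : ∀ n, MemLp (u n) (ENNReal.ofReal p) μ) {B : ℝ} (hB : ∀ n, ∫ x, ‖u n x‖ ^ p ∂μ ≤ B)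
    (h : ∀ ε : ℝ, 0 < ε → ∃ n₀, ∀ m ≥ n₀, ∀ n ≥ n₀, ∫ x, ‖u m x‖ ^ p ∂μ + ∫ x, ‖u n x‖ ^ p ∂μ -
      2 * ∫ x, ‖(1 / 2 : ℝ) • (u m x + u n x)‖ ^ p ∂μ < ε) (ε : ℝ) (hε : 0 < ε) :
    ∃ n₀, ∀ m ≥ n₀, ∀ n ≥ n₀, ∫ x, ‖u m x - u n x‖ ^ p ∂μ < ε := by
  have hB0 : 0 ≤ B := integral_norm_rpow_nonneg.trans (hB 0)
  have h2p : (0 : ℝ) < 2 ^ p := by positivity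
  obtain ⟨C, hC0, hC⟩ := exists_norm_sub_rpow_le_bregman (F := F) hp
    (η := ε / (2 ^ p * (4 * B + 4))) (by positivity)
  obtain ⟨n₀, hn₀⟩ := h (ε / (2 ^ p * (2 * C + 2))) (by positivity)
  refine ⟨n₀, fun m hm n hn => ?_⟩
  have hmid : MemLp (fun x => (1 / 2 : ℝ) • (u m x + u n x)) (ENNReal.ofReal p) μ :=
    ((hu m).add (hu n)).const_smul (1 / 2 : ℝ)
  have h1 := integral_bregman_midpoint hp (hu m) (hu n)
  have h2 : 0 ≤ ∫ x, bregman p (u n x) ((1 / 2 : ℝ) • (u m x + u n x)) ∂μ :=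
    integral_nonneg fun _ => bregman_nonneg hp _ _
  have h3 := hn₀ m hm n hn
  have h4 : ∫ x, bregman p (u m x) ((1 / 2 : ℝ) • (u m x + u n x)) ∂μ ≤
      ε / (2 ^ p * (2 * C + 2)) := by linarith
  have h5 := integral_midpoint_rpow_le hp (hu m) (hu n)
  -- The Bregman estimate compares `u m` with the midpoint, which is half of the difference; this is
  -- the origin of the factors `2 ^ p` in the constants.
  have h6 : ∀ x, ‖u m x - u n x‖ ^ p = 2 ^ p * ‖u m x - (1 / 2 : ℝ) • (u m x + u n x)‖ ^ p := by
    intro x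
    have h7 : u m x - u n x = (2 : ℝ) • (u m x - (1 / 2 : ℝ) • (u m x + u n x)) := by module
    rw [h7, norm_smul, Real.mul_rpow (norm_nonneg _) (norm_nonneg _)]
    norm_num
  have hi1 := integrable_rpow_of_memLp hp (hu m)
  have hi2 := integrable_rpow_of_memLp hp hmid
  have hi12 : Integrable (fun x => ‖u m x‖ ^ p + ‖(1 / 2 : ℝ) • (u m x + u n x)‖ ^ p) μ :=
    hi1.add hi2
  have h8 : ∫ x, ‖u m x - (1 / 2 : ℝ) • (u m x + u n x)‖ ^ p ∂μ ≤
      ε / (2 ^ p * (4 * B + 4)) * (∫ x, ‖u m x‖ ^ p ∂μ +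
        ∫ x, ‖(1 / 2 : ℝ) • (u m x + u n x)‖ ^ p ∂μ) +
        C * ∫ x, bregman p (u m x) ((1 / 2 : ℝ) • (u m x + u n x)) ∂μ := by
    rw [← integral_add hi1 hi2, ← integral_const_mul, ← integral_const_mul,
      ← integral_add (hi12.const_mul _) ((integrable_bregman hp (hu m) hmid).const_mul _)]
    exact integral_mono (integrable_rpow_of_memLp hp ((hu m).sub hmid))
      ((hi12.const_mul _).add ((integrable_bregman hp (hu m) hmid).const_mul _))
      fun x => hC _ _
  have hBm := hB m
  have hBn := hB n
  have h9 : ε / (2 ^ p * (4 * B + 4)) * (∫ x, ‖u m x‖ ^ p ∂μ +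
      ∫ x, ‖(1 / 2 : ℝ) • (u m x + u n x)‖ ^ p ∂μ) ≤ ε / (2 ^ p * (4 * B + 4)) * (2 * B) :=
    mul_le_mul_of_nonneg_left (by linarith) (by positivity)
  have h10 : C * ∫ x, bregman p (u m x) ((1 / 2 : ℝ) • (u m x + u n x)) ∂μ ≤
      C * (ε / (2 ^ p * (2 * C + 2))) := mul_le_mul_of_nonneg_left h4 hC0
  simp_rw [h6]
  rw [integral_const_mul]
  calc 2 ^ p * ∫ x, ‖u m x - (1 / 2 : ℝ) • (u m x + u n x)‖ ^ p ∂μ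
      ≤ 2 ^ p * (ε / (2 ^ p * (4 * B + 4)) * (2 * B) + C * (ε / (2 ^ p * (2 * C + 2)))) :=
        mul_le_mul_of_nonneg_left (by linarith) h2p.le
    _ = ε * (2 * B / (4 * B + 4) + C / (2 * C + 2)) := by
        field_simp
    _ < ε * 1 := by
        apply mul_lt_mul_of_pos_left _ hε
        rw [div_add_div _ _ (by positivity) (by positivity), div_lt_one (by positivity)]
        nlinarith
    _ = ε := mul_one ε

end MidpointCauchy

/-! ### Operations in `W_0^{1,p}` and the inequality defining `λ₁` -/

section SobolevZero

variable {N : ℕ} {Ω : Set (EuclideanSpace ℝ (Fin N))} {p : ℝ}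
  {u v : EuclideanSpace ℝ (Fin N) → ℝ}
  {g h : EuclideanSpace ℝ (Fin N) → EuclideanSpace ℝ (Fin N)}

/-- `u ∈ W_0^{1,p}(Ω, γ_N)` with gradient `g`, as limits of test functions. -/
abbrev SobolevZero (p : ℝ) (Ω : Set (EuclideanSpace ℝ (Fin N)))
    (u : EuclideanSpace ℝ (Fin N) → ℝ)
    (g : EuclideanSpace ℝ (Fin N) → EuclideanSpace ℝ (Fin N)) : Prop :=
  ApproxBy {φ | IsTestFunction Ω φ} p Ω u g

variable [IsFiniteMeasure ((gaussMeasure N).restrict Ω)]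

theorem SobolevZero.add (hp : 1 < p) (hu : SobolevZero p Ω u g) (hv : SobolevZero p Ω v h) :
    SobolevZero p Ω (fun x => u x + v x) (fun x => g x + h x) :=
  ApproxBy.add hp (fun _ h => h) (fun _ h1 _ h2 => IsTestFunction.add h1 h2) hu hv

theorem SobolevZero.const_mul (hp : 1 < p) (hu : SobolevZero p Ω u g) (c : ℝ) :
    SobolevZero p Ω (fun x => c * u x) (fun x => c • g x) := by
  have hd : ∀ t : ℝ, deriv (fun s : ℝ => c * s) t = c := fun t => by
    simp
  have := ApproxBy.comp (G := fun s : ℝ => c * s) (C := |c|) hp (fun _ h => h)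
    (contDiff_const.mul contDiff_id) (fun t => by rw [hd])
    (fun φ hφ => IsTestFunction.const_mul hφ c) (fun _ h => h) hu
  simp only [hd] at this
  exact this

theorem SobolevZero.sub (hp : 1 < p) (hu : SobolevZero p Ω u g) (hv : SobolevZero p Ω v h) :
    SobolevZero p Ω (fun x => u x - v x) (fun x => g x - h x) := by
  simpa [sub_eq_add_neg] using hu.add hp (hv.const_mul hp (-1))

theorem SobolevZero.zero (hp : 1 < p) : SobolevZero p Ω (fun _ => 0) (fun _ => 0) := by
  have h0 : IsTestFunction Ω (fun _ => (0 : ℝ)) :=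
    ⟨contDiff_const, HasCompactSupport.zero, by simp [tsupport]⟩
  have := h0.approxBy (S := {φ | IsTestFunction Ω φ}) hp h0
  rwa [gradient_fun_const'] at this

theorem SobolevZero.pos (hp : 1 < p) (hu : SobolevZero p Ω u g) :
    SobolevZero p Ω (fun x => max (u x) 0) (fun x => (if 0 < u x then (1 : ℝ) else 0) • g x) :=
  (ApproxBy.pos hp hu).mono fun _ h => h.1

/-- The gradient is built from the positive and negative parts. Only the bound on its norm matters:
it says that `|u|` does not increase the Rayleigh quotient. -/
theorem SobolevZero.abs (hp : 1 < p) (hu : SobolevZero p Ω u g) :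
    ∃ h, SobolevZero p Ω (fun x => |u x|) h ∧ ∀ x, ‖h x‖ ≤ ‖g x‖ := by
  have h1 := (hu.pos hp).add hp ((hu.const_mul hp (-1)).pos hp)
  have h2 : ∀ x, max (u x) 0 + max (-1 * u x) 0 = |u x| := fun x => by
    rcases le_total 0 (u x) with h | h
    · rw [max_eq_left h, max_eq_right (by linarith), abs_of_nonneg h, add_zero]
    · rw [max_eq_right h, max_eq_left (by linarith), abs_of_nonpos h]
      ring
  simp only [h2] at h1
  refine ⟨_, h1, fun x => ?_⟩
  rcases lt_trichotomy (u x) 0 with h | h | h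
  · simp [h, h.not_gt]
  · simp [h]
  · simp [h, h.not_gt]

theorem SobolevZero.of_tendsto (hp : 1 < p)
    {us : ℕ → EuclideanSpace ℝ (Fin N) → ℝ}
    {gs : ℕ → EuclideanSpace ℝ (Fin N) → EuclideanSpace ℝ (Fin N)}
    (hs : ∀ n, SobolevZero p Ω (us n) (gs n))
    (hu : MemLp u (ENNReal.ofReal p) ((gaussMeasure N).restrict Ω))
    (hg : MemLp g (ENNReal.ofReal p) ((gaussMeasure N).restrict Ω))
    (hul : Tendsto (fun n => ∫ x in Ω, ‖us n x - u x‖ ^ p ∂(gaussMeasure N)) atTop (𝓝 0))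
    (hgl : Tendsto (fun n => ∫ x in Ω, ‖gs n x - g x‖ ^ p ∂(gaussMeasure N)) atTop (𝓝 0)) :
    SobolevZero p Ω u g :=
  approxBy_of_tendsto hp (fun _ h => h) hs hu hg hul hgl

theorem bddBelow_rayleigh {N : ℕ} (p : ℝ) (Ω : Set (EuclideanSpace ℝ (Fin N))) :
    BddBelow {r : ℝ | ∃ w g, MemW1pZero p Ω w g ∧ ¬ (∀ᵐ x ∂(volume.restrict Ω), w x = 0) ∧
      r = (∫ x in Ω, ‖g x‖ ^ p ∂(gaussMeasure N)) / (∫ x in Ω, |w x| ^ p ∂(gaussMeasure N))} := by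
  refine ⟨0, ?_⟩
  rintro r ⟨w, g, -, -, rfl⟩
  exact div_nonneg integral_norm_rpow_nonneg (integral_norm_rpow_nonneg (u := w))

theorem integral_norm_rpow_eq_zero_iff {α F : Type*} {mα : MeasurableSpace α} {μ : Measure α}
    [NormedAddCommGroup F] {p : ℝ} (hp : 1 < p) {u : α → F}
    (hu : MemLp u (ENNReal.ofReal p) μ) :
    ∫ x, ‖u x‖ ^ p ∂μ = 0 ↔ ∀ᵐ x ∂μ, u x = 0 := by
  rw [integral_eq_zero_iff_of_nonneg (fun x => by positivity) (integrable_rpow_of_memLp hp hu)]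
  refine ⟨fun h => ?_, fun h => ?_⟩
  · filter_upwards [h] with x hx
    exact norm_eq_zero.1 ((Real.rpow_eq_zero (norm_nonneg _) (by linarith)).1 hx)
  · filter_upwards [h] with x hx
    simp [hx, Real.zero_rpow (show p ≠ 0 by linarith)]

/-- The multiplied form also covers `u = 0` a.e., where the Rayleigh quotient is not available. -/
theorem SobolevZero.lambdaOne_mul_le (hΩ : IsOpen Ω) (hp : 1 < p) (hu : SobolevZero p Ω u g) :
    lambdaOne p Ω * ∫ x in Ω, ‖u x‖ ^ p ∂(gaussMeasure N) ≤
      ∫ x in Ω, ‖g x‖ ^ p ∂(gaussMeasure N) := by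
  by_cases h0 : ∫ x in Ω, ‖u x‖ ^ p ∂(gaussMeasure N) = 0
  · rw [h0, mul_zero]
    exact integral_norm_rpow_nonneg
  · have hpos := lt_of_le_of_ne integral_norm_rpow_nonneg (Ne.symm h0)
    rw [← le_div_iff₀ hpos]
    refine csInf_le (bddBelow_rayleigh p Ω) ⟨u, g, (memW1pZero_iff hΩ hp).2 hu, fun h => h0 ?_, rfl⟩
    exact (integral_norm_rpow_eq_zero_iff hp hu.1).2 (ae_restrict_gaussMeasure_iff.2 h)

end SobolevZero

/-! ### The coercive problem with frozen right-hand side, by the direct method -/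

section ResolventProblem

variable {N : ℕ} {Ω : Set (EuclideanSpace ℝ (Fin N))} {p κ a : ℝ}
  {u v w f : EuclideanSpace ℝ (Fin N) → ℝ}
  {g h : EuclideanSpace ℝ (Fin N) → EuclideanSpace ℝ (Fin N)}

/-- `v ∈ W_0^{1,p}(Ω, γ_N)`, with gradient `g`, solves
`-div (φ_N |Dv|^{p-2} Dv) + κ φ_N |v|^{p-2} v = a φ_N |f|^{p-2} f + φ_N` weakly. -/
def IsResolventSolution (p : ℝ) (Ω : Set (EuclideanSpace ℝ (Fin N))) (κ a : ℝ)
    (f v : EuclideanSpace ℝ (Fin N) → ℝ)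
    (g : EuclideanSpace ℝ (Fin N) → EuclideanSpace ℝ (Fin N)) : Prop :=
  SobolevZero p Ω v g ∧ ∀ φ h, SobolevZero p Ω φ h →
    ∫ x in Ω, inner ℝ (pFlux p (g x)) (h x) ∂(gaussMeasure N) +
      κ * ∫ x in Ω, inner ℝ (pFlux p (v x)) (φ x) ∂(gaussMeasure N) =
    a * (∫ x in Ω, inner ℝ (pFlux p (f x)) (φ x) ∂(gaussMeasure N)) +
      ∫ x in Ω, φ x ∂(gaussMeasure N)

/-- The right-hand side functional of the resolvent problem. -/
noncomputable def resolventRHS (p : ℝ) (Ω : Set (EuclideanSpace ℝ (Fin N))) (a : ℝ)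
    (f u : EuclideanSpace ℝ (Fin N) → ℝ) : ℝ :=
  a * (∫ x in Ω, inner ℝ (pFlux p (f x)) (u x) ∂(gaussMeasure N)) +
      ∫ x in Ω, u x ∂(gaussMeasure N)

/-- The energy whose minimizer solves the resolvent problem. -/
noncomputable def resolventEnergy (p : ℝ) (Ω : Set (EuclideanSpace ℝ (Fin N))) (κ a : ℝ)
    (f u : EuclideanSpace ℝ (Fin N) → ℝ)
    (g : EuclideanSpace ℝ (Fin N) → EuclideanSpace ℝ (Fin N)) : ℝ :=
  ∫ x in Ω, ‖g x‖ ^ p ∂(gaussMeasure N) + κ * ∫ x in Ω, ‖u x‖ ^ p ∂(gaussMeasure N) -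
    p * resolventRHS p Ω a f u

variable [IsFiniteMeasure ((gaussMeasure N).restrict Ω)]

theorem resolventRHS_add_const_mul (hp : 1 < p)
    (hf : MemLp f (ENNReal.ofReal p) ((gaussMeasure N).restrict Ω))
    (hu : MemLp u (ENNReal.ofReal p) ((gaussMeasure N).restrict Ω))
    (hv : MemLp v (ENNReal.ofReal p) ((gaussMeasure N).restrict Ω)) (s t : ℝ) :
    resolventRHS p Ω a f (fun x => s * u x + t * v x) =
      s * resolventRHS p Ω a f u + t * resolventRHS p Ω a f v := by
  have h1 := (integrable_inner_pFlux hp hf hu).const_mul s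
  have h2 := (integrable_inner_pFlux hp hf hv).const_mul t
  have h3 := (integrable_of_memLp_ofReal hp hu).const_mul s
  have h4 := (integrable_of_memLp_ofReal hp hv).const_mul t
  have h5 : ∀ x, inner ℝ (pFlux p (f x)) (s * u x + t * v x) =
      s * inner ℝ (pFlux p (f x)) (u x) + t * inner ℝ (pFlux p (f x)) (v x) := fun x => by
    rw [inner_add_right, ← smul_eq_mul s, ← smul_eq_mul t, inner_smul_right, inner_smul_right]
  unfold resolventRHS
  simp_rw [h5]
  rw [integral_add h1 h2, integral_add h3 h4, integral_const_mul, integral_const_mul,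
    integral_const_mul, integral_const_mul]
  ring

/-- Source of coercivity: by Young's inequality the linear term costs an arbitrarily small multiple
of `∫‖u‖ ^ p`. -/
theorem exists_resolventRHS_le (hp : 1 < p)
    (hf : MemLp f (ENNReal.ofReal p) ((gaussMeasure N).restrict Ω)) (a : ℝ) {η : ℝ} (hη : 0 < η) :
    ∃ C : ℝ, ∀ u, MemLp u (ENNReal.ofReal p) ((gaussMeasure N).restrict Ω) →
      resolventRHS p Ω a f u ≤ η * ∫ x in Ω, ‖u x‖ ^ p ∂(gaussMeasure N) + C := by
  -- This share of `η` is spent `|a|` times on the pairing with `f` and once on the integral of `u`.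
  have hη' : 0 < η / (|a| + 1) := by positivity
  obtain ⟨C, hC0, hC⟩ := exists_inner_pFlux_le_left (F := ℝ) hp hη'
  refine ⟨|a| * (C * ∫ x in Ω, ‖f x‖ ^ p ∂(gaussMeasure N)) +
    C * ∫ x in Ω, ‖(1 : ℝ)‖ ^ p ∂(gaussMeasure N), fun u hu => ?_⟩
  have key : ∀ f : EuclideanSpace ℝ (Fin N) → ℝ,
      MemLp f (ENNReal.ofReal p) ((gaussMeasure N).restrict Ω) →
      |∫ x in Ω, inner ℝ (pFlux p (f x)) (u x) ∂(gaussMeasure N)| ≤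
      η / (|a| + 1) * ∫ x in Ω, ‖u x‖ ^ p ∂(gaussMeasure N) +
        C * ∫ x in Ω, ‖f x‖ ^ p ∂(gaussMeasure N) := by
    intro f hf
    have h1 := (integrable_rpow_of_memLp hp hu).const_mul (η / (|a| + 1))
    have h2 := (integrable_rpow_of_memLp hp hf).const_mul C
    rw [← integral_const_mul, ← integral_const_mul, ← integral_add h1 h2]
    exact abs_integral_le_integral_abs.trans
      (integral_mono (integrable_inner_pFlux hp hf hu).abs (h1.add h2) fun x => hC _ _)
  have h1 := key f hf
  have h2 := key (fun _ => 1) (memLp_const _)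
  have h3 : ∀ x, inner ℝ (pFlux p (1 : ℝ)) (u x) = u x := fun x => by simp [pFlux]
  simp_rw [h3] at h2
  have h4 := le_abs_self (a * ∫ x in Ω, inner ℝ (pFlux p (f x)) (u x) ∂(gaussMeasure N))
  rw [abs_mul] at h4
  have h5 := mul_le_mul_of_nonneg_left h1 (abs_nonneg a)
  have h6 := le_abs_self (∫ x in Ω, u x ∂(gaussMeasure N))
  have h7 : |a| * (η / (|a| + 1) * ∫ x in Ω, ‖u x‖ ^ p ∂(gaussMeasure N)) +
      η / (|a| + 1) * ∫ x in Ω, ‖u x‖ ^ p ∂(gaussMeasure N) =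
      η * ∫ x in Ω, ‖u x‖ ^ p ∂(gaussMeasure N) := by
    field_simp
  unfold resolventRHS
  linarith

theorem tendsto_integral_norm_sub_perturb {F : Type*} [NormedAddCommGroup F] [NormedSpace ℝ F]
    {α : Type*} {mα : MeasurableSpace α} {μ : Measure α} {u v : α → F}
    (hp : 1 < p) (hu : MemLp u (ENNReal.ofReal p) μ) (hv : MemLp v (ENNReal.ofReal p) μ) :
    Tendsto (fun n : ℕ => ∫ x, ‖(u x + (1 / ((n : ℝ) + 1)) • v x) - u x‖ ^ p ∂μ) atTop (𝓝 0) := by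
  refine tendsto_integral_norm_sub_of_dominated hp (V := fun x => ‖u x‖ + ‖v x‖)
    (fun n => hu.1.add (hv.1.const_smul _)) (integrable_rpow_of_memLp hp (hu.norm.add hv.norm))
    (fun n => Eventually.of_forall fun x => ?_) (Eventually.of_forall fun x => ?_)
  · refine (norm_add_le _ _).trans ?_
    have h1 : ‖(1 / ((n : ℝ) + 1))‖ ≤ 1 := by
      rw [Real.norm_of_nonneg (by positivity)]
      exact (div_le_one (by positivity)).2 (by linarith [(n.cast_nonneg : (0 : ℝ) ≤ n)])
    rw [norm_smul]
    have := mul_le_mul_of_nonneg_right h1 (norm_nonneg (v x))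
    linarith
  · have h1 := (tendsto_one_div_add_atTop_nhds_zero_nat (𝕜 := ℝ)).smul_const (v x)
    have h2 := h1.const_add (u x)
    simpa using h2

/-- The subgradient inequality taken at the perturbed point `u + t v`. With it the Euler–Lagrange
equation follows by letting `t → 0` in flux pairings, without differentiating an integral. -/
theorem integral_norm_rpow_add_smul_le {F : Type*} [NormedAddCommGroup F] [InnerProductSpace ℝ F]
    [FiniteDimensional ℝ F] {α : Type*} {mα : MeasurableSpace α} {μ : Measure α} {u v : α → F}
    (hp : 1 < p) (hu : MemLp u (ENNReal.ofReal p) μ) (hv : MemLp v (ENNReal.ofReal p) μ) (t : ℝ) :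
    ∫ x, ‖u x + t • v x‖ ^ p ∂μ ≤ ∫ x, ‖u x‖ ^ p ∂μ +
      p * t * ∫ x, inner ℝ (pFlux p (u x + t • v x)) (v x) ∂μ := by
  have hw : MemLp (fun x => u x + t • v x) (ENNReal.ofReal p) μ := hu.add (hv.const_smul t)
  have h1 := (integrable_inner_pFlux hp hw hv).const_mul (p * t)
  rw [← integral_const_mul, ← integral_add (integrable_rpow_of_memLp hp hu) h1]
  refine integral_mono (integrable_rpow_of_memLp hp hw)
    ((integrable_rpow_of_memLp hp hu).add h1) fun x => ?_
  have h2 := bregman_nonneg hp (u x) (u x + t • v x)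
  rw [bregman, show u x - (u x + t • v x) = -(t • v x) by abel, inner_neg_right,
    inner_smul_right] at h2
  simp only
  linarith

theorem isResolventSolution_of_isMin (hp : 1 < p) (hκ : 0 ≤ κ)
    (hf : MemLp f (ENNReal.ofReal p) ((gaussMeasure N).restrict Ω)) (hv : SobolevZero p Ω v g)
    (hmin : ∀ u h, SobolevZero p Ω u h →
      resolventEnergy p Ω κ a f v g ≤ resolventEnergy p Ω κ a f u h) :
    IsResolventSolution p Ω κ a f v g := by
  have key : ∀ φ h, SobolevZero p Ω φ h → resolventRHS p Ω a f φ ≤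
      ∫ x in Ω, inner ℝ (pFlux p (g x)) (h x) ∂(gaussMeasure N) +
      κ * ∫ x in Ω, inner ℝ (pFlux p (v x)) (φ x) ∂(gaussMeasure N) := by
    intro φ h hφ
    have hgm : ∀ t : ℝ, MemLp (fun x => g x + t • h x) (ENNReal.ofReal p)
        ((gaussMeasure N).restrict Ω) := fun t => hv.2.1.add (hφ.2.1.const_smul t)
    have hvm : ∀ t : ℝ, MemLp (fun x => v x + t • φ x) (ENNReal.ofReal p)
        ((gaussMeasure N).restrict Ω) := fun t => hv.1.add (hφ.1.const_smul t)
    have h1 := tendsto_integral_inner_pFlux hp (fun n : ℕ => hgm (1 / ((n : ℝ) + 1))) hv.2.1 hφ.2.1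
      (tendsto_integral_norm_sub_perturb hp hv.2.1 hφ.2.1)
    have h2 := tendsto_integral_inner_pFlux hp (fun n : ℕ => hvm (1 / ((n : ℝ) + 1))) hv.1 hφ.1
      (tendsto_integral_norm_sub_perturb hp hv.1 hφ.1)
    -- Minimality along `v + t φ` with `t = 1 / (n + 1)`, divided by `p t`, bounds the right-hand
    -- side by the flux pairings at the perturbed point.
    refine ge_of_tendsto (h1.add (h2.const_mul κ)) (Eventually.of_forall fun n => ?_)
    set t : ℝ := 1 / ((n : ℝ) + 1)
    have ht : 0 < t := by positivity
    have h3 := hmin _ _ (hv.add hp (hφ.const_mul hp t))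
    have h4 := integral_norm_rpow_add_smul_le hp hv.2.1 hφ.2.1 t
    have h5 := mul_le_mul_of_nonneg_left (integral_norm_rpow_add_smul_le hp hv.1 hφ.1 t) hκ
    have h6 := resolventRHS_add_const_mul (a := a) hp hf hv.1 hφ.1 1 t
    simp only [one_mul] at h6
    unfold resolventEnergy at h3
    rw [h6] at h3
    simp only [smul_eq_mul] at h5 ⊢
    have hpt : 0 < p * t := by positivity
    refine le_of_mul_le_mul_left ?_ hpt
    linarith
  refine ⟨hv, fun φ h hφ => le_antisymm ?_ (key φ h hφ)⟩
  -- The inequality for `-φ` is the reverse one, since both sides are linear in the test function.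
  have h1 := key _ _ (hφ.const_mul hp (-1))
  have h2 := resolventRHS_add_const_mul (a := a) hp hf hφ.1 hφ.1 (-1) 0
  simp only [zero_mul, add_zero] at h2
  rw [h2] at h1
  simp only [neg_one_smul, neg_one_mul, inner_neg_right, integral_neg] at h1
  unfold resolventRHS at h1
  linarith

/-- Solvability of the resolvent problem. -/
theorem exists_isResolventSolution (hp : 1 < p) (hκ : 0 < κ)
    (hf : MemLp f (ENNReal.ofReal p) ((gaussMeasure N).restrict Ω)) :
    ∃ v g, IsResolventSolution p Ω κ a f v g := by
  have hp0 : 0 < p := by linarith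
  -- The linear term enters the energy with factor `p`, so this choice leaves half of the `κ` term.
  obtain ⟨C, hC⟩ := exists_resolventRHS_le (Ω := Ω) hp hf a (η := κ / (2 * p)) (by positivity)
  have hcoer : ∀ u h, SobolevZero p Ω u h →
      ∫ x in Ω, ‖h x‖ ^ p ∂(gaussMeasure N) +
        κ / 2 * ∫ x in Ω, ‖u x‖ ^ p ∂(gaussMeasure N) ≤ resolventEnergy p Ω κ a f u h + p * C := by
    intro u h hu
    have h1 := mul_le_mul_of_nonneg_left (hC u hu.1) hp0.le
    have h2 : p * (κ / (2 * p) * ∫ x in Ω, ‖u x‖ ^ p ∂(gaussMeasure N) + C) =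
        κ / 2 * ∫ x in Ω, ‖u x‖ ^ p ∂(gaussMeasure N) + p * C := by
      field_simp
    unfold resolventEnergy
    linarith
  set V : Set ℝ := {r | ∃ u h, SobolevZero p Ω u h ∧ r = resolventEnergy p Ω κ a f u h} with hV
  have hVb : BddBelow V := by
    refine ⟨-(p * C), ?_⟩
    rintro r ⟨u, h, hu, rfl⟩
    have h1 := hcoer u h hu
    have h2 : 0 ≤ ∫ x in Ω, ‖h x‖ ^ p ∂(gaussMeasure N) := integral_norm_rpow_nonneg
    have h3 : 0 ≤ κ / 2 * ∫ x in Ω, ‖u x‖ ^ p ∂(gaussMeasure N) :=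
      mul_nonneg (by positivity) integral_norm_rpow_nonneg
    linarith
  have hVn : V.Nonempty := ⟨_, _, _, SobolevZero.zero hp, rfl⟩
  have hex : ∀ n : ℕ, ∃ u h, SobolevZero p Ω u h ∧
      resolventEnergy p Ω κ a f u h < sInf V + 1 / ((n : ℝ) + 1) := by
    intro n
    obtain ⟨r, ⟨u, h, hu, rfl⟩, hr⟩ := exists_lt_of_csInf_lt hVn
      (lt_add_of_pos_right (sInf V) (show (0 : ℝ) < 1 / ((n : ℝ) + 1) by positivity))
    exact ⟨u, h, hu, hr⟩
  choose us gs hs hlt using hex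
  have hle1 : ∀ n : ℕ, 1 / ((n : ℝ) + 1) ≤ 1 := fun n =>
    (div_le_one (by positivity)).2 (by linarith [(n.cast_nonneg : (0 : ℝ) ≤ n)])
  have hbound : ∀ n, ∫ x in Ω, ‖gs n x‖ ^ p ∂(gaussMeasure N) +
      κ / 2 * ∫ x in Ω, ‖us n x‖ ^ p ∂(gaussMeasure N) ≤ sInf V + 1 + p * C := fun n => by
    have h1 := hcoer _ _ (hs n)
    have h2 := hlt n
    have h3 := hle1 n
    linarith
  have hI : ∀ n, 0 ≤ ∫ x in Ω, ‖us n x‖ ^ p ∂(gaussMeasure N) := fun n =>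
    integral_norm_rpow_nonneg
  have hG : ∀ n, 0 ≤ ∫ x in Ω, ‖gs n x‖ ^ p ∂(gaussMeasure N) := fun n =>
    integral_norm_rpow_nonneg
  -- The midpoint of two almost minimizers has energy at least `sInf V`. The linear part cancels, so
  -- the convexity defects of the gradients and of the functions are together at most the sum of the
  -- two errors.
  have hdef : ∀ m n, (∫ x in Ω, ‖gs m x‖ ^ p ∂(gaussMeasure N) +
      ∫ x in Ω, ‖gs n x‖ ^ p ∂(gaussMeasure N) -
      2 * ∫ x in Ω, ‖(1 / 2 : ℝ) • (gs m x + gs n x)‖ ^ p ∂(gaussMeasure N)) +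
      κ * (∫ x in Ω, ‖us m x‖ ^ p ∂(gaussMeasure N) + ∫ x in Ω, ‖us n x‖ ^ p ∂(gaussMeasure N) -
      2 * ∫ x in Ω, ‖(1 / 2 : ℝ) • (us m x + us n x)‖ ^ p ∂(gaussMeasure N)) ≤
      1 / ((m : ℝ) + 1) + 1 / ((n : ℝ) + 1) := by
    intro m n
    have h1 : sInf V ≤ resolventEnergy p Ω κ a f (fun x => (1 / 2 : ℝ) * (us m x + us n x))
        (fun x => (1 / 2 : ℝ) • (gs m x + gs n x)) :=
      csInf_le hVb ⟨_, _, ((hs m).add hp (hs n)).const_mul hp (1 / 2), rfl⟩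
    have h2 := resolventRHS_add_const_mul (a := a) hp hf (hs m).1 (hs n).1 (1 / 2) (1 / 2)
    simp only [← mul_add] at h2
    have h3 := hlt m
    have h4 := hlt n
    unfold resolventEnergy at h1 h3 h4
    rw [h2] at h1
    simp only [smul_eq_mul]
    linarith
  have hsmall : ∀ ε : ℝ, 0 < ε → ∃ n₀ : ℕ, ∀ m ≥ n₀, ∀ n ≥ n₀,
      1 / ((m : ℝ) + 1) + 1 / ((n : ℝ) + 1) < ε := by
    intro ε hε
    obtain ⟨n₀, hn₀⟩ := eventually_atTop.1
      ((tendsto_one_div_add_atTop_nhds_zero_nat (𝕜 := ℝ)).eventually_lt_const (half_pos hε))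
    exact ⟨n₀, fun m hm n hn => by linarith [hn₀ m hm, hn₀ n hn]⟩
  have hgC := cauchy_of_midpoint_defect hp (fun n => (hs n).2.1) (B := sInf V + 1 + p * C)
    (fun n => by
      have h1 := hbound n
      have h2 := mul_nonneg (by positivity : 0 ≤ κ / 2) (hI n)
      linarith)
    (fun ε hε => by
      obtain ⟨n₀, hn₀⟩ := hsmall ε hε
      refine ⟨n₀, fun m hm n hn => ?_⟩
      have h1 := hdef m n
      have h2 := mul_nonneg hκ.le (sub_nonneg.2 (integral_midpoint_rpow_le hp (hs m).1 (hs n).1))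
      have h3 := hn₀ m hm n hn
      linarith)
  have huC := cauchy_of_midpoint_defect hp (fun n => (hs n).1)
    (B := 2 / κ * (sInf V + 1 + p * C))
    (fun n => by
      have h1 := hbound n
      have h2 := hG n
      have h3 : κ / 2 * ∫ x in Ω, ‖us n x‖ ^ p ∂(gaussMeasure N) ≤ sInf V + 1 + p * C := by
        linarith
      have h4 := mul_le_mul_of_nonneg_left h3 (by positivity : 0 ≤ 2 / κ)
      rwa [← mul_assoc, show 2 / κ * (κ / 2) = 1 by field_simp, one_mul] at h4)
    (fun ε hε => by
      obtain ⟨n₀, hn₀⟩ := hsmall (κ * ε) (by positivity)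
      refine ⟨n₀, fun m hm n hn => ?_⟩
      have h1 := hdef m n
      have h2 := integral_midpoint_rpow_le hp (hs m).2.1 (hs n).2.1
      have h3 := hn₀ m hm n hn
      refine lt_of_mul_lt_mul_left ?_ hκ.le
      linarith)
  obtain ⟨v, hv, hvl⟩ := exists_memLp_limit hp (fun n => (hs n).1) huC
  obtain ⟨g, hg, hgl⟩ := exists_memLp_limit hp (fun n => (hs n).2.1) hgC
  have hvg : SobolevZero p Ω v g := SobolevZero.of_tendsto hp hs hv hg hvl hgl
  refine ⟨v, g, isResolventSolution_of_isMin hp hκ.le hf hvg fun u h hu => ?_⟩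
  have h1 : Tendsto (fun n => resolventEnergy p Ω κ a f (us n) (gs n)) atTop
      (𝓝 (resolventEnergy p Ω κ a f v g)) :=
    ((tendsto_integral_norm_rpow hp (fun n => (hs n).2.1) hg hgl).add
      ((tendsto_integral_norm_rpow hp (fun n => (hs n).1) hv hvl).const_mul κ)).sub
      ((((tendsto_integral_inner_pFlux_right hp (fun n => (hs n).1) hv hf hvl).const_mul a).add
        (tendsto_integral_of_tendsto_rpow hp (fun n => (hs n).1) hv hvl)).const_mul p)
  have h2 : Tendsto (fun n : ℕ => sInf V + 1 / ((n : ℝ) + 1)) atTop (𝓝 (sInf V)) := by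
    simpa using (tendsto_one_div_add_atTop_nhds_zero_nat (𝕜 := ℝ)).const_add (sInf V)
  exact (le_of_tendsto_of_tendsto' h1 h2 fun n => (hlt n).le).trans
    (csInf_le hVb ⟨u, h, hu, rfl⟩)

end ResolventProblem

/-! ### Cauchy criteria from order and from monotonicity of the flux -/

section Monotonicity

theorem pFlux_le_pFlux {p : ℝ} (hp : 1 < p) {x y : ℝ} (hxy : x ≤ y) : pFlux p x ≤ pFlux p y := by
  rcases hxy.eq_or_lt with rfl | h
  · exact le_rfl
  · have h1 := inner_pFlux_sub_nonneg hp x y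
    rw [real_inner_eq_re_inner ℝ] at h1
    simp only [RCLike.inner_apply, conj_trivial, RCLike.re_to_real] at h1
    by_contra h2
    push Not at h2
    nlinarith

theorem inner_pFlux_real (p x y : ℝ) : inner ℝ (pFlux p x) y = pFlux p x * y := by
  simp [mul_comm]

theorem pFlux_nonneg {p : ℝ} {x : ℝ} (hx : 0 ≤ x) : 0 ≤ pFlux p x :=
  mul_nonneg (by positivity) hx

variable {α : Type*} {mα : MeasurableSpace α} {μ : Measure α}

/-- Superadditivity of `t ↦ t ^ p` on nonnegative reals bounds `∫‖u m - u n‖ ^ p` by an increment of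
the bounded monotone sequence `∫‖u n‖ ^ p`. -/
theorem cauchy_of_monotone_of_bounded {p : ℝ} (hp : 1 < p) {u : ℕ → α → ℝ}
    (hu : ∀ n, MemLp (u n) (ENNReal.ofReal p) μ) {B : ℝ} (hB : ∀ n, ∫ x, ‖u n x‖ ^ p ∂μ ≤ B)
    (h0 : ∀ n, ∀ᵐ x ∂μ, 0 ≤ u n x) (hmono : ∀ n, ∀ᵐ x ∂μ, u n x ≤ u (n + 1) x)
    (ε : ℝ) (hε : 0 < ε) :
    ∃ n₀, ∀ m ≥ n₀, ∀ n ≥ n₀, ∫ x, ‖u m x - u n x‖ ^ p ∂μ < ε := by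
  have hm : ∀ᵐ x ∂μ, Monotone fun n => u n x := by
    filter_upwards [ae_all_iff.2 hmono] with x hx
    exact monotone_nat_of_le_succ hx
  have hi := fun n => integrable_rpow_of_memLp hp (hu n)
  have hkey : ∀ n m, n ≤ m → ∫ x, ‖u m x - u n x‖ ^ p ∂μ ≤
      ∫ x, ‖u m x‖ ^ p ∂μ - ∫ x, ‖u n x‖ ^ p ∂μ := by
    intro n m hnm
    rw [← integral_sub (hi m) (hi n)]
    refine integral_mono_ae (integrable_rpow_of_memLp hp ((hu m).sub (hu n)))
      ((hi m).sub (hi n)) ?_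
    filter_upwards [hm, h0 n] with x hx hx0
    have h1 : u n x ≤ u m x := hx hnm
    have h2 := Real.add_rpow_le_rpow_add hx0 (sub_nonneg.2 h1) hp.le
    rw [Real.norm_of_nonneg (sub_nonneg.2 h1), Real.norm_of_nonneg hx0,
      Real.norm_of_nonneg (hx0.trans h1)]
    rw [add_sub_cancel] at h2
    linarith
  set I : ℕ → ℝ := fun n => ∫ x, ‖u n x‖ ^ p ∂μ with hI
  have hImono : Monotone I := by
    intro n m hnm
    have h1 : 0 ≤ ∫ x, ‖u m x - u n x‖ ^ p ∂μ := integral_norm_rpow_nonneg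
    have h2 := hkey n m hnm
    simp only [hI]
    linarith
  have hIb : BddAbove (range I) := ⟨B, by rintro _ ⟨n, rfl⟩; exact hB n⟩
  have hc := (tendsto_atTop_ciSup hImono hIb).cauchySeq
  obtain ⟨n₀, hn₀⟩ := Metric.cauchySeq_iff.1 hc ε hε
  refine ⟨n₀, fun m hm n hn => ?_⟩
  have h1 := hn₀ m hm n hn
  rw [Real.dist_eq] at h1
  rcases le_total n m with h | h
  · exact (hkey n m h).trans_lt ((le_abs_self _).trans_lt h1)
  · rw [abs_sub_comm] at h1
    rw [integral_norm_sub_comm_rpow]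
    exact (hkey m n h).trans_lt ((le_abs_self _).trans_lt h1)

theorem integrable_inner_pFlux_sub {F : Type*} [NormedAddCommGroup F] [InnerProductSpace ℝ F]
    [FiniteDimensional ℝ F] {p : ℝ} (hp : 1 < p) {u v w : α → F}
    (hu : MemLp u (ENNReal.ofReal p) μ) (hv : MemLp v (ENNReal.ofReal p) μ)
    (hw : MemLp w (ENNReal.ofReal p) μ) :
    Integrable (fun x => inner ℝ (pFlux p (u x) - pFlux p (v x)) (w x)) μ := by
  simp_rw [inner_sub_left]
  exact (integrable_inner_pFlux hp hu hw).sub (integrable_inner_pFlux hp hv hw)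

theorem integral_inner_pFlux_sub {F : Type*} [NormedAddCommGroup F] [InnerProductSpace ℝ F]
    [FiniteDimensional ℝ F] {p : ℝ} (hp : 1 < p) {u v w : α → F}
    (hu : MemLp u (ENNReal.ofReal p) μ) (hv : MemLp v (ENNReal.ofReal p) μ)
    (hw : MemLp w (ENNReal.ofReal p) μ) :
    ∫ x, inner ℝ (pFlux p (u x) - pFlux p (v x)) (w x) ∂μ =
      ∫ x, inner ℝ (pFlux p (u x)) (w x) ∂μ - ∫ x, inner ℝ (pFlux p (v x)) (w x) ∂μ := by
  simp_rw [inner_sub_left]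
  exact integral_sub (integrable_inner_pFlux hp hu hw) (integrable_inner_pFlux hp hv hw)

/-- The flux pairing dominates the Bregman distance up to the factor `p`, and the latter controls
`‖u m - u n‖ ^ p` up to a small multiple of the bounded masses. -/
theorem cauchy_of_inner_pFlux_sub {F : Type*} [NormedAddCommGroup F] [InnerProductSpace ℝ F]
    [FiniteDimensional ℝ F] {p : ℝ} (hp : 1 < p) {u : ℕ → α → F}
    (hu : ∀ n, MemLp (u n) (ENNReal.ofReal p) μ) {B : ℝ} (hB : ∀ n, ∫ x, ‖u n x‖ ^ p ∂μ ≤ B)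
    (h : ∀ ε : ℝ, 0 < ε → ∃ n₀, ∀ m ≥ n₀, ∀ n ≥ n₀,
      ∫ x, inner ℝ (pFlux p (u m x) - pFlux p (u n x)) (u m x - u n x) ∂μ < ε)
    (ε : ℝ) (hε : 0 < ε) :
    ∃ n₀, ∀ m ≥ n₀, ∀ n ≥ n₀, ∫ x, ‖u m x - u n x‖ ^ p ∂μ < ε := by
  have hB0 : 0 ≤ B := integral_norm_rpow_nonneg.trans (hB 0)
  have hp0 : 0 < p := by linarith
  obtain ⟨C, hC0, hC⟩ := exists_norm_sub_rpow_le_bregman (F := F) hp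
    (η := ε / (4 * B + 4)) (by positivity)
  obtain ⟨n₀, hn₀⟩ := h (ε / (2 * (C * p) + 2)) (by positivity)
  refine ⟨n₀, fun m hm n hn => ?_⟩
  have hi1 := integrable_rpow_of_memLp hp (hu m)
  have hi2 := integrable_rpow_of_memLp hp (hu n)
  have hi12 : Integrable (fun x => ‖u m x‖ ^ p + ‖u n x‖ ^ p) μ := hi1.add hi2
  have hi3 := integrable_inner_pFlux_sub hp (hu m) (hu n) ((hu m).sub (hu n))
  have h1 : ∫ x, ‖u m x - u n x‖ ^ p ∂μ ≤
      ε / (4 * B + 4) * (∫ x, ‖u m x‖ ^ p ∂μ + ∫ x, ‖u n x‖ ^ p ∂μ) +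
        C * p * ∫ x, inner ℝ (pFlux p (u m x) - pFlux p (u n x)) (u m x - u n x) ∂μ := by
    rw [← integral_add hi1 hi2, ← integral_const_mul, ← integral_const_mul]
    refine (integral_mono (integrable_rpow_of_memLp hp ((hu m).sub (hu n)))
      ((hi12.const_mul _).add (hi3.const_mul _)) fun x => ?_).trans_eq
      (integral_add (hi12.const_mul _) (hi3.const_mul _))
    have h2 := bregman_add_bregman (p := p) (u m x) (u n x)
    have h3 := bregman_nonneg hp (u n x) (u m x)
    refine (hC (u m x) (u n x)).trans ?_
    simp only [Pi.add_apply, Pi.sub_apply]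
    rw [mul_assoc C p, ← h2]
    gcongr
    linarith
  have h2 := hn₀ m hm n hn
  have h3 : ε / (4 * B + 4) * (∫ x, ‖u m x‖ ^ p ∂μ + ∫ x, ‖u n x‖ ^ p ∂μ) ≤
      ε / (4 * B + 4) * (2 * B) :=
    mul_le_mul_of_nonneg_left (by linarith [hB m, hB n]) (by positivity)
  have h4 : C * p * ∫ x, inner ℝ (pFlux p (u m x) - pFlux p (u n x)) (u m x - u n x) ∂μ ≤
      C * p * (ε / (2 * (C * p) + 2)) := mul_le_mul_of_nonneg_left h2.le (by positivity)
  have h5 : ε / (4 * B + 4) * (2 * B) < ε / 2 := by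
    rw [div_mul_eq_mul_div, div_lt_div_iff₀ (by positivity) two_pos]
    nlinarith
  have h6 : C * p * (ε / (2 * (C * p) + 2)) < ε / 2 := by
    rw [mul_div_assoc', div_lt_div_iff₀ (by positivity) two_pos]
    nlinarith
  linarith

end Monotonicity

/-! ### Comparison, monotone iteration and the minimal solution -/

section Existence

variable {N : ℕ} {Ω : Set (EuclideanSpace ℝ (Fin N))} {p κ a b α β : ℝ}
  {v w f₁ f₂ : EuclideanSpace ℝ (Fin N) → ℝ}
  {g h : EuclideanSpace ℝ (Fin N) → EuclideanSpace ℝ (Fin N)}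
  [IsFiniteMeasure ((gaussMeasure N).restrict Ω)]

/-- Comparison principle for the resolvent problem. -/
theorem IsResolventSolution.le (hp : 1 < p) (hκ : 0 < κ)
    (hf₁ : MemLp f₁ (ENNReal.ofReal p) ((gaussMeasure N).restrict Ω))
    (hf₂ : MemLp f₂ (ENNReal.ofReal p) ((gaussMeasure N).restrict Ω))
    (hv : IsResolventSolution p Ω κ a f₁ v g) (hw : IsResolventSolution p Ω κ b f₂ w h)
    (hle : ∀ᵐ x ∂((gaussMeasure N).restrict Ω), a * pFlux p (f₁ x) ≤ b * pFlux p (f₂ x)) :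
    ∀ᵐ x ∂((gaussMeasure N).restrict Ω), v x ≤ w x := by
  -- Both equations are tested with `(v - w)⁺`. The gradient and zero-order monotonicity terms are
  -- nonnegative while the difference of the right sides is nonpositive, so the zero-order term
  -- vanishes.
  have hφ := (hv.1.sub hp hw.1).pos hp
  have h1 := hv.2 _ _ hφ
  have h2 := hw.2 _ _ hφ
  have h3 := integral_inner_pFlux_sub hp hv.1.2.1 hw.1.2.1 hφ.2.1
  have h4 := integral_inner_pFlux_sub hp hv.1.1 hw.1.1 hφ.1
  have h5 : a * ∫ x in Ω, inner ℝ (pFlux p (f₁ x)) (max (v x - w x) 0) ∂(gaussMeasure N) ≤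
      b * ∫ x in Ω, inner ℝ (pFlux p (f₂ x)) (max (v x - w x) 0) ∂(gaussMeasure N) := by
    rw [← integral_const_mul, ← integral_const_mul]
    refine integral_mono_ae ((integrable_inner_pFlux hp hf₁ hφ.1).const_mul a)
      ((integrable_inner_pFlux hp hf₂ hφ.1).const_mul b) ?_
    filter_upwards [hle] with x hx
    rw [inner_pFlux_real, inner_pFlux_real, ← mul_assoc, ← mul_assoc]
    exact mul_le_mul_of_nonneg_right hx (le_max_right _ _)
  have h6 : 0 ≤ ∫ x in Ω, inner ℝ (pFlux p (g x) - pFlux p (h x))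
      ((if 0 < v x - w x then (1 : ℝ) else 0) • (g x - h x)) ∂(gaussMeasure N) := by
    refine integral_nonneg fun x => ?_
    rw [inner_smul_right]
    exact mul_nonneg (by split_ifs <;> simp) (inner_pFlux_sub_nonneg hp _ _)
  have hpt : ∀ x, inner ℝ (pFlux p (v x) - pFlux p (w x)) (max (v x - w x) 0) =
      (if 0 < v x - w x then (1 : ℝ) else 0) *
        inner ℝ (pFlux p (v x) - pFlux p (w x)) (v x - w x) := fun x => by
    split_ifs with hx
    · rw [max_eq_left hx.le, one_mul]
    · rw [max_eq_right (not_lt.1 hx), inner_zero_right, zero_mul]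
  have hnn : ∀ x, 0 ≤ inner ℝ (pFlux p (v x) - pFlux p (w x)) (max (v x - w x) 0) := fun x => by
    rw [hpt]
    exact mul_nonneg (by split_ifs <;> simp) (inner_pFlux_sub_nonneg hp _ _)
  have h7 : 0 ≤ ∫ x in Ω, inner ℝ (pFlux p (v x) - pFlux p (w x)) (max (v x - w x) 0)
      ∂(gaussMeasure N) := integral_nonneg hnn
  have h8 : ∫ x in Ω, inner ℝ (pFlux p (v x) - pFlux p (w x)) (max (v x - w x) 0)
      ∂(gaussMeasure N) = 0 := by
    refine le_antisymm ?_ h7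
    refine le_of_mul_le_mul_left ?_ hκ
    rw [h4]
    linarith
  rw [integral_eq_zero_iff_of_nonneg hnn
    (integrable_inner_pFlux_sub hp hv.1.1 hw.1.1 hφ.1)] at h8
  filter_upwards [h8] with x hx
  by_contra hlt
  push Not at hlt
  rw [hpt, if_pos (sub_pos.2 hlt), one_mul] at hx
  exact hlt.ne' (eq_of_inner_pFlux_sub_eq_zero hp hx)

-- Adding `μ |v|^(p-2) v` to both sides turns a solution of the original problem into a fixed point
-- of the iteration with parameter `κ`.
omit [IsFiniteMeasure ((gaussMeasure N).restrict Ω)] in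
theorem IsResolventSolution.shift {μ : ℝ} (hv : IsResolventSolution p Ω κ a v v g) :
    IsResolventSolution p Ω (κ + μ) (a + μ) v v g := by
  refine ⟨hv.1, fun φ h hφ => ?_⟩
  have := hv.2 φ h hφ
  linear_combination this

theorem isTorsionFunction_iff (hΩ : IsOpen Ω) (hp : 1 < p) :
    IsTorsionFunction p α Ω v ↔ ∃ g, IsResolventSolution p Ω 0 α v v g := by
  have h1 : ∀ x y : ℝ, inner ℝ (pFlux p x) y = |x| ^ (p - 2) * x * y := fun x y => by
    rw [inner_pFlux_real, pFlux, smul_eq_mul, Real.norm_eq_abs]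
  unfold IsTorsionFunction IsResolventSolution
  simp only [memW1pZero_iff hΩ hp, zero_mul, add_zero, h1, inner_pFlux]

/-- Weak solutions below the first eigenvalue are nonnegative. -/
theorem IsResolventSolution.nonneg (hΩ : IsOpen Ω) (hp : 1 < p) (hα : α < lambdaOne p Ω)
    (hv : IsResolventSolution p Ω 0 α v v g) :
    ∀ᵐ x ∂((gaussMeasure N).restrict Ω), 0 ≤ v x := by
  -- With the negative part as test function the equation reads `∫|Dv⁻|^p + ∫v⁻ = α ∫|v⁻|^p`,
  -- incompatible with `α < λ₁` unless `v⁻ = 0`.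
  have hφ := (hv.1.const_mul hp (-1)).pos hp
  have h1 := hv.2 _ _ hφ
  have h2 : ∀ x, inner ℝ (pFlux p (g x)) ((if 0 < -1 * v x then (1 : ℝ) else 0) • (-1 : ℝ) • g x) =
      -‖(if 0 < -1 * v x then (1 : ℝ) else 0) • (-1 : ℝ) • g x‖ ^ p := fun x => by
    split_ifs
    · simp [inner_pFlux_self hp]
    · simp [Real.zero_rpow (show p ≠ 0 by linarith)]
  have h3 : ∀ x, inner ℝ (pFlux p (v x)) (max (-1 * v x) 0) = -‖max (-1 * v x) 0‖ ^ p := fun x => by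
    rcases le_total 0 (v x) with h | h
    · rw [max_eq_right (by linarith)]
      simp [Real.zero_rpow (show p ≠ 0 by linarith)]
    · rw [max_eq_left (by linarith), neg_one_mul, inner_neg_right, inner_pFlux_self hp, norm_neg]
  simp_rw [h2, h3, integral_neg] at h1
  have h4 := hφ.lambdaOne_mul_le hΩ hp
  have h5 : 0 ≤ ∫ x in Ω, max (-1 * v x) 0 ∂(gaussMeasure N) :=
    integral_nonneg fun x => le_max_right _ _
  have h6 : 0 ≤ ∫ x in Ω, ‖max (-1 * v x) 0‖ ^ p ∂(gaussMeasure N) := integral_norm_rpow_nonneg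
  have h7 : ∫ x in Ω, ‖max (-1 * v x) 0‖ ^ p ∂(gaussMeasure N) = 0 := by
    refine le_antisymm ?_ h6
    by_contra h8
    push Not at h8
    have := mul_lt_mul_of_pos_right hα h8
    linarith
  rw [integral_norm_rpow_eq_zero_iff hp hφ.1] at h7
  filter_upwards [h7] with x hx
  have := le_max_left (-1 * v x) 0
  linarith

theorem exists_resolvent_iteration (hp : 1 < p) (hκ : 0 < κ) (a : ℝ) :
    ∃ (vs : ℕ → EuclideanSpace ℝ (Fin N) → ℝ)
      (gs : ℕ → EuclideanSpace ℝ (Fin N) → EuclideanSpace ℝ (Fin N)), vs 0 = (fun _ => 0) ∧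
      (∀ n, MemLp (vs n) (ENNReal.ofReal p) ((gaussMeasure N).restrict Ω)) ∧
      ∀ n, IsResolventSolution p Ω κ a (vs n) (vs (n + 1)) (gs (n + 1)) := by
  have hex : ∀ P : {f : EuclideanSpace ℝ (Fin N) → ℝ //
      MemLp f (ENNReal.ofReal p) ((gaussMeasure N).restrict Ω)},
      ∃ v g, IsResolventSolution p Ω κ a P.1 v g := fun P => exists_isResolventSolution hp hκ P.2
  choose V G hVG using hex
  set seq : ℕ → {f : EuclideanSpace ℝ (Fin N) → ℝ //
      MemLp f (ENNReal.ofReal p) ((gaussMeasure N).restrict Ω)} :=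
    fun n => Nat.rec ⟨fun _ => 0, MemLp.zero'⟩ (fun _ P => ⟨V P, (hVG P).1.1⟩) n
  -- Gradients are indexed so that `gs (n + 1)` belongs to `vs (n + 1)`; the value `gs 0` has no
  -- meaning and is never used.
  exact ⟨fun n => (seq n).1, fun n => G (seq (n - 1)), rfl, fun n => (seq n).2,
    fun n => hVG (seq n)⟩

/-- Existence of a minimal weak solution below the first eigenvalue. -/
theorem exists_minimal_solution (hΩ : IsOpen Ω) (hp : 1 < p) (hα : α < lambdaOne p Ω) :
    ∃ v g, IsResolventSolution p Ω 0 α v v g ∧ ∀ β w h, α ≤ β → β < lambdaOne p Ω →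
      IsResolventSolution p Ω 0 β w w h →
      ∀ᵐ x ∂((gaussMeasure N).restrict Ω), v x ≤ w x := by
  -- Large enough that `α + κ > 0`, so that the right side of the iteration increases with the
  -- previous iterate.
  set κ : ℝ := |α| + 1 with hκdef
  have hκ : 0 < κ := by positivity
  have hακ : 0 < α + κ := by
    have := neg_abs_le α
    linarith
  obtain ⟨vs, gs, hv0, hvm, hvs⟩ := exists_resolvent_iteration (Ω := Ω) hp hκ (α + κ)
  -- The zero function solves the problem with datum `-1` and `a = 1`, because the flux of `-1`
  -- cancels the source `1`. In this form the comparison principle starts the induction at `0 ≤ vs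
  -- 1`.
  have hzero : IsResolventSolution p Ω κ 1 (fun _ => (-1 : ℝ)) (fun _ => 0) (fun _ => 0) := by
    refine ⟨SobolevZero.zero hp, fun φ h hφ => ?_⟩
    have h1 : ∀ y : ℝ, inner ℝ (pFlux p (-1 : ℝ)) y = -y := fun y => by simp [pFlux]
    simp_rw [pFlux_zero, inner_zero_left, h1, integral_neg]
    simp
  have hmono : ∀ n, ∀ᵐ x ∂((gaussMeasure N).restrict Ω), vs n x ≤ vs (n + 1) x := by
    intro n
    induction n with
    | zero =>
      rw [hv0]
      refine hzero.le hp hκ (memLp_const _) (hvm 0) (hvs 0) (Eventually.of_forall fun x => ?_)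
      rw [hv0]
      simp [pFlux]
    | succ n ih =>
      refine (hvs n).le hp hκ (hvm n) (hvm (n + 1)) (hvs (n + 1)) ?_
      filter_upwards [ih] with x hx
      exact mul_le_mul_of_nonneg_left (pFlux_le_pFlux hp hx) hακ.le
  have hnn : ∀ n, ∀ᵐ x ∂((gaussMeasure N).restrict Ω), 0 ≤ vs n x := by
    intro n
    induction n with
    | zero => exact Eventually.of_forall fun x => by rw [hv0]
    | succ n ih =>
      filter_upwards [ih, hmono n] with x h1 h2
      exact h1.trans h2
  -- Testing with the iterate itself and replacing `vs n` by the larger `vs (n + 1)` on the right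
  -- makes the `κ` terms cancel.
  have henergy : ∀ n, ∫ x in Ω, ‖gs (n + 1) x‖ ^ p ∂(gaussMeasure N) ≤
      α * ∫ x in Ω, ‖vs (n + 1) x‖ ^ p ∂(gaussMeasure N) +
        ∫ x in Ω, vs (n + 1) x ∂(gaussMeasure N) := by
    intro n
    have h1 := (hvs n).2 _ _ (hvs n).1
    simp_rw [inner_pFlux_self hp] at h1
    have h2 : ∫ x in Ω, inner ℝ (pFlux p (vs n x)) (vs (n + 1) x) ∂(gaussMeasure N) ≤
        ∫ x in Ω, ‖vs (n + 1) x‖ ^ p ∂(gaussMeasure N) := by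
      refine integral_mono_ae (integrable_inner_pFlux hp (hvm n) (hvm (n + 1)))
        (integrable_rpow_of_memLp hp (hvm (n + 1))) ?_
      filter_upwards [hmono n, hnn (n + 1)] with x hx hx0
      rw [← inner_pFlux_self hp, inner_pFlux_real, inner_pFlux_real]
      exact mul_le_mul_of_nonneg_right (pFlux_le_pFlux hp hx) hx0
    have h3 := mul_le_mul_of_nonneg_left h2 hακ.le
    linarith
  set c : ℝ := lambdaOne p Ω - α with hc
  have hc0 : 0 < c := sub_pos.2 hα
  -- Half of the spectral gap `c` absorbs the source term; the other half bounds the iterates in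
  -- `L^p`.
  obtain ⟨C, hC⟩ := exists_resolventRHS_le (Ω := Ω) (f := fun _ => 0) hp (memLp_const _) 0
    (half_pos hc0)
  have hC' : ∀ n, ∫ x in Ω, vs n x ∂(gaussMeasure N) ≤
      c / 2 * ∫ x in Ω, ‖vs n x‖ ^ p ∂(gaussMeasure N) + C := fun n => by
    have := hC (vs n) (hvm n)
    simpa [resolventRHS] using this
  have hvB : ∀ n, ∫ x in Ω, ‖vs (n + 1) x‖ ^ p ∂(gaussMeasure N) ≤ 2 * C / c := by
    intro n
    have h1 := henergy n
    have h2 := hC' (n + 1)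
    have h3 := (hvs n).1.lambdaOne_mul_le hΩ hp
    rw [le_div_iff₀ hc0]
    have h4 : c * ∫ x in Ω, ‖vs (n + 1) x‖ ^ p ∂(gaussMeasure N) ≤
        c / 2 * ∫ x in Ω, ‖vs (n + 1) x‖ ^ p ∂(gaussMeasure N) + C := by
      rw [hc, sub_mul]
      linarith
    linarith
  have hgB : ∀ n, ∫ x in Ω, ‖gs (n + 1) x‖ ^ p ∂(gaussMeasure N) ≤
      (|α| + c / 2) * (2 * C / c) + C := by
    intro n
    have h1 := henergy n
    have h2 := hC' (n + 1)
    have h3 : 0 ≤ ∫ x in Ω, ‖vs (n + 1) x‖ ^ p ∂(gaussMeasure N) := integral_norm_rpow_nonneg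
    have h4 := mul_le_mul_of_nonneg_right (le_abs_self α) h3
    have h5 := mul_le_mul_of_nonneg_left (hvB n) (show 0 ≤ |α| + c / 2 by positivity)
    linarith
  have hvC := cauchy_of_monotone_of_bounded hp (fun n => hvm (n + 1)) hvB (fun n => hnn (n + 1))
    (fun n => hmono (n + 1))
  -- Subtracting two equations, tested with the difference of the iterates, bounds the gradient
  -- pairing by pairings of bounded fluxes with a difference that is already small in `L^p`.
  have hgC := cauchy_of_inner_pFlux_sub hp (fun n => (hvs n).1.2.1) hgB (fun ε hε => by
    have hB0 : 0 ≤ 2 * C / c := integral_norm_rpow_nonneg.trans (hvB 0)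
    obtain ⟨K, hK0, hK⟩ := exists_inner_pFlux_le_right (F := ℝ) hp
      (η := ε / (α + κ) / (4 * (2 * C / c) + 4)) (by positivity)
    obtain ⟨n₀, hn₀⟩ := hvC (ε / (α + κ) / (4 * K + 4)) (by positivity)
    refine ⟨n₀ + 1, fun m hm n hn => ?_⟩
    obtain ⟨m, rfl⟩ : ∃ m', m = m' + 1 := ⟨m - 1, by omega⟩
    obtain ⟨n, rfl⟩ : ∃ n', n = n' + 1 := ⟨n - 1, by omega⟩
    have hd := (hvs (m + 1)).1.sub hp (hvs (n + 1)).1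
    have h1 := (hvs (m + 1)).2 _ _ hd
    have h2 := (hvs (n + 1)).2 _ _ hd
    have h3 := integral_inner_pFlux_sub hp (hvs (m + 1)).1.2.1 (hvs (n + 1)).1.2.1 hd.2.1
    have h4 := integral_inner_pFlux_sub hp (hvs (m + 1)).1.1 (hvs (n + 1)).1.1 hd.1
    have h5 : 0 ≤ ∫ x in Ω, inner ℝ (pFlux p (vs (m + 1 + 1) x) - pFlux p (vs (n + 1 + 1) x))
        (vs (m + 1 + 1) x - vs (n + 1 + 1) x) ∂(gaussMeasure N) :=
      integral_nonneg fun x => inner_pFlux_sub_nonneg hp _ _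
    have h6 := mul_nonneg hκ.le h5
    have hbd : ∀ k, |∫ x in Ω, inner ℝ (pFlux p (vs (k + 1) x))
        (vs (m + 1 + 1) x - vs (n + 1 + 1) x) ∂(gaussMeasure N)| < ε / (α + κ) / 2 := by
      intro k
      have hi1 := (integrable_rpow_of_memLp hp (hvm (k + 1))).const_mul
        (ε / (α + κ) / (4 * (2 * C / c) + 4))
      have hi2 := (integrable_rpow_of_memLp hp hd.1).const_mul K
      have h7 := abs_integral_le_integral_abs.trans
        (integral_mono (integrable_inner_pFlux hp (hvm (k + 1)) hd.1).abs (hi1.add hi2)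
          fun x => hK _ _)
      simp only [Pi.add_apply] at h7
      rw [integral_add hi1 hi2, integral_const_mul, integral_const_mul] at h7
      have h8 := mul_le_mul_of_nonneg_left (hvB k)
        (show 0 ≤ ε / (α + κ) / (4 * (2 * C / c) + 4) by positivity)
      have h9 := mul_le_mul_of_nonneg_left (hn₀ (m + 1) (by omega) (n + 1) (by omega)).le hK0
      have h10 : ε / (α + κ) / (4 * (2 * C / c) + 4) * (2 * C / c) < ε / (α + κ) / 4 := by
        have : 0 < ε / (α + κ) := by positivity
        rw [div_mul_eq_mul_div, div_lt_div_iff₀ (by positivity) (by norm_num)]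
        nlinarith
      have h11 : K * (ε / (α + κ) / (4 * K + 4)) < ε / (α + κ) / 4 := by
        have : 0 < ε / (α + κ) := by positivity
        rw [mul_div_assoc', div_lt_div_iff₀ (by positivity) (by norm_num)]
        nlinarith
      linarith
    have h7 := (le_abs_self _).trans_lt (hbd m)
    have h8 := (neg_le_abs _).trans_lt (hbd n)
    have h9 : (α + κ) * (∫ x in Ω, inner ℝ (pFlux p (vs (m + 1) x))
        (vs (m + 1 + 1) x - vs (n + 1 + 1) x) ∂(gaussMeasure N) -
        ∫ x in Ω, inner ℝ (pFlux p (vs (n + 1) x))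
        (vs (m + 1 + 1) x - vs (n + 1 + 1) x) ∂(gaussMeasure N)) < (α + κ) * (ε / (α + κ)) :=
      mul_lt_mul_of_pos_left (by linarith) hακ
    rw [mul_div_cancel₀ _ hακ.ne'] at h9
    rw [h4] at h6
    linarith)
  obtain ⟨v, hv, hvl⟩ := exists_memLp_limit hp (fun n => hvm (n + 1)) hvC
  obtain ⟨g, hg, hgl⟩ := exists_memLp_limit hp (fun n => (hvs n).1.2.1) hgC
  have hvg : SobolevZero p Ω v g := SobolevZero.of_tendsto hp (fun n => (hvs n).1) hv hg hvl hgl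
  refine ⟨v, g, ⟨hvg, fun φ h hφ => ?_⟩, fun β w h hαβ hβ hw => ?_⟩
  · have h1 := tendsto_integral_inner_pFlux hp (fun n => (hvs n).1.2.1) hg hφ.2.1 hgl
    have h2 := tendsto_integral_inner_pFlux hp (fun n => hvm (n + 1)) hv hφ.1 hvl
    have h3 := (h1.add (h2.const_mul κ)).comp (tendsto_add_atTop_nat 1)
    have h4 := (h2.const_mul (α + κ)).add_const (∫ x in Ω, φ x ∂(gaussMeasure N))
    -- The left side of step `n + 1` involves `vs (n + 2)` and the right side `vs (n + 1)`; the
    -- shift in `h3` matches them, and in the limit `κ` cancels.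
    have h5 := tendsto_nhds_unique (h4.congr fun n => ((hvs (n + 1)).2 φ h hφ).symm) h3
    linear_combination -h5
  · have hw0 := hw.nonneg hΩ hp hβ
    have hws := hw.shift (μ := κ)
    rw [zero_add] at hws
    -- Any solution `w` at level `β ≥ α` is a supersolution of every step of the iteration, because
    -- `w ≥ 0`.
    have hvw : ∀ n, ∀ᵐ x ∂((gaussMeasure N).restrict Ω), vs n x ≤ w x := by
      intro n
      induction n with
      | zero =>
        filter_upwards [hw0] with x hx
        rwa [hv0]
      | succ n ih =>
        refine (hvs n).le hp hκ (hvm n) hw.1.1 hws ?_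
        filter_upwards [ih, hw0] with x hx hx0
        have h1 := mul_le_mul_of_nonneg_left (pFlux_le_pFlux hp hx) hακ.le
        have h2 := mul_le_mul_of_nonneg_right (show α + κ ≤ β + κ by linarith)
          (pFlux_nonneg (p := p) hx0)
        exact h1.trans h2
    obtain ⟨ns, -, hae⟩ := exists_subseq_tendsto_ae hp (fun n => hvm (n + 1)) hv hvl
    filter_upwards [hae, ae_all_iff.2 hvw] with x hx hxw
    exact le_of_tendsto hx (Eventually.of_forall fun n => hxw _)

end Existence

/-! ### A smooth approximation of `|t| ^ p` vanishing at `0` -/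

section SmoothPower

/-- A smooth approximation of `|t| ^ p`, as `δ → 0`. -/
noncomputable def smoothAbsRpow (p δ t : ℝ) : ℝ := (t ^ 2 + δ ^ 2) ^ (p / 2) - δ ^ p

theorem sq_rpow_half {p t : ℝ} : (t ^ 2) ^ (p / 2) = |t| ^ p := by
  rw [← sq_abs, ← Real.rpow_natCast, ← Real.rpow_mul (abs_nonneg t)]
  congr 1
  push_cast
  ring

theorem contDiff_smoothAbsRpow {p δ : ℝ} (hδ : 0 < δ) : ContDiff ℝ ∞ (smoothAbsRpow p δ) := by
  refine ContDiff.sub (ContDiff.rpow_const_of_ne (by fun_prop) fun t => ?_) contDiff_const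
  positivity

theorem smoothAbsRpow_zero {p δ : ℝ} (hδ : 0 < δ) : smoothAbsRpow p δ 0 = 0 := by
  rw [smoothAbsRpow, zero_pow two_ne_zero, zero_add, sq_rpow_half, abs_of_pos hδ, sub_self]

theorem hasDerivAt_smoothAbsRpow {p δ : ℝ} (hδ : 0 < δ) (t : ℝ) :
    HasDerivAt (smoothAbsRpow p δ) (p * t * (t ^ 2 + δ ^ 2) ^ (p / 2 - 1)) t := by
  have h := ((((hasDerivAt_id t).pow 2).add_const (δ ^ 2)).rpow_const (p := p / 2)
    (Or.inl (show (id ^ 2) t + δ ^ 2 ≠ 0 by simp only [Pi.pow_apply, id]; positivity))).sub_const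
    (δ ^ p)
  refine h.congr_deriv ?_
  simp only [Pi.pow_apply, id_eq, Nat.cast_ofNat]
  ring

theorem smoothAbsRpow_nonneg {p δ : ℝ} (hp : 1 < p) (hδ : 0 < δ) (t : ℝ) :
    0 ≤ smoothAbsRpow p δ t := by
  have h : (δ ^ 2) ^ (p / 2) ≤ (t ^ 2 + δ ^ 2) ^ (p / 2) :=
    Real.rpow_le_rpow (by positivity) (by linarith [sq_nonneg t]) (by linarith)
  rw [sq_rpow_half, abs_of_pos hδ] at h
  exact sub_nonneg.2 h

theorem le_smoothAbsRpow {p δ : ℝ} (hp : 1 < p) (t : ℝ) :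
    |t| ^ p - δ ^ p ≤ smoothAbsRpow p δ t := by
  have h : (t ^ 2) ^ (p / 2) ≤ (t ^ 2 + δ ^ 2) ^ (p / 2) :=
    Real.rpow_le_rpow (by positivity) (by linarith [sq_nonneg δ]) (by linarith)
  rw [sq_rpow_half] at h
  exact sub_le_sub_right h _

theorem smoothAbsRpow_le {p δ t M : ℝ} (hp : 1 < p) (hδ : 0 < δ) (hδ1 : δ ≤ 1) (ht : |t| ≤ M) :
    smoothAbsRpow p δ t ≤ (M ^ 2 + 1) ^ (p / 2) := by
  have h : (t ^ 2 + δ ^ 2) ^ (p / 2) ≤ (M ^ 2 + 1) ^ (p / 2) := by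
    refine Real.rpow_le_rpow (by positivity) (add_le_add ?_ ?_) (by linarith)
    · rw [← sq_abs]
      gcongr
    · nlinarith
  have := Real.rpow_nonneg hδ.le p
  unfold smoothAbsRpow
  linarith

theorem tendsto_smoothAbsRpow {p : ℝ} (hp : 1 < p) {δ : ℕ → ℝ} (hδ : Tendsto δ atTop (𝓝 0))
    (t : ℝ) : Tendsto (fun n => smoothAbsRpow p (δ n) t) atTop (𝓝 (|t| ^ p)) := by
  have h1 := (((hδ.pow 2).const_add (t ^ 2)).rpow_const (p := p / 2) (Or.inr (by linarith))).sub
    (hδ.rpow_const (p := p) (Or.inr (by linarith)))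
  rw [zero_pow two_ne_zero, add_zero, sq_rpow_half, Real.zero_rpow (by linarith), sub_zero] at h1
  exact h1

end SmoothPower

/-! ### Picone's inequality and maximality of weak solutions -/

section Picone

/-- A pointwise Picone inequality. -/
theorem inner_pFlux_picone_le {F : Type*} [NormedAddCommGroup F] [InnerProductSpace ℝ F]
    {p V ε δ t : ℝ} (hp : 1 < p) (hV : 0 ≤ V) (hε : 0 < ε) (hδ : 0 < δ) (G d : F) :
    inner ℝ (pFlux p G) ((V + ε) ^ (1 - p) • ((p * t * (t ^ 2 + δ ^ 2) ^ (p / 2 - 1)) • d) +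
      (smoothAbsRpow p δ t * ((1 - p) * (V + ε) ^ (-p))) • G) ≤
      ‖d‖ ^ p + (p - 1) * (δ / ε) ^ p * ‖G‖ ^ p := by
  have hW : 0 < V + ε := by linarith
  have hT : 0 < t ^ 2 + δ ^ 2 := by positivity
  set R := √(t ^ 2 + δ ^ 2) with hR
  have hR0 : 0 < R := Real.sqrt_pos.2 hT
  have hRsq : R ^ 2 = t ^ 2 + δ ^ 2 := Real.sq_sqrt hT.le
  have hpow : ∀ q : ℝ, (t ^ 2 + δ ^ 2) ^ (q / 2) = R ^ q := fun q => by
    rw [← hRsq, sq_rpow_half, abs_of_pos hR0]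
  have hs : 0 < R / (V + ε) := by positivity
  -- Here `R = √(t² + δ²)`, and `(t / R) d` is the gradient of the regularized `|φ|` when `d` is
  -- that of `φ`: convexity at this pair is Picone's inequality. The price for subtracting `δ ^ p`
  -- is the last term of the bound.
  have h1 := bregman_nonneg hp ((t / R) • d) ((R / (V + ε)) • G)
  rw [bregman_eq hp, pFlux_smul hs, inner_smul_left, inner_smul_right, norm_smul, norm_smul,
    Real.mul_rpow (norm_nonneg _) (norm_nonneg _), Real.mul_rpow (norm_nonneg _) (norm_nonneg _),
    Real.norm_of_nonneg hs.le, conj_trivial] at h1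
  have htR : |t| ≤ R := Real.abs_le_sqrt (by linarith [sq_nonneg δ])
  have h2 : ‖t / R‖ ^ p * ‖d‖ ^ p ≤ ‖d‖ ^ p := by
    refine mul_le_of_le_one_left (by positivity) (Real.rpow_le_one (norm_nonneg _) ?_ (by linarith))
    rw [norm_div, Real.norm_eq_abs, Real.norm_of_nonneg hR0.le]
    exact (div_le_one hR0).2 htR
  have h3 : (δ / (V + ε)) ^ p * ‖G‖ ^ p ≤ (δ / ε) ^ p * ‖G‖ ^ p := by
    gcongr
    linarith
  rw [inner_add_right, inner_smul_right, inner_smul_right, inner_smul_right,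
    inner_pFlux_self hp, show p / 2 - 1 = (p - 2) / 2 by ring, hpow, smoothAbsRpow, hpow]
  have h4 : (R / (V + ε)) ^ p = R ^ p * (V + ε) ^ (-p) := by
    rw [Real.div_rpow hR0.le hW.le, Real.rpow_neg hW.le]
    rfl
  have h5 : (R / (V + ε)) ^ (p - 1) * (t / R) = (V + ε) ^ (1 - p) * (t * R ^ (p - 2)) := by
    rw [Real.div_rpow hR0.le hW.le, show 1 - p = -(p - 1) by ring, Real.rpow_neg hW.le,
      show p - 1 = (p - 2) + 1 by ring, Real.rpow_add_one hR0.ne']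
    field_simp
  have h6 : (δ / (V + ε)) ^ p = δ ^ p * (V + ε) ^ (-p) := by
    rw [Real.div_rpow hδ.le hW.le, Real.rpow_neg hW.le]
    rfl
  rw [h4] at h1
  rw [h6] at h3
  have h7 := congrArg (fun z => p * z * inner ℝ (pFlux p G) d) h5
  have h8 := mul_le_mul_of_nonneg_left h3 (show 0 ≤ p - 1 by linarith)
  linarith

variable {N : ℕ} {Ω : Set (EuclideanSpace ℝ (Fin N))} {p α : ℝ}
  {v w φ : EuclideanSpace ℝ (Fin N) → ℝ}
  {g h : EuclideanSpace ℝ (Fin N) → EuclideanSpace ℝ (Fin N)}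
  [IsFiniteMeasure ((gaussMeasure N).restrict Ω)]

/-- The gradient attached to `v⁺` is `g` cut off to `{v > 0}`. That it equals `g` comes from the
equation itself: `v - v⁺` vanishes a.e., and as a test function it leaves only the `p`-th power of
the remaining gradient. -/
theorem IsResolventSolution.approxBy_nonnegTest (hp : 1 < p)
    (hv : IsResolventSolution p Ω 0 α v v g)
    (hv0 : ∀ᵐ x ∂((gaussMeasure N).restrict Ω), 0 ≤ v x) : ApproxBy (nonnegTest Ω) p Ω v g := by
  have hpos := ApproxBy.pos hp hv.1
  have hd := hv.1.sub hp (hpos.mono fun _ h => h.1)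
  have hz : ∀ᵐ x ∂((gaussMeasure N).restrict Ω), v x - max (v x) 0 = 0 := by
    filter_upwards [hv0] with x hx
    rw [max_eq_left hx, sub_self]
  have h1 := hv.2 _ _ hd
  have h2 : ∫ x in Ω, (v x - max (v x) 0) ∂(gaussMeasure N) = 0 := integral_eq_zero_of_ae hz
  have h3 : ∫ x in Ω, inner ℝ (pFlux p (v x)) (v x - max (v x) 0) ∂(gaussMeasure N) = 0 := by
    refine integral_eq_zero_of_ae ?_
    filter_upwards [hz] with x hx
    rw [hx, inner_zero_right]
    rfl
  have h4 : ∀ x, inner ℝ (pFlux p (g x)) (g x - (if 0 < v x then (1 : ℝ) else 0) • g x) =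
      ‖g x - (if 0 < v x then (1 : ℝ) else 0) • g x‖ ^ p := fun x => by
    split_ifs
    · simp [Real.zero_rpow (show p ≠ 0 by linarith)]
    · simp [inner_pFlux_self hp]
  simp_rw [h2, h3, h4] at h1
  rw [zero_mul, mul_zero, add_zero, add_zero, integral_norm_rpow_eq_zero_iff hp hd.2.1] at h1
  refine hpos.congr_ae ?_ ?_
  · filter_upwards [hv0] with x hx using max_eq_left hx
  · filter_upwards [h1] with x hx using (sub_eq_zero.1 hx).symm

/-- Picone's inequality against a test function, in regularized form. -/
theorem IsResolventSolution.picone (hp : 1 < p) (hv : IsResolventSolution p Ω 0 α v v g)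
    (hv0 : ∀ᵐ x ∂((gaussMeasure N).restrict Ω), 0 ≤ v x) (hφ : IsTestFunction Ω φ) {ε δ : ℝ}
    (hε : 0 < ε) (hδ : 0 < δ) :
    MemLp (fun x => (v x + ε) ^ (1 - p) * smoothAbsRpow p δ (φ x)) (ENNReal.ofReal p)
      ((gaussMeasure N).restrict Ω) ∧
    α * (∫ x in Ω, pFlux p (v x) * ((v x + ε) ^ (1 - p) * smoothAbsRpow p δ (φ x))
      ∂(gaussMeasure N)) +
      ∫ x in Ω, (v x + ε) ^ (1 - p) * smoothAbsRpow p δ (φ x) ∂(gaussMeasure N) ≤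
    ∫ x in Ω, ‖gradient φ x‖ ^ p ∂(gaussMeasure N) +
      (p - 1) * (δ / ε) ^ p * ∫ x in Ω, ‖g x‖ ^ p ∂(gaussMeasure N) := by
  have hψ := hφ.comp (contDiff_smoothAbsRpow (p := p) hδ) (smoothAbsRpow_zero hδ)
  have hθ := ApproxBy.test_mul_rpow hp hψ hε (hv.approxBy_nonnegTest hp hv0)
  refine ⟨hθ.1, ?_⟩
  have h1 := hv.2 _ _ hθ
  simp_rw [inner_pFlux_real] at h1
  rw [← h1, zero_mul, add_zero, ← integral_const_mul,
    ← integral_add (integrable_rpow_of_memLp hp (hφ.memLp_gradient _))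
      ((integrable_rpow_of_memLp hp hv.1.2.1).const_mul _)]
  refine integral_mono_ae (integrable_inner_pFlux hp hv.1.2.1 hθ.2.1)
    ((integrable_rpow_of_memLp hp (hφ.memLp_gradient _)).add
      ((integrable_rpow_of_memLp hp hv.1.2.1).const_mul _)) ?_
  filter_upwards [hv0] with x hx
  rw [gradient_comp_deriv (hasDerivAt_smoothAbsRpow hδ (φ x)) (hφ.differentiable x)]
  exact inner_pFlux_picone_le hp hx hε hδ (g x) (gradient φ x)

theorem pFlux_mul_rpow_eq {p V ε : ℝ} (hV : 0 ≤ V) (hp : 1 < p) (hε : 0 < ε) :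
    pFlux p V * (V + ε) ^ (1 - p) = (V / (V + ε)) ^ (p - 1) := by
  have hW : 0 < V + ε := by linarith
  have h : pFlux p V = V ^ (p - 1) := by
    rw [← Real.norm_of_nonneg (pFlux_nonneg hV), norm_pFlux hp, Real.norm_of_nonneg hV]
  rw [h, Real.div_rpow hV hW.le, show 1 - p = -(p - 1) by ring, Real.rpow_neg hW.le]
  rfl

theorem pFlux_mul_rpow_mem_Icc {p V ε : ℝ} (hV : 0 ≤ V) (hp : 1 < p) (hε : 0 < ε) :
    0 ≤ pFlux p V * (V + ε) ^ (1 - p) ∧ pFlux p V * (V + ε) ^ (1 - p) ≤ 1 := by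
  have hW : 0 < V + ε := by linarith
  rw [pFlux_mul_rpow_eq hV hp hε]
  exact ⟨by positivity, Real.rpow_le_one (by positivity) ((div_le_one hW).2 (by linarith))
    (by linarith)⟩

/-- Young's inequality for `|t|` and `V + ε`, divided by `(V + ε) ^ (p - 1)`. The choice `δ = ε ^ 2`
makes the regularization error at most `ε ^ (p + 1)`. -/
theorem le_rpow_mul_smoothAbsRpow {p V ε t : ℝ} (hV : 0 ≤ V) (hp : 1 < p) (hε : 0 < ε) :
    p * |t| - (p - 1) * (V + ε) - ε ^ (p + 1) ≤
      (V + ε) ^ (1 - p) * smoothAbsRpow p (ε ^ 2) t := by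
  have hW : 0 < V + ε := by linarith
  have h1 := (young_rpow hp (abs_nonneg t) hW.le).1
  have h2 := le_smoothAbsRpow (δ := ε ^ 2) hp t
  have hX : 0 < (V + ε) ^ (1 - p) := Real.rpow_pos_of_pos hW _
  have h3 : (V + ε) ^ (1 - p) * (V + ε) ^ (p - 1) = 1 := by
    rw [← Real.rpow_add hW]
    simp
  have h4 : (V + ε) ^ (1 - p) * (V + ε) ^ p = V + ε := by
    rw [← Real.rpow_add hW]
    simp
  have h5 : (V + ε) ^ (1 - p) * (ε ^ 2) ^ p ≤ ε ^ (p + 1) := by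
    have h6 : (V + ε) ^ (1 - p) ≤ ε ^ (1 - p) :=
      Real.rpow_le_rpow_of_nonpos hε (by linarith) (by linarith)
    have h7 : ε ^ (1 - p) * (ε ^ 2) ^ p = ε ^ (p + 1) := by
      rw [← Real.rpow_natCast ε 2, ← Real.rpow_mul hε.le, ← Real.rpow_add hε]
      congr 1
      push_cast
      ring
    rw [← h7]
    gcongr
  have h8 := mul_le_mul_of_nonneg_left h1 hX.le
  have h9 := mul_le_mul_of_nonneg_left h2 hX.le
  have h10 : (V + ε) ^ (1 - p) * (p * ((V + ε) ^ (p - 1) * |t|)) = p * |t| := by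
    calc _ = ((V + ε) ^ (1 - p) * (V + ε) ^ (p - 1)) * (p * |t|) := by ring
      _ = _ := by rw [h3, one_mul]
  have h11 : (V + ε) ^ (1 - p) * (|t| ^ p + (p - 1) * (V + ε) ^ p) =
      (V + ε) ^ (1 - p) * |t| ^ p + (p - 1) * (V + ε) := by
    rw [mul_add, mul_left_comm, h4]
  rw [h10, h11] at h8
  rw [mul_sub] at h9
  linarith

theorem aestronglyMeasurable_rpow_const {α : Type*} {mα : MeasurableSpace α} {μ : Measure α}
    {f : α → ℝ} (hf : AEStronglyMeasurable f μ) (q : ℝ) :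
    AEStronglyMeasurable (fun x => f x ^ q) μ :=
  (hf.aemeasurable.pow_const q).aestronglyMeasurable

/-- A weak solution bounds the torsion functional on test functions. -/
theorem IsResolventSolution.test_le (hp : 1 < p) (hv : IsResolventSolution p Ω 0 α v v g)
    (hv0 : ∀ᵐ x ∂((gaussMeasure N).restrict Ω), 0 ≤ v x) (hφ : IsTestFunction Ω φ) :
    α * (∫ x in Ω, ‖φ x‖ ^ p ∂(gaussMeasure N)) + p * ∫ x in Ω, |φ x| ∂(gaussMeasure N) ≤
      ∫ x in Ω, ‖gradient φ x‖ ^ p ∂(gaussMeasure N) +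
        (p - 1) * ∫ x in Ω, v x ∂(gaussMeasure N) := by
  set μ := (gaussMeasure N).restrict Ω with hμ
  obtain ⟨M, hM⟩ := hφ.2.1.exists_bound_of_continuous hφ.1.continuous
  -- With `δ = ε ^ 2` the ratio `δ / ε` tends to `0`, so the gradient error in Picone's inequality
  -- disappears as well.
  set ε : ℕ → ℝ := fun n => 1 / ((n : ℝ) + 1) with hεdef
  have hε : ∀ n, 0 < ε n := fun n => by positivity
  have hε1 : ∀ n, ε n ≤ 1 := fun n =>
    (div_le_one (by positivity)).2 (by linarith [(n.cast_nonneg : (0 : ℝ) ≤ n)])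
  have hεl : Tendsto ε atTop (𝓝 0) := tendsto_one_div_add_atTop_nhds_zero_nat
  have hδ : ∀ n, 0 < ε n ^ 2 := fun n => pow_pos (hε n) 2
  have hδ1 : ∀ n, ε n ^ 2 ≤ 1 := fun n => pow_le_one₀ (hε n).le (hε1 n)
  have hδl : Tendsto (fun n => ε n ^ 2) atTop (𝓝 0) := by simpa using hεl.pow 2
  set ψ : ℕ → EuclideanSpace ℝ (Fin N) → ℝ := fun n x => smoothAbsRpow p (ε n ^ 2) (φ x) with hψ
  set K := (M ^ 2 + 1) ^ (p / 2) with hK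
  have hψ0 : ∀ n x, 0 ≤ ψ n x := fun n x => smoothAbsRpow_nonneg hp (hδ n) _
  have hψK : ∀ n x, ψ n x ≤ K := fun n x => smoothAbsRpow_le hp (hδ n) (hδ1 n) (hM x)
  have hψc : ∀ n, Continuous (ψ n) := fun n =>
    (contDiff_smoothAbsRpow (hδ n)).continuous.comp hφ.1.continuous
  have hψl : ∀ x, Tendsto (fun n => ψ n x) atTop (𝓝 (|φ x| ^ p)) := fun x =>
    tendsto_smoothAbsRpow hp hδl _
  have hpic := fun n => (hv.picone hp hv0 hφ (hε n) (hδ n)).2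
  have hθm := fun n => (hv.picone hp hv0 hφ (hε n) (hδ n)).1
  have hratio : ∀ n, (ε n ^ 2 / ε n) = ε n := fun n => by
    rw [sq, mul_div_assoc, div_self (hε n).ne', mul_one]
  simp only [hratio] at hpic
  have hvm : AEStronglyMeasurable v μ := hv.1.1.1
  have hkm : ∀ n, AEStronglyMeasurable (fun x => pFlux p (v x) * (v x + ε n) ^ (1 - p)) μ :=
    fun n => ((continuous_pFlux hp).comp_aestronglyMeasurable hvm).mul
      (aestronglyMeasurable_rpow_const (hvm.add_const _) _)
  have hassoc : ∀ n x, pFlux p (v x) * ((v x + ε n) ^ (1 - p) * ψ n x) =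
      (pFlux p (v x) * (v x + ε n) ^ (1 - p)) * ψ n x := fun n x => (mul_assoc _ _ _).symm
  have hbd : ∀ n, ∀ᵐ x ∂μ, 0 ≤ pFlux p (v x) * ((v x + ε n) ^ (1 - p) * ψ n x) ∧
      pFlux p (v x) * ((v x + ε n) ^ (1 - p) * ψ n x) ≤ K := by
    intro n
    filter_upwards [hv0] with x hx
    rw [hassoc]
    obtain ⟨h1, h2⟩ := pFlux_mul_rpow_mem_Icc hx hp (hε n)
    exact ⟨mul_nonneg h1 (hψ0 n x),
      (mul_le_of_le_one_left (hψ0 n x) h2).trans (hψK n x)⟩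
  have hAm : ∀ n, AEStronglyMeasurable
      (fun x => pFlux p (v x) * ((v x + ε n) ^ (1 - p) * ψ n x)) μ := fun n => by
    simp_rw [hassoc]
    exact (hkm n).mul (hψc n).aestronglyMeasurable
  set A : ℕ → ℝ := fun n => ∫ x, pFlux p (v x) * ((v x + ε n) ^ (1 - p) * ψ n x) ∂μ with hA
  have hA0 : ∀ n, 0 ≤ A n := fun n => integral_nonneg_of_ae ((hbd n).mono fun x hx => hx.1)
  have hAK : ∀ n, A n ≤ K * μ.real univ := fun n => by
    have h1 : A n ≤ ∫ _, K ∂μ := by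
      refine integral_mono_ae ?_ (integrable_const K) ((hbd n).mono fun x hx => hx.2)
      refine Integrable.mono' (integrable_const K) (hAm n) ?_
      filter_upwards [hbd n] with x hx
      rw [Real.norm_of_nonneg hx.1]
      exact hx.2
    rw [integral_const, smul_eq_mul, mul_comm] at h1
    exact h1
  set D := ∫ x in Ω, ‖gradient φ x‖ ^ p ∂(gaussMeasure N) with hD
  set E := ∫ x in Ω, ‖g x‖ ^ p ∂(gaussMeasure N) with hE
  have hE0 : 0 ≤ E := integral_norm_rpow_nonneg
  have hθi : ∀ n, Integrable (fun x => (v x + ε n) ^ (1 - p) * ψ n x) μ := fun n =>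
    integrable_of_memLp_ofReal hp (hθm n)
  -- Substitute for the strong maximum principle: on `{v = 0}` the weight `(v + ε) ^ (1 - p)` equals
  -- `ε ^ (1 - p)` and blows up, while Picone's inequality keeps the integral bounded, so `φ` must
  -- vanish there.
  have hzero : ∀ᵐ x ∂μ, v x ≤ 0 → φ x = 0 := by
    have hind : ∀ᵐ x ∂μ, (if v x ≤ 0 then (1 : ℝ) else 0) * |φ x| ^ p = 0 := by
      have him : AEStronglyMeasurable (fun x => if v x ≤ 0 then (1 : ℝ) else 0) μ := by
        have h1 : Measurable fun t : ℝ => if t ≤ 0 then (1 : ℝ) else 0 :=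
          Measurable.ite measurableSet_Iic measurable_const measurable_const
        exact (h1.comp_aemeasurable hvm.aemeasurable).aestronglyMeasurable
      have hle1 : ∀ x, (if v x ≤ 0 then (1 : ℝ) else 0) ≤ 1 := fun x => by split_ifs <;> simp
      have hge0 : ∀ x, 0 ≤ (if v x ≤ 0 then (1 : ℝ) else 0) := fun x => by split_ifs <;> simp
      have h1 : Tendsto (fun n => ∫ x, (if v x ≤ 0 then (1 : ℝ) else 0) * ψ n x ∂μ) atTop
          (𝓝 (∫ x, (if v x ≤ 0 then (1 : ℝ) else 0) * |φ x| ^ p ∂μ)) := by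
        refine tendsto_integral_of_dominated_convergence (fun _ => K)
          (fun n => him.mul (hψc n).aestronglyMeasurable) (integrable_const K)
          (fun n => Eventually.of_forall fun x => ?_)
          (Eventually.of_forall fun x => (hψl x).const_mul _)
        rw [Real.norm_of_nonneg (mul_nonneg (hge0 x) (hψ0 n x))]
        exact (mul_le_of_le_one_left (hψ0 n x) (hle1 x)).trans (hψK n x)
      have hX : ∀ n, ∫ x, (if v x ≤ 0 then (1 : ℝ) else 0) * ψ n x ∂μ ≤
          ε n ^ (p - 1) * (D + (p - 1) * E + |α| * (K * μ.real univ)) := by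
        intro n
        have h2 : ∫ x, (if v x ≤ 0 then (1 : ℝ) else 0) * ψ n x ∂μ ≤
            ∫ x, ε n ^ (p - 1) * ((v x + ε n) ^ (1 - p) * ψ n x) ∂μ := by
          refine integral_mono_of_nonneg (Eventually.of_forall fun x =>
            mul_nonneg (hge0 x) (hψ0 n x)) ((hθi n).const_mul _) ?_
          filter_upwards [hv0] with x hx
          have h3 : 0 ≤ (v x + ε n) ^ (1 - p) := Real.rpow_nonneg (by linarith [hε n]) _
          have h4 : 0 ≤ ε n ^ (p - 1) := Real.rpow_nonneg (hε n).le _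
          split_ifs with h
          · rw [le_antisymm h hx, zero_add, ← mul_assoc, ← Real.rpow_add (hε n)]
            simp
          · rw [zero_mul]
            exact mul_nonneg h4 (mul_nonneg h3 (hψ0 n x))
        rw [integral_const_mul] at h2
        refine h2.trans (mul_le_mul_of_nonneg_left ?_ (Real.rpow_nonneg (hε n).le _))
        have h3 := hpic n
        have h4 : -(|α| * (K * μ.real univ)) ≤ α * A n := by
          have h5 : |α| * A n ≤ |α| * (K * μ.real univ) :=
            mul_le_mul_of_nonneg_left (hAK n) (abs_nonneg α)
          have h6 := mul_le_mul_of_nonneg_right (neg_abs_le α) (hA0 n)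
          linarith
        have h5 : (p - 1) * ε n ^ p * E ≤ (p - 1) * E := by
          have h6 : ε n ^ p ≤ 1 := Real.rpow_le_one (hε n).le (hε1 n) (by linarith)
          have h7 : (p - 1) * ε n ^ p ≤ p - 1 :=
            mul_le_of_le_one_right (by linarith) h6
          exact mul_le_mul_of_nonneg_right h7 hE0
        linarith
      have h2 := (hεl.rpow_const (p := p - 1) (Or.inr (by linarith))).mul_const
        (D + (p - 1) * E + |α| * (K * μ.real univ))
      rw [Real.zero_rpow (by linarith), zero_mul] at h2
      have h3 := le_of_tendsto_of_tendsto' h1 h2 hX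
      have hnn : ∀ x, 0 ≤ (if v x ≤ 0 then (1 : ℝ) else 0) * |φ x| ^ p := fun x =>
        mul_nonneg (hge0 x) (by positivity)
      have h4 := le_antisymm h3 (integral_nonneg hnn)
      rw [integral_eq_zero_iff_of_nonneg hnn] at h4
      · exact h4
      · exact Integrable.bdd_mul (integrable_rpow_of_memLp hp (hφ.memLp _)) him
          (Eventually.of_forall fun x => by
            rw [Real.norm_of_nonneg (hge0 x)]
            exact hle1 x)
    filter_upwards [hind] with x hx hvx
    rw [if_pos hvx, one_mul] at hx
    exact abs_eq_zero.1 ((Real.rpow_eq_zero (abs_nonneg _) (by linarith)).1 hx)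
  -- Where `v > 0` the ratio `v / (v + ε n)` tends to `1`; where `v = 0` both the integrand and its
  -- limit vanish, by `hzero`.
  have hAl : Tendsto A atTop (𝓝 (∫ x in Ω, ‖φ x‖ ^ p ∂(gaussMeasure N))) := by
    refine tendsto_integral_of_dominated_convergence (fun _ => K) hAm (integrable_const K)
      (fun n => ?_) ?_
    · filter_upwards [hbd n] with x hx
      rw [Real.norm_of_nonneg hx.1]
      exact hx.2
    · filter_upwards [hv0, hzero] with x hx hx0
      rcases hx.eq_or_lt with h | h
      · rw [← h, hx0 h.symm.le]
        simp [pFlux, Real.zero_rpow (show p ≠ 0 by linarith)]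
      · have h1 : Tendsto (fun n => (v x / (v x + ε n)) ^ (p - 1)) atTop (𝓝 1) := by
          have h2 := ((tendsto_const_nhds (x := v x)).div (hεl.const_add (v x))
            (by simpa using h.ne')).rpow_const (p := p - 1) (Or.inr (by linarith))
          rw [add_zero, div_self h.ne', Real.one_rpow] at h2
          exact h2
        have h3 := h1.mul (hψl x)
        rw [one_mul] at h3
        refine h3.congr fun n => ?_
        rw [hassoc, pFlux_mul_rpow_eq hx hp (hε n)]
  have hφi : Integrable (fun x => |φ x|) μ :=
    (integrable_of_memLp_ofReal hp (hφ.memLp (ENNReal.ofReal p))).abs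
  have hvi : Integrable v μ := integrable_of_memLp_ofReal hp hv.1.1
  -- The singular integral is bounded below through Young's inequality before passing to the limit,
  -- so its own limit is never needed.
  have hkey : ∀ n, α * A n + (p * ∫ x, |φ x| ∂μ - (p - 1) * ∫ x, v x ∂μ -
      ((p - 1) * ε n + ε n ^ (p + 1)) * μ.real univ) ≤ D + (p - 1) * ε n ^ p * E := by
    intro n
    refine le_trans (add_le_add_right ?_ _) (hpic n)
    have h1 : Integrable (fun x => p * |φ x| - (p - 1) * v x) μ :=
      (hφi.const_mul p).sub (hvi.const_mul (p - 1))
    have h2 : ∫ x, (p * |φ x| - (p - 1) * v x - ((p - 1) * ε n + ε n ^ (p + 1))) ∂μ =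
        p * ∫ x, |φ x| ∂μ - (p - 1) * ∫ x, v x ∂μ -
          ((p - 1) * ε n + ε n ^ (p + 1)) * μ.real univ := by
      rw [integral_sub h1 (integrable_const _), integral_sub (hφi.const_mul p)
        (hvi.const_mul (p - 1)), integral_const_mul, integral_const_mul, integral_const,
        smul_eq_mul, mul_comm (μ.real univ)]
    rw [← h2]
    refine integral_mono_ae (h1.sub (integrable_const _)) (hθi n) ?_
    filter_upwards [hv0] with x hx
    have h3 := le_rpow_mul_smoothAbsRpow (t := φ x) hx hp (hε n)
    linarith
  have hl1 := (hAl.const_mul α).add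
    (((((hεl.const_mul (p - 1)).add (hεl.rpow_const (p := p + 1) (Or.inr (by linarith)))).mul_const
      (μ.real univ)).const_sub (p * ∫ x, |φ x| ∂μ - (p - 1) * ∫ x, v x ∂μ)))
  have hl2 := (((hεl.rpow_const (p := p) (Or.inr (by linarith))).const_mul (p - 1)).mul_const
    E).const_add D
  have hfin := le_of_tendsto_of_tendsto' hl1 hl2 hkey
  rw [Real.zero_rpow (by linarith), Real.zero_rpow (by linarith)] at hfin
  simp only [mul_zero, zero_mul, add_zero, sub_zero] at hfin
  linarith

/-- A nonnegative weak solution maximizes the torsion functional. -/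
theorem IsResolventSolution.torsionFunctional_le (hp : 1 < p)
    (hv : IsResolventSolution p Ω 0 α v v g)
    (hv0 : ∀ᵐ x ∂((gaussMeasure N).restrict Ω), 0 ≤ v x) (hw : SobolevZero p Ω w h) :
    torsionFunctional p α Ω w h ≤ (p - 1) * ∫ x in Ω, v x ∂(gaussMeasure N) := by
  obtain ⟨hwm, hhm, φ, hφ, h1, h2⟩ := hw
  have hφm := fun n => (hφ n).memLp (μ := (gaussMeasure N).restrict Ω) (ENNReal.ofReal p)
  have hl := ((tendsto_integral_norm_rpow hp (fun n => (hφ n).memLp_gradient _) hhm h2).neg.add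
    ((tendsto_integral_norm_rpow hp hφm hwm h1).const_mul α)).add
    ((tendsto_integral_of_tendsto_rpow hp hφm hwm h1).const_mul p)
  refine le_of_tendsto hl (Eventually.of_forall fun n => ?_)
  have h3 := hv.test_le hp hv0 (hφ n)
  have h4 : ∫ x in Ω, φ n x ∂(gaussMeasure N) ≤ ∫ x in Ω, |φ n x| ∂(gaussMeasure N) :=
    integral_mono (integrable_of_memLp_ofReal hp (hφm n))
      (integrable_of_memLp_ofReal hp (hφm n)).abs fun x => le_abs_self _
  have h5 := mul_le_mul_of_nonneg_left h4 (show 0 ≤ p by linarith)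
  linarith

-- Testing the equation with `v` gives `∫|Dv|^p = α ∫|v|^p + ∫v`.
omit [IsFiniteMeasure ((gaussMeasure N).restrict Ω)] in
theorem IsResolventSolution.torsionFunctional_eq (hp : 1 < p)
    (hv : IsResolventSolution p Ω 0 α v v g) :
    torsionFunctional p α Ω v g = (p - 1) * ∫ x in Ω, v x ∂(gaussMeasure N) := by
  have h := hv.2 _ _ hv.1
  simp_rw [inner_pFlux_self hp, zero_mul, add_zero] at h
  simp only [Real.norm_eq_abs] at h
  rw [torsionFunctional, h]
  ring

end Picone

/-! ### Translation estimates and mass on small sets -/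

section Translation

variable {E : Type*} [NormedAddCommGroup E] [NormedSpace ℝ E] {u : E → ℝ}

theorem enorm_sub_translate_le (hu : ContDiff ℝ 1 u) (x y : E) :
    ‖u x - u (x - y)‖ₑ ≤ ∫⁻ t in Ioc (0 : ℝ) 1, ‖fderiv ℝ u (x - y + t • y)‖ₑ * ‖y‖ₑ := by
  have hd : ∀ t ∈ uIcc (0 : ℝ) 1, HasDerivAt (fun t : ℝ => u (x - y + t • y))
      (fderiv ℝ u (x - y + t • y) y) t := by
    intro t _
    have h1 : HasDerivAt (fun t : ℝ => x - y + t • y) y t := by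
      simpa using ((hasDerivAt_id t).smul_const y).const_add (x - y)
    exact (hu.differentiable one_ne_zero _).hasFDerivAt.comp_hasDerivAt t h1
  have hc : Continuous fun t : ℝ => fderiv ℝ u (x - y + t • y) y :=
    ((hu.continuous_fderiv one_ne_zero).comp (by fun_prop)).clm_apply continuous_const
  have h := intervalIntegral.integral_eq_sub_of_hasDerivAt hd (hc.intervalIntegrable 0 1)
  simp only [one_smul, zero_smul, add_zero, sub_add_cancel] at h
  rw [← h, intervalIntegral.integral_of_le zero_le_one]
  exact (enorm_integral_le_lintegral_enorm _).trans
    (lintegral_mono fun t => ContinuousLinearMap.le_opENorm _ _)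

variable [MeasurableSpace E] [BorelSpace E] [FiniteDimensional ℝ E]
  {μ : Measure E} [μ.IsAddHaarMeasure]

/-- The fundamental theorem of calculus along the segment, Tonelli, and translation invariance of
the measure. -/
theorem lintegral_enorm_sub_translate_le (hu : ContDiff ℝ 1 u) (y : E) :
    ∫⁻ x, ‖u x - u (x - y)‖ₑ ∂μ ≤ ‖y‖ₑ * ∫⁻ x, ‖fderiv ℝ u x‖ₑ ∂μ := by
  have hc : Continuous (fderiv ℝ u) := hu.continuous_fderiv one_ne_zero
  calc ∫⁻ x, ‖u x - u (x - y)‖ₑ ∂μ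
      ≤ ∫⁻ x, (∫⁻ t in Ioc (0 : ℝ) 1, ‖fderiv ℝ u (x - y + t • y)‖ₑ * ‖y‖ₑ) ∂μ :=
        lintegral_mono fun x => enorm_sub_translate_le hu x y
    _ = ∫⁻ t in Ioc (0 : ℝ) 1, ∫⁻ x, ‖fderiv ℝ u (x - y + t • y)‖ₑ * ‖y‖ₑ ∂μ := by
        refine lintegral_lintegral_swap (Continuous.aemeasurable ?_)
        have h1 : Continuous fun z : E × ℝ => ‖fderiv ℝ u (z.1 - y + z.2 • y)‖ₑ :=
          (hc.comp (by fun_prop)).enorm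
        exact ENNReal.continuous_mul_const (by simp) |>.comp h1
    _ = ∫⁻ t in Ioc (0 : ℝ) 1, ‖y‖ₑ * ∫⁻ x, ‖fderiv ℝ u x‖ₑ ∂μ := by
        refine lintegral_congr fun t => ?_
        rw [lintegral_mul_const' _ _ (by simp), mul_comm]
        congr 1
        have h1 := lintegral_add_right_eq_self (μ := μ) (fun x => ‖fderiv ℝ u x‖ₑ) (-y + t • y)
        simp only [← add_assoc, ← sub_eq_add_neg] at h1
        exact h1
    _ = ‖y‖ₑ * ∫⁻ x, ‖fderiv ℝ u x‖ₑ ∂μ := by simp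

/-- Average `|u(x)| ≤ |u(x - y)| + |u(x) - u(x - y)|` over `y` in the ball: integrating the first
term over `y` gives at most the full mass for each `x ∈ T`, the second is the translation estimate.
-/
theorem measure_ball_mul_setLIntegral_le (hu : ContDiff ℝ 1 u) {T : Set E} (δ : ℝ) :
    μ (Metric.ball 0 δ) * ∫⁻ x in T, ‖u x‖ₑ ∂μ ≤ μ T * ∫⁻ x, ‖u x‖ₑ ∂μ +
      μ (Metric.ball 0 δ) * (ENNReal.ofReal δ * ∫⁻ x, ‖fderiv ℝ u x‖ₑ ∂μ) := by
  have huc := hu.continuous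
  calc μ (Metric.ball 0 δ) * ∫⁻ x in T, ‖u x‖ₑ ∂μ
      = ∫⁻ y in Metric.ball 0 δ, ∫⁻ x in T, ‖u x‖ₑ ∂μ ∂μ := by
        rw [setLIntegral_const, mul_comm]
    _ ≤ ∫⁻ y in Metric.ball 0 δ, (∫⁻ x in T, ‖u (x - y)‖ₑ ∂μ +
          ENNReal.ofReal δ * ∫⁻ x, ‖fderiv ℝ u x‖ₑ ∂μ) ∂μ := by
        refine setLIntegral_mono' Metric.isOpen_ball.measurableSet fun y hy => ?_
        calc ∫⁻ x in T, ‖u x‖ₑ ∂μ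
            ≤ ∫⁻ x in T, (‖u (x - y)‖ₑ + ‖u x - u (x - y)‖ₑ) ∂μ := by
              refine lintegral_mono fun x => ?_
              have := enorm_add_le (u (x - y)) (u x - u (x - y))
              rwa [add_sub_cancel] at this
          _ = ∫⁻ x in T, ‖u (x - y)‖ₑ ∂μ + ∫⁻ x in T, ‖u x - u (x - y)‖ₑ ∂μ :=
              lintegral_add_left (huc.comp (by fun_prop)).enorm.measurable _
          _ ≤ _ := by
              gcongr
              refine (setLIntegral_le_lintegral _ _).trans
                ((lintegral_enorm_sub_translate_le hu y).trans ?_)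
              gcongr
              rw [← ofReal_norm]
              exact ENNReal.ofReal_le_ofReal (by simpa using (mem_ball_zero_iff.1 hy).le)
    _ = ∫⁻ y in Metric.ball 0 δ, ∫⁻ x in T, ‖u (x - y)‖ₑ ∂μ ∂μ +
          μ (Metric.ball 0 δ) * (ENNReal.ofReal δ * ∫⁻ x, ‖fderiv ℝ u x‖ₑ ∂μ) := by
        rw [lintegral_add_right _ measurable_const, setLIntegral_const, mul_comm (μ _)]
    _ ≤ _ := by
        gcongr
        rw [lintegral_lintegral_swap
          (huc.comp (continuous_snd.sub continuous_fst)).enorm.aemeasurable]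
        calc ∫⁻ x in T, ∫⁻ y in Metric.ball 0 δ, ‖u (x - y)‖ₑ ∂μ ∂μ
            ≤ ∫⁻ _ in T, ∫⁻ x, ‖u x‖ₑ ∂μ ∂μ := by
              refine lintegral_mono fun x => ?_
              refine (setLIntegral_le_lintegral _ _).trans_eq ?_
              exact lintegral_sub_left_eq_self (fun x => ‖u x‖ₑ) x
          _ = μ T * ∫⁻ x, ‖u x‖ₑ ∂μ := by rw [setLIntegral_const, mul_comm]

/-- The mass of `u` on a small set is controlled by its gradient in `L^1`. -/
theorem measureReal_ball_mul_setIntegral_le (hu : ContDiff ℝ 1 u) (hus : HasCompactSupport u)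
    {T : Set E} (hT : μ T ≠ ⊤) {δ : ℝ} (hδ : 0 < δ) :
    μ.real (Metric.ball 0 δ) * ∫ x in T, ‖u x‖ ∂μ ≤ μ.real T * ∫ x, ‖u x‖ ∂μ +
      μ.real (Metric.ball 0 δ) * (δ * ∫ x, ‖fderiv ℝ u x‖ ∂μ) := by
  have hd : Continuous (fderiv ℝ u) := hu.continuous_fderiv one_ne_zero
  have hui : Integrable u μ := hu.continuous.integrable_of_hasCompactSupport hus
  have hdi : Integrable (fderiv ℝ u) μ := hd.integrable_of_hasCompactSupport (hus.fderiv ℝ)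
  have hB : μ (Metric.ball (0 : E) δ) ≠ ⊤ := measure_ball_lt_top.ne
  have h1 : ∫⁻ x, ‖u x‖ₑ ∂μ ≠ ⊤ := hui.2.ne
  have h2 : ∫⁻ x, ‖fderiv ℝ u x‖ₑ ∂μ ≠ ⊤ := hdi.2.ne
  rw [integral_norm_eq_lintegral_enorm hui.1, integral_norm_eq_lintegral_enorm hui.1.restrict,
    integral_norm_eq_lintegral_enorm hdi.1, measureReal_def, measureReal_def,
    ← ENNReal.toReal_ofReal hδ.le, ← ENNReal.toReal_mul, ← ENNReal.toReal_mul,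
    ← ENNReal.toReal_mul, ← ENNReal.toReal_mul, ENNReal.toReal_ofReal hδ.le,
    ← ENNReal.toReal_add (ENNReal.mul_ne_top hT h1)
      (ENNReal.mul_ne_top hB (ENNReal.mul_ne_top ENNReal.ofReal_ne_top h2))]
  exact ENNReal.toReal_mono (ENNReal.add_ne_top.2 ⟨ENNReal.mul_ne_top hT h1,
    ENNReal.mul_ne_top hB (ENNReal.mul_ne_top ENNReal.ofReal_ne_top h2)⟩)
    (measure_ball_mul_setLIntegral_le hu δ)

end Translation

/-! ### First moment of `|φ| ^ p` under the Gaussian -/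

section GaussianTail

variable {N : ℕ}

theorem hasFDerivAt_gaussDensity (x : EuclideanSpace ℝ (Fin N)) :
    HasFDerivAt (gaussDensity N) (-(gaussDensity N x) • innerSL ℝ x) x := by
  have h1 := ((hasStrictFDerivAt_norm_sq x).hasFDerivAt.const_mul (-(1 / 2 : ℝ))).exp.const_mul
    (1 / (2 * Real.pi) ^ ((N : ℝ) / 2))
  have h2 : gaussDensity N = fun y => 1 / (2 * Real.pi) ^ ((N : ℝ) / 2) *
      Real.exp (-(1 / 2 : ℝ) * ‖y‖ ^ 2) := by
    funext y
    unfold gaussDensity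
    congr 2
    ring
  rw [h2]
  refine h1.congr_fderiv ?_
  ext e
  simp
  ring

theorem contDiff_gaussDensity : ContDiff ℝ 1 (gaussDensity N) := by
  unfold gaussDensity
  exact contDiff_const.mul (((contDiff_norm_sq ℝ).neg.div_const 2).exp)

variable {Ω : Set (EuclideanSpace ℝ (Fin N))} {φ : EuclideanSpace ℝ (Fin N) → ℝ} {p : ℝ}

/-- The weighted density `|φ|^p` times the Gaussian. -/
noncomputable def gaussRpow (p : ℝ) (φ : EuclideanSpace ℝ (Fin N) → ℝ)
    (x : EuclideanSpace ℝ (Fin N)) : ℝ := ‖φ x‖ ^ p * gaussDensity N x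

theorem gaussRpow_nonneg (x : EuclideanSpace ℝ (Fin N)) : 0 ≤ gaussRpow p φ x :=
  mul_nonneg (by positivity) (gaussDensity_pos x).le

theorem IsTestFunction.contDiff_gaussRpow (hp : 1 < p) (hφ : IsTestFunction Ω φ) :
    ContDiff ℝ 1 (gaussRpow p φ) :=
  (hφ.contDiff_one.norm_rpow hp).mul contDiff_gaussDensity

theorem IsTestFunction.hasCompactSupport_rpow (hp : 1 < p) (hφ : IsTestFunction Ω φ) :
    HasCompactSupport fun x => ‖φ x‖ ^ p :=
  hφ.2.1.comp_left (g := fun t : ℝ => ‖t‖ ^ p) (by simp [Real.zero_rpow (show p ≠ 0 by linarith)])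

theorem IsTestFunction.hasCompactSupport_gaussRpow (hp : 1 < p) (hφ : IsTestFunction Ω φ) :
    HasCompactSupport (gaussRpow p φ) :=
  (hφ.hasCompactSupport_rpow hp).mul_right

theorem IsTestFunction.fderiv_gaussRpow (hp : 1 < p) (hφ : IsTestFunction Ω φ)
    (x : EuclideanSpace ℝ (Fin N)) : fderiv ℝ (gaussRpow p φ) x =
      gaussDensity N x • fderiv ℝ (fun x => ‖φ x‖ ^ p) x - gaussRpow p φ x • innerSL ℝ x := by
  have h1 := ((hφ.contDiff_one.norm_rpow hp).differentiable one_ne_zero x).hasFDerivAt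
  have h2 := (h1.mul (hasFDerivAt_gaussDensity x)).fderiv
  rw [show gaussRpow p φ = (fun x => ‖φ x‖ ^ p) * gaussDensity N from rfl, h2]
  ext e
  simp
  ring

theorem IsTestFunction.norm_fderiv_rpow_le (hp : 1 < p) (hφ : IsTestFunction Ω φ)
    (x : EuclideanSpace ℝ (Fin N)) : ‖fderiv ℝ (fun x => ‖φ x‖ ^ p) x‖ ≤
      p * (‖φ x‖ ^ p + ‖gradient φ x‖ ^ p) := by
  have h1 := norm_fderiv_norm_rpow_le hφ.differentiable (x := x) hp
  have h2 := (young_rpow hp (norm_nonneg (gradient φ x)) (norm_nonneg (φ x))).1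
  rw [← norm_gradient φ x, mul_assoc] at h1
  have h3 : 0 ≤ ‖φ x‖ ^ p := by positivity
  have h4 : 0 ≤ ‖gradient φ x‖ ^ p := by positivity
  nlinarith

/-- The Gaussian Sobolev energy of a test function. -/
noncomputable def gaussEnergy (p : ℝ) (φ : EuclideanSpace ℝ (Fin N) → ℝ) : ℝ :=
  ∫ x, gaussDensity N x * (‖φ x‖ ^ p + ‖gradient φ x‖ ^ p)

theorem IsTestFunction.integrable_energy (hp : 1 < p) (hφ : IsTestFunction Ω φ) :
    Integrable fun x => gaussDensity N x * (‖φ x‖ ^ p + ‖gradient φ x‖ ^ p) := by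
  have h0 : (0 : ℝ) ^ p = 0 := Real.zero_rpow (by linarith)
  refine Continuous.integrable_of_hasCompactSupport ?_ (HasCompactSupport.mul_left
    ((hφ.hasCompactSupport_rpow hp).add
      (hφ.hasCompactSupport_gradient.comp_left (g := fun t => ‖t‖ ^ p) (by simp [h0]))))
  exact continuous_gaussDensity.mul (((continuous_norm_rpow hp).comp hφ.1.continuous).add
    ((continuous_norm_rpow hp).comp (continuous_gradient hφ.contDiff_one)))

theorem IsTestFunction.integrable_mul_gaussRpow (hp : 1 < p) (hφ : IsTestFunction Ω φ)
    {f : EuclideanSpace ℝ (Fin N) → ℝ} (hf : Continuous f) :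
    Integrable fun x => f x * gaussRpow p φ x :=
  (hf.mul (hφ.contDiff_gaussRpow hp).continuous).integrable_of_hasCompactSupport
    (hφ.hasCompactSupport_gaussRpow hp).mul_left

theorem IsTestFunction.integrable_gaussRpow (hp : 1 < p) (hφ : IsTestFunction Ω φ) :
    Integrable (gaussRpow p φ) := by
  simpa using hφ.integrable_mul_gaussRpow hp continuous_const (f := fun _ => 1)

theorem IsTestFunction.integral_gaussRpow_le (hp : 1 < p) (hφ : IsTestFunction Ω φ) :
    ∫ x, gaussRpow p φ x ≤ gaussEnergy p φ := by
  refine integral_mono (hφ.integrable_gaussRpow hp) (hφ.integrable_energy hp) fun x => ?_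
  have h1 : 0 ≤ ‖gradient φ x‖ ^ p := by positivity
  have h2 := mul_nonneg (gaussDensity_pos x).le h1
  simp only [gaussRpow]
  linarith

/-- A bounded field whose product with `t` still grows linearly, as the integration by parts below
requires. -/
theorem mul_arctan_ge (t : ℝ) : |t| - 1 ≤ 2 * (t * Real.arctan t) := by
  have key : ∀ s : ℝ, 0 ≤ s → s - 1 ≤ 2 * (s * Real.arctan s) := by
    intro s hs
    have h0 : 0 ≤ Real.arctan s := Real.arctan_nonneg.2 hs
    rcases le_total s 1 with h | h
    · have := mul_nonneg hs h0
      linarith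
    · have h1 : Real.pi / 4 ≤ Real.arctan s := by
        rw [← Real.arctan_one]
        exact Real.arctan_strictMono.monotone h
      have h2 := Real.pi_gt_three
      nlinarith
  rcases le_total 0 t with h | h
  · rw [abs_of_nonneg h]
    exact key t h
  · rw [abs_of_nonpos h]
    have := key (-t) (by linarith)
    rwa [Real.arctan_neg, neg_mul_neg] at this

/-- Integration by parts against `arctan (x · e)` controls one coordinate moment. -/
theorem IsTestFunction.integral_coord_mul_le (hp : 1 < p) (hφ : IsTestFunction Ω φ)
    {e : EuclideanSpace ℝ (Fin N)} (he : ‖e‖ = 1) :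
    ∫ x, |inner ℝ x e| * gaussRpow p φ x ≤ (4 * p + 3) * gaussEnergy p φ := by
  set S := gaussEnergy p φ with hS
  have hcd := hφ.contDiff_gaussRpow hp
  have hs := hφ.hasCompactSupport_gaussRpow hp
  have hin : ContDiff ℝ 1 fun x : EuclideanSpace ℝ (Fin N) => inner ℝ x e :=
    contDiff_id.inner ℝ contDiff_const
  have hat : ContDiff ℝ 1 fun x : EuclideanSpace ℝ (Fin N) => Real.arctan (inner ℝ x e) :=
    Real.contDiff_arctan.comp hin
  have hatd : ∀ x : EuclideanSpace ℝ (Fin N),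
      fderiv ℝ (fun x : EuclideanSpace ℝ (Fin N) => Real.arctan (inner ℝ x e)) x e =
        1 / (1 + inner ℝ x e ^ 2) := by
    intro x
    have h1 : HasFDerivAt (fun x : EuclideanSpace ℝ (Fin N) => inner ℝ x e) (innerSL ℝ e) x := by
      have := (innerSL ℝ e).hasFDerivAt (x := x)
      refine this.congr_of_eventuallyEq (Eventually.of_forall fun y => ?_)
      simp [real_inner_comm]
    have h2 := ((Real.hasDerivAt_arctan (inner ℝ x e)).comp_hasFDerivAt x h1).fderiv
    change fderiv ℝ (Real.arctan ∘ fun x : EuclideanSpace ℝ (Fin N) => inner ℝ x e) x e = _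
    rw [h2]
    simp [he]
  have hud : Continuous fun x => fderiv ℝ (gaussRpow p φ) x e :=
    (hcd.continuous_fderiv one_ne_zero).clm_apply continuous_const
  have huds : HasCompactSupport fun x => fderiv ℝ (gaussRpow p φ) x e :=
    (hs.fderiv ℝ).comp_left (g := fun L : EuclideanSpace ℝ (Fin N) →L[ℝ] ℝ => L e) rfl
  have hq : Continuous fun x => fderiv ℝ (fun x => ‖φ x‖ ^ p) x e :=
    ((hφ.contDiff_one.norm_rpow hp).continuous_fderiv one_ne_zero).clm_apply continuous_const
  -- The derivative of the density produces the factor `-(x · e)`. All other terms are bounded by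
  -- the energy, with factors `2 p` (as `|arctan| ≤ 2`) and `1`; undoing `mul_arctan_ge` gives `2 (2
  -- p + 1) + 1 = 4 p + 3`.
  have hparts := integral_mul_fderiv_eq_neg_fderiv_mul_of_integrable
    (μ := (volume : Measure (EuclideanSpace ℝ (Fin N))))
    (f := fun x => Real.arctan (inner ℝ x e)) (g := gaussRpow p φ) (v := e)
    ((((hat.continuous_fderiv one_ne_zero).clm_apply continuous_const).mul
      hcd.continuous).integrable_of_hasCompactSupport hs.mul_left)
    ((hat.continuous.mul hud).integrable_of_hasCompactSupport huds.mul_left)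
    ((hat.continuous.mul hcd.continuous).integrable_of_hasCompactSupport hs.mul_left)
    (fun x _ => hat.differentiable one_ne_zero x) (fun x _ => hcd.differentiable one_ne_zero x)
  have hexp : ∀ x, Real.arctan (inner ℝ x e) * fderiv ℝ (gaussRpow p φ) x e =
      Real.arctan (inner ℝ x e) * (gaussDensity N x * fderiv ℝ (fun x => ‖φ x‖ ^ p) x e) -
        (inner ℝ x e * Real.arctan (inner ℝ x e)) * gaussRpow p φ x := by
    intro x
    rw [hφ.fderiv_gaussRpow hp]
    simp
    ring
  simp_rw [hexp, hatd] at hparts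
  have hi1 : Integrable fun x => Real.arctan (inner ℝ x e) *
      (gaussDensity N x * fderiv ℝ (fun x => ‖φ x‖ ^ p) x e) := by
    refine (hat.continuous.mul (continuous_gaussDensity.mul
      hq)).integrable_of_hasCompactSupport
      (HasCompactSupport.mul_left (HasCompactSupport.mul_left ?_))
    exact ((hφ.hasCompactSupport_rpow hp).fderiv ℝ).comp_left
      (g := fun L : EuclideanSpace ℝ (Fin N) →L[ℝ] ℝ => L e) rfl
  have hi2 : Integrable fun x => (inner ℝ x e * Real.arctan (inner ℝ x e)) * gaussRpow p φ x :=
    hφ.integrable_mul_gaussRpow hp (hin.continuous.mul hat.continuous)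
  have hi3 : Integrable fun x : EuclideanSpace ℝ (Fin N) =>
      1 / (1 + inner ℝ x e ^ 2) * gaussRpow p φ x :=
    hφ.integrable_mul_gaussRpow hp (continuous_const.div
      (continuous_const.add (hin.continuous.pow 2)) fun x => by positivity)
  rw [integral_sub hi1 hi2] at hparts
  have h1 : ∫ x, Real.arctan (inner ℝ x e) *
      (gaussDensity N x * fderiv ℝ (fun x => ‖φ x‖ ^ p) x e) ≤ 2 * p * S := by
    rw [hS, gaussEnergy, ← integral_const_mul]
    refine integral_mono hi1 ((hφ.integrable_energy hp).const_mul _) fun x => ?_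
    have h2 : |Real.arctan (inner ℝ x e)| ≤ 2 := by
      have h3 := Real.pi_lt_four
      rw [abs_le]
      constructor
      · linarith [Real.neg_pi_div_two_lt_arctan (inner ℝ x e)]
      · linarith [Real.arctan_lt_pi_div_two (inner ℝ x e)]
    have h3 : |fderiv ℝ (fun x => ‖φ x‖ ^ p) x e| ≤ p * (‖φ x‖ ^ p + ‖gradient φ x‖ ^ p) := by
      refine ((fderiv ℝ (fun x => ‖φ x‖ ^ p) x).le_opNorm e).trans ?_
      rw [he, mul_one]
      exact hφ.norm_fderiv_rpow_le hp x
    have hρ := (gaussDensity_pos x).le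
    calc _ ≤ |Real.arctan (inner ℝ x e) *
          (gaussDensity N x * fderiv ℝ (fun x => ‖φ x‖ ^ p) x e)| := le_abs_self _
      _ = |Real.arctan (inner ℝ x e)| *
          (gaussDensity N x * |fderiv ℝ (fun x => ‖φ x‖ ^ p) x e|) := by
          rw [abs_mul, abs_mul, abs_of_nonneg hρ]
      _ ≤ 2 * (gaussDensity N x * (p * (‖φ x‖ ^ p + ‖gradient φ x‖ ^ p))) := by gcongr
      _ = _ := by ring
  have h2 : ∫ x : EuclideanSpace ℝ (Fin N), 1 / (1 + inner ℝ x e ^ 2) * gaussRpow p φ x ≤ S := by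
    refine (integral_mono hi3 (hφ.integrable_gaussRpow hp) fun x => ?_).trans
      (hφ.integral_gaussRpow_le hp)
    refine mul_le_of_le_one_left (gaussRpow_nonneg x) ?_
    rw [div_le_one (by positivity)]
    linarith [sq_nonneg (inner ℝ x e)]
  have h3 : ∫ x, |inner ℝ x e| * gaussRpow p φ x ≤
      ∫ x, (2 * ((inner ℝ x e * Real.arctan (inner ℝ x e)) * gaussRpow p φ x) +
        gaussRpow p φ x) := by
    refine integral_mono (hφ.integrable_mul_gaussRpow hp hin.continuous.abs)
      ((hi2.const_mul 2).add (hφ.integrable_gaussRpow hp)) fun x => ?_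
    have := mul_le_mul_of_nonneg_right (mul_arctan_ge (inner ℝ x e))
      (gaussRpow_nonneg (p := p) (φ := φ) x)
    simp only
    linarith
  rw [integral_add (hi2.const_mul 2) (hφ.integrable_gaussRpow hp), integral_const_mul] at h3
  have h4 := hφ.integral_gaussRpow_le hp
  linarith

theorem IsTestFunction.integral_norm_mul_le (hp : 1 < p) (hφ : IsTestFunction Ω φ) :
    ∫ x, ‖x‖ * gaussRpow p φ x ≤ N * (4 * p + 3) * gaussEnergy p φ := by
  have hi : ∀ i : Fin N, Integrable fun x : EuclideanSpace ℝ (Fin N) =>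
      |inner ℝ x (EuclideanSpace.single i (1 : ℝ))| * gaussRpow p φ x := fun i =>
    hφ.integrable_mul_gaussRpow hp (continuous_id.inner continuous_const).abs
  have h1 : ∀ x : EuclideanSpace ℝ (Fin N), ‖x‖ * gaussRpow p φ x ≤
      ∑ i, |inner ℝ x (EuclideanSpace.single i (1 : ℝ))| * gaussRpow p φ x := by
    intro x
    rw [← Finset.sum_mul]
    refine mul_le_mul_of_nonneg_right ?_ (gaussRpow_nonneg x)
    rw [EuclideanSpace.norm_eq]
    simp only [EuclideanSpace.inner_single_right, one_mul, conj_trivial, Real.norm_eq_abs]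
    refine Real.sqrt_le_iff.2 ⟨Finset.sum_nonneg fun _ _ => abs_nonneg _, ?_⟩
    exact Finset.sum_sq_le_sq_sum_of_nonneg fun i _ => abs_nonneg _
  calc ∫ x, ‖x‖ * gaussRpow p φ x
      ≤ ∫ x, ∑ i, |inner ℝ x (EuclideanSpace.single i (1 : ℝ))| * gaussRpow p φ x :=
        integral_mono (hφ.integrable_mul_gaussRpow hp continuous_norm)
          (integrable_finsetSum _ fun i _ => hi i) h1
    _ = ∑ i, ∫ x, |inner ℝ x (EuclideanSpace.single i (1 : ℝ))| * gaussRpow p φ x :=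
        integral_finsetSum _ fun i _ => hi i
    _ ≤ ∑ _i : Fin N, (4 * p + 3) * gaussEnergy p φ :=
        Finset.sum_le_sum fun i _ => hφ.integral_coord_mul_le hp (by simp)
    _ = N * (4 * p + 3) * gaussEnergy p φ := by
        simp
        ring

/-- The gradient of the density contributes `‖x‖ |φ|^p` times the density, so the first moment bound
is what controls `gaussRpow p φ` in unweighted `W^{1,1}`. -/
theorem IsTestFunction.integral_norm_fderiv_gaussRpow_le (hp : 1 < p) (hφ : IsTestFunction Ω φ) :
    ∫ x, ‖fderiv ℝ (gaussRpow p φ) x‖ ≤ (p + N * (4 * p + 3)) * gaussEnergy p φ := by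
  have hi1 := (hφ.integrable_energy hp).const_mul p
  have hi2 := hφ.integrable_mul_gaussRpow hp continuous_norm
  have h1 : ∫ x, ‖fderiv ℝ (gaussRpow p φ) x‖ ≤
      ∫ x, (p * (gaussDensity N x * (‖φ x‖ ^ p + ‖gradient φ x‖ ^ p)) +
        ‖x‖ * gaussRpow p φ x) := by
    refine integral_mono ?_ (hi1.add hi2) fun x => ?_
    · exact (((hφ.contDiff_gaussRpow hp).continuous_fderiv
        one_ne_zero).integrable_of_hasCompactSupport
          ((hφ.hasCompactSupport_gaussRpow hp).fderiv ℝ)).norm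
    · simp only
      rw [hφ.fderiv_gaussRpow hp]
      refine (norm_sub_le _ _).trans ?_
      rw [norm_smul, norm_smul, innerSL_apply_norm, Real.norm_of_nonneg (gaussDensity_pos x).le,
        Real.norm_of_nonneg (gaussRpow_nonneg x)]
      have h2 := mul_le_mul_of_nonneg_left (hφ.norm_fderiv_rpow_le hp x) (gaussDensity_pos x).le
      linarith
  rw [integral_add hi1 hi2, integral_const_mul] at h1
  have h2 := hφ.integral_norm_mul_le hp
  unfold gaussEnergy at h2 ⊢
  linarith

end GaussianTail

/-! ### The super-Poincaré inequality -/

section SuperPoincare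

variable {N : ℕ} {Ω : Set (EuclideanSpace ℝ (Fin N))} {p : ℝ}

theorem exists_le_gaussDensity (R : ℝ) :
    ∃ c : ℝ, 0 < c ∧ ∀ x : EuclideanSpace ℝ (Fin N), ‖x‖ ≤ R → c ≤ gaussDensity N x := by
  refine ⟨1 / (2 * Real.pi) ^ ((N : ℝ) / 2) * Real.exp (-(R ^ 2) / 2), by positivity,
    fun x hx => ?_⟩
  unfold gaussDensity
  gcongr

theorem IsTestFunction.integrable_mul_abs {φ : EuclideanSpace ℝ (Fin N) → ℝ}
    (hφ : IsTestFunction Ω φ) : Integrable fun x => gaussDensity N x * |φ x| :=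
  (continuous_gaussDensity.mul hφ.1.continuous.abs).integrable_of_hasCompactSupport
    (HasCompactSupport.mul_left hφ.2.1.norm)

theorem IsTestFunction.gaussEnergy_nonneg {φ : EuclideanSpace ℝ (Fin N) → ℝ} :
    0 ≤ gaussEnergy p φ :=
  integral_nonneg fun x => mul_nonneg (gaussDensity_pos x).le (by positivity)

/-- The `L^p` mass is controlled by a small multiple of the energy and a multiple of the
`L^1` mass. -/
theorem exists_integral_gaussRpow_le (hp : 1 < p) {ε : ℝ} (hε : 0 < ε) :
    ∃ C : ℝ, 0 ≤ C ∧ ∀ φ : EuclideanSpace ℝ (Fin N) → ℝ, IsTestFunction Ω φ →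
      ∫ x, gaussRpow p φ x ≤ ε * gaussEnergy p φ +
        C * (1 + gaussEnergy p φ) * ∫ x, gaussDensity N x * |φ x| := by
  set A : ℝ := N * (4 * p + 3) with hA
  have hA0 : 0 ≤ A := by positivity
  -- The mass outside radius `R` is at most `A / R` times the energy, below `ε / 2` times the
  -- energy.
  set R : ℝ := 2 * A / ε + 1 with hR
  have hR0 : 0 < R := by positivity
  set B : ℝ := p + A with hB
  have hB0 : 0 < B := by linarith
  -- The translation error `δ B` times the energy is the other half of `ε`.
  set δ : ℝ := ε / (2 * B) with hδ
  have hδ0 : 0 < δ := by positivity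
  obtain ⟨c, hc0, hc⟩ := exists_le_gaussDensity (N := N) R
  set b : ℝ := volume.real (Metric.ball (0 : EuclideanSpace ℝ (Fin N)) δ) with hb
  have hb0 : 0 < b := ENNReal.toReal_pos (Metric.measure_ball_pos _ _ hδ0).ne'
    measure_ball_lt_top.ne
  refine ⟨1 + 1 / (c * b), by positivity, fun φ hφ => ?_⟩
  set S := gaussEnergy p φ with hS
  have hS0 : 0 ≤ S := IsTestFunction.gaussEnergy_nonneg
  set m := ∫ x, gaussDensity N x * |φ x| with hm
  have hm0 : 0 ≤ m := integral_nonneg fun x => mul_nonneg (gaussDensity_pos x).le (abs_nonneg _)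
  set T : Set (EuclideanSpace ℝ (Fin N)) := Metric.closedBall 0 R ∩ {x | 1 < |φ x|} with hT
  have hTm : MeasurableSet T := Metric.isClosed_closedBall.measurableSet.inter
    (isOpen_lt continuous_const hφ.1.continuous.abs).measurableSet
  have hTf : volume T ≠ ⊤ :=
    measure_ne_top_of_subset inter_subset_left measure_closedBall_lt_top.ne
  have hi := hφ.integrable_gaussRpow hp
  -- Chebyshev: on `T` one has `|φ| > 1` and density at least `c`, so a small `L^1` mass makes `T`
  -- small.
  have hT1 : c * volume.real T ≤ m := by
    calc c * volume.real T = ∫ _ in T, c := by simp [mul_comm]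
      _ ≤ ∫ x in T, gaussDensity N x * |φ x| := by
        refine setIntegral_mono_on (integrableOn_const hTf) hφ.integrable_mul_abs.integrableOn hTm
          fun x hx => ?_
        have h1 := hc x (by simpa using hx.1)
        have h2 : 1 < |φ x| := hx.2
        nlinarith
      _ ≤ m := setIntegral_le_integral hφ.integrable_mul_abs (Eventually.of_forall fun x =>
          mul_nonneg (gaussDensity_pos x).le (abs_nonneg _))
  have hT2 : b * ∫ x in T, gaussRpow p φ x ≤ volume.real T * S + b * (δ * (B * S)) := by
    have h1 := measureReal_ball_mul_setIntegral_le (μ := volume) (hφ.contDiff_gaussRpow hp)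
      (hφ.hasCompactSupport_gaussRpow hp) hTf hδ0
    simp only [Real.norm_of_nonneg (gaussRpow_nonneg _)] at h1
    refine h1.trans ?_
    gcongr
    · exact hφ.integral_gaussRpow_le hp
    · exact hφ.integral_norm_fderiv_gaussRpow_le hp
  -- Three regions: far from the origin the moment term dominates; near it with `|φ| ≤ 1` one has
  -- `|φ|^p ≤ |φ|`; the remaining set is `T`.
  have hpt : ∀ x, gaussRpow p φ x ≤ 1 / R * (‖x‖ * gaussRpow p φ x) +
      gaussDensity N x * |φ x| + T.indicator (gaussRpow p φ) x := by
    intro x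
    have h0 := gaussRpow_nonneg (p := p) (φ := φ) x
    have h1 : 0 ≤ gaussDensity N x * |φ x| := mul_nonneg (gaussDensity_pos x).le (abs_nonneg _)
    have h2 : 0 ≤ 1 / R * (‖x‖ * gaussRpow p φ x) := by positivity
    have h3 : 0 ≤ T.indicator (gaussRpow p φ) x := indicator_nonneg (fun _ _ => gaussRpow_nonneg _) x
    by_cases hxT : x ∈ T
    · rw [indicator_of_mem hxT]
      linarith
    by_cases hx : ‖x‖ ≤ R
    · have h4 : |φ x| ≤ 1 := by
        by_contra! h
        exact hxT ⟨by simpa using hx, h⟩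
      have h5 : ‖φ x‖ ^ p ≤ |φ x| := Real.rpow_le_self_of_le_one (abs_nonneg _) h4 hp.le
      have h6 : gaussRpow p φ x ≤ gaussDensity N x * |φ x| := by
        rw [gaussRpow, mul_comm]
        exact mul_le_mul_of_nonneg_left h5 (gaussDensity_pos x).le
      linarith
    · have h4 : 1 ≤ 1 / R * ‖x‖ := by
        rw [one_div_mul_eq_div, one_le_div hR0]
        exact (not_le.1 hx).le
      have h5 := mul_le_mul_of_nonneg_right h4 h0
      rw [one_mul, mul_assoc] at h5
      linarith
  have hi1 := (hφ.integrable_mul_gaussRpow hp continuous_norm).const_mul (1 / R)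
  have hint : ∫ x, gaussRpow p φ x ≤ 1 / R * (∫ x, ‖x‖ * gaussRpow p φ x) + m +
      ∫ x in T, gaussRpow p φ x := by
    have h := integral_mono hi ((hi1.add hφ.integrable_mul_abs).add (hi.indicator hTm)) hpt
    have h1 := integral_add (hi1.add hφ.integrable_mul_abs) (hi.indicator hTm)
    have h2 := integral_add hi1 hφ.integrable_mul_abs
    simp only [Pi.add_apply] at h h1 h2
    rwa [h1, h2, integral_const_mul, integral_indicator hTm] at h
  have hfirst : 1 / R * ∫ x, ‖x‖ * gaussRpow p φ x ≤ ε / 2 * S := by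
    have h1 : ∫ x, ‖x‖ * gaussRpow p φ x ≤ A * S := hφ.integral_norm_mul_le hp
    have h2 : A ≤ ε / 2 * R := by
      rw [hR]
      field_simp
      linarith
    calc 1 / R * ∫ x, ‖x‖ * gaussRpow p φ x ≤ 1 / R * ((ε / 2 * R) * S) := by
          refine mul_le_mul_of_nonneg_left (h1.trans ?_) (by positivity)
          gcongr
      _ = ε / 2 * S := by field_simp
  have hlast : ∫ x in T, gaussRpow p φ x ≤ 1 / (c * b) * S * m + ε / 2 * S := by
    have h1 : volume.real T ≤ m / c := by
      rw [le_div_iff₀ hc0]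
      linarith
    have h2 : b * ∫ x in T, gaussRpow p φ x ≤ b * (1 / (c * b) * S * m + ε / 2 * S) := by
      refine hT2.trans ?_
      have h3 : volume.real T * S ≤ m / c * S := by gcongr
      have h4 : b * (1 / (c * b) * S * m + ε / 2 * S) = m / c * S + b * (δ * (B * S)) := by
        rw [hδ]
        field_simp
      linarith
    exact le_of_mul_le_mul_left h2 hb0
  have h7 : 0 ≤ 1 / (c * b) * m := by positivity
  have h8 : 0 ≤ S * m := by positivity
  calc ∫ x, gaussRpow p φ x ≤ ε / 2 * S + m + (1 / (c * b) * S * m + ε / 2 * S) := by linarith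
    _ ≤ ε * S + (1 + 1 / (c * b)) * (1 + S) * m := by
      have : (1 + 1 / (c * b)) * (1 + S) * m =
        m + S * m + 1 / (c * b) * m + 1 / (c * b) * S * m := by ring
      linarith

theorem setIntegral_gaussMeasure_eq_integral (hΩ : MeasurableSet Ω)
    {f : EuclideanSpace ℝ (Fin N) → ℝ} (hf : ∀ x ∉ Ω, f x = 0) :
    ∫ x in Ω, f x ∂(gaussMeasure N) = ∫ x, gaussDensity N x * f x := by
  rw [setIntegral_gaussMeasure hΩ]
  refine setIntegral_eq_integral_of_forall_compl_eq_zero fun x hx => ?_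
  rw [hf x hx, smul_zero]

variable [IsFiniteMeasure ((gaussMeasure N).restrict Ω)]

/-- Each integral is continuous along the approximating test functions, so the inequality extends by
density. -/
theorem SobolevZero.exists_integral_norm_rpow_le (hΩ : MeasurableSet Ω) (hp : 1 < p) {ε : ℝ}
    (hε : 0 < ε) : ∃ C : ℝ, 0 ≤ C ∧ ∀ (u : EuclideanSpace ℝ (Fin N) → ℝ)
      (g : EuclideanSpace ℝ (Fin N) → EuclideanSpace ℝ (Fin N)), SobolevZero p Ω u g →
      ∫ x in Ω, ‖u x‖ ^ p ∂(gaussMeasure N) ≤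
        ε * (∫ x in Ω, ‖u x‖ ^ p ∂(gaussMeasure N) + ∫ x in Ω, ‖g x‖ ^ p ∂(gaussMeasure N)) +
        C * (1 + (∫ x in Ω, ‖u x‖ ^ p ∂(gaussMeasure N) +
          ∫ x in Ω, ‖g x‖ ^ p ∂(gaussMeasure N))) * ∫ x in Ω, |u x| ∂(gaussMeasure N) := by
  obtain ⟨C, hC, h⟩ := exists_integral_gaussRpow_le (Ω := Ω) hp hε
  have hp0 : (0 : ℝ) ^ p = 0 := Real.zero_rpow (by linarith)
  refine ⟨C, hC, fun u g ⟨hu, hg, φ, hφ, hφu, hφg⟩ => ?_⟩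
  have hφm : ∀ n, MemLp (φ n) (ENNReal.ofReal p) ((gaussMeasure N).restrict Ω) :=
    fun n => (hφ n).memLp _
  have hgm : ∀ n, MemLp (gradient (φ n)) (ENNReal.ofReal p) ((gaussMeasure N).restrict Ω) :=
    fun n => (hφ n).memLp_gradient _
  have l1 := tendsto_integral_norm_rpow hp hφm hu hφu
  have l2 := tendsto_integral_norm_rpow hp hgm hg hφg
  have l3 : Tendsto (fun n => ∫ x in Ω, |φ n x| ∂(gaussMeasure N)) atTop
      (𝓝 (∫ x in Ω, |u x| ∂(gaussMeasure N))) := by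
    refine tendsto_integral_of_tendsto_rpow hp (fun n => (hφm n).norm) hu.norm
      (squeeze_zero (fun n => integral_norm_rpow_nonneg) (fun n => ?_) hφu)
    refine integral_mono (integrable_rpow_of_memLp hp ((hφm n).norm.sub hu.norm))
      (integrable_rpow_of_memLp hp ((hφm n).sub hu)) fun x => ?_
    exact Real.rpow_le_rpow (norm_nonneg _) (abs_abs_sub_abs_le _ _) (by linarith)
  refine le_of_tendsto_of_tendsto' l1
    (((l1.add l2).const_mul ε).add ((((l1.add l2).const_add 1).const_mul C).mul l3)) fun n => ?_
  have hT := hφ n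
  have e1 : ∫ x in Ω, ‖φ n x‖ ^ p ∂(gaussMeasure N) = ∫ x, gaussRpow p (φ n) x := by
    rw [setIntegral_gaussMeasure_eq_integral hΩ fun x hx => by
      rw [IsTestFunction.eq_zero_of_notMem hT hx, norm_zero, hp0]]
    exact integral_congr_ae (Eventually.of_forall fun x => mul_comm _ _)
  have e2 : ∫ x in Ω, ‖φ n x‖ ^ p ∂(gaussMeasure N) +
      ∫ x in Ω, ‖gradient (φ n) x‖ ^ p ∂(gaussMeasure N) = gaussEnergy p (φ n) := by
    rw [← integral_add (integrable_rpow_of_memLp hp (hφm n))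
      (integrable_rpow_of_memLp hp (hgm n)), gaussEnergy,
      setIntegral_gaussMeasure_eq_integral hΩ fun x hx => by
        rw [norm_gradient, IsTestFunction.eq_zero_of_notMem hT hx,
          IsTestFunction.fderiv_eq_zero_of_notMem hT hx, norm_zero, norm_zero, hp0, add_zero]]
  have e3 : ∫ x in Ω, |φ n x| ∂(gaussMeasure N) = ∫ x, gaussDensity N x * |φ n x| :=
    setIntegral_gaussMeasure_eq_integral hΩ fun x hx => by
      rw [IsTestFunction.eq_zero_of_notMem hT hx, abs_zero]
  rw [e2, e1, e3]
  exact h _ hT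

end SuperPoincare

/-! ### Properties of `Q_p`: ordering, derivative and limits -/

section GeneralizedTorsion

theorem exists_subseq_tendsto_ae_of_integral {α : Type*} {mα : MeasurableSpace α} {μ : Measure α}
    {u : ℕ → α → ℝ} {v : α → ℝ} (hu : ∀ n, Integrable (u n) μ) (hv : Integrable v μ)
    (h : Tendsto (fun n => ∫ x, ‖u n x - v x‖ ∂μ) atTop (𝓝 0)) :
    ∃ ns : ℕ → ℕ, StrictMono ns ∧ ∀ᵐ x ∂μ, Tendsto (fun n => u (ns n) x) atTop (𝓝 (v x)) := by
  refine (tendstoInMeasure_of_tendsto_eLpNorm one_ne_zero (fun n => (hu n).1) hv.1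
    ?_).exists_seq_tendsto_ae
  have h1 := ENNReal.tendsto_ofReal h
  rw [ENNReal.ofReal_zero] at h1
  refine h1.congr fun n => ?_
  rw [eLpNorm_one_eq_lintegral_enorm]
  exact ofReal_integral_norm_eq_lintegral_enorm ((hu n).sub hv)

variable {N : ℕ} {Ω : Set (EuclideanSpace ℝ (Fin N))} {p α β : ℝ}
  {v w : EuclideanSpace ℝ (Fin N) → ℝ}
  {g h : EuclideanSpace ℝ (Fin N) → EuclideanSpace ℝ (Fin N)}

theorem exists_isTestFunction_integral_pos (hΩ : IsOpen Ω) (hne : Ω.Nonempty) :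
    ∃ φ, IsTestFunction Ω φ ∧ 0 < ∫ x in Ω, φ x ∂(gaussMeasure N) := by
  obtain ⟨x, hx⟩ := hne
  obtain ⟨r, hr, hrΩ⟩ := Metric.nhds_basis_closedBall.mem_iff.1 (hΩ.mem_nhds hx)
  let f : ContDiffBump x := ⟨r / 2, r, by positivity, by linarith⟩
  have hf : IsTestFunction Ω f := ⟨f.contDiff, f.hasCompactSupport, by
    rw [f.tsupport_eq]
    exact hrΩ⟩
  refine ⟨f, hf, ?_⟩
  rw [setIntegral_gaussMeasure_eq_integral hΩ.measurableSet fun y hy => hf.eq_zero_of_notMem hy]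
  refine (continuous_gaussDensity.mul f.continuous).integral_pos_of_hasCompactSupport_nonneg_nonzero
    f.hasCompactSupport.mul_left (fun y => mul_nonneg (gaussDensity_pos y).le f.nonneg) (x := x) ?_
  have h1 : f x = 1 := f.one_of_mem_closedBall (Metric.mem_closedBall_self f.rIn_pos.le)
  rw [h1, mul_one]
  exact (gaussDensity_pos x).ne'

theorem torsionFunctional_const_mul {t : ℝ} (ht : 0 ≤ t) :
    torsionFunctional p α Ω (fun x => t * w x) (fun x => t • h x) =
      t ^ p * (-(∫ x in Ω, ‖h x‖ ^ p ∂(gaussMeasure N)) +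
        α * (∫ x in Ω, ‖w x‖ ^ p ∂(gaussMeasure N))) + p * (t * ∫ x in Ω, w x ∂(gaussMeasure N)) := by
  simp only [torsionFunctional, norm_smul, abs_mul, Real.norm_eq_abs, abs_of_nonneg ht]
  simp only [Real.mul_rpow ht (norm_nonneg _), Real.mul_rpow ht (abs_nonneg _), integral_const_mul]
  ring

theorem torsionFunctional_eq_add (p α β : ℝ) (Ω : Set (EuclideanSpace ℝ (Fin N)))
    (w : EuclideanSpace ℝ (Fin N) → ℝ) (h : EuclideanSpace ℝ (Fin N) → EuclideanSpace ℝ (Fin N)) :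
    torsionFunctional p α Ω w h = torsionFunctional p β Ω w h +
      (α - β) * ∫ x in Ω, ‖w x‖ ^ p ∂(gaussMeasure N) := by
  simp only [torsionFunctional, Real.norm_eq_abs]
  ring

theorem lambdaOne_nonneg (p : ℝ) (Ω : Set (EuclideanSpace ℝ (Fin N))) : 0 ≤ lambdaOne p Ω := by
  refine Real.sInf_nonneg ?_
  rintro r ⟨w, g, -, -, rfl⟩
  exact div_nonneg integral_norm_rpow_nonneg (integral_norm_rpow_nonneg (u := w))

variable [IsFiniteMeasure ((gaussMeasure N).restrict Ω)]

theorem IsResolventSolution.isGreatest (hΩ : IsOpen Ω) (hp : 1 < p) (hα : α < lambdaOne p Ω)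
    (hv : IsResolventSolution p Ω 0 α v v g) :
    IsGreatest (torsionValues p α Ω) ((p - 1) * ∫ x in Ω, v x ∂(gaussMeasure N)) := by
  constructor
  · exact ⟨v, g, (memW1pZero_iff hΩ hp).2 hv.1, (hv.torsionFunctional_eq hp).symm⟩
  · rintro r ⟨w, h, hw, rfl⟩
    exact hv.torsionFunctional_le hp (hv.nonneg hΩ hp hα) ((memW1pZero_iff hΩ hp).1 hw)

theorem IsResolventSolution.genTorsion_eq (hΩ : IsOpen Ω) (hp : 1 < p) (hα : α < lambdaOne p Ω)
    (hv : IsResolventSolution p Ω 0 α v v g) :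
    genTorsion p α Ω = (p - 1) * ∫ x in Ω, v x ∂(gaussMeasure N) :=
  (hv.isGreatest hΩ hp hα).csSup_eq

theorem torsionFunctional_le_genTorsion (hΩ : IsOpen Ω) (hp : 1 < p) (hα : α < lambdaOne p Ω)
    (hw : SobolevZero p Ω w h) : torsionFunctional p α Ω w h ≤ genTorsion p α Ω := by
  obtain ⟨v, g, hv, -⟩ := exists_minimal_solution hΩ hp hα
  exact le_csSup (hv.isGreatest hΩ hp hα).bddAbove ⟨w, h, (memW1pZero_iff hΩ hp).2 hw, rfl⟩

theorem IsResolventSolution.integrable (hp : 1 < p) (hv : IsResolventSolution p Ω 0 α v v g) :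
    Integrable v ((gaussMeasure N).restrict Ω) :=
  integrable_of_memLp_ofReal hp hv.1.1

/-- The minimal solution at level `α` lies below `v` and has the same integral, both being `Q_p / (p
- 1)`; hence it equals `v`, and it lies below `w`. The case `α = β` yields uniqueness. -/
theorem IsResolventSolution.ae_le (hΩ : IsOpen Ω) (hp : 1 < p) (hαβ : α ≤ β)
    (hβ : β < lambdaOne p Ω) (hv : IsResolventSolution p Ω 0 α v v g)
    (hw : IsResolventSolution p Ω 0 β w w h) :
    ∀ᵐ x ∂(gaussMeasure N).restrict Ω, v x ≤ w x := by
  have hα := hαβ.trans_lt hβ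
  obtain ⟨z, k, hz, hmin⟩ := exists_minimal_solution hΩ hp hα
  have h1 := hmin α v g le_rfl hα hv
  have h2 : ∫ x in Ω, z x ∂(gaussMeasure N) = ∫ x in Ω, v x ∂(gaussMeasure N) := by
    have h3 := (hz.genTorsion_eq hΩ hp hα).symm.trans (hv.genTorsion_eq hΩ hp hα)
    exact mul_left_cancel₀ (by linarith) h3
  have h3 := (integral_eq_iff_of_ae_le (hz.integrable hp) (hv.integrable hp) h1).1 h2
  filter_upwards [h3, hmin β w h hαβ hβ hw] with x hx hxw
  rwa [← hx]

/-- `v` is a competitor at level `β`, and the functional is affine in the level with slope `∫‖v‖ ^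
p`. No order between `α` and `β` is assumed, so this is a subgradient inequality. -/
theorem IsResolventSolution.genTorsion_add_le (hΩ : IsOpen Ω) (hp : 1 < p)
    (hα : α < lambdaOne p Ω) (hβ : β < lambdaOne p Ω) (hv : IsResolventSolution p Ω 0 α v v g) :
    genTorsion p α Ω + (β - α) * ∫ x in Ω, ‖v x‖ ^ p ∂(gaussMeasure N) ≤ genTorsion p β Ω := by
  rw [hv.genTorsion_eq hΩ hp hα, ← hv.torsionFunctional_eq hp, ← torsionFunctional_eq_add]
  exact torsionFunctional_le_genTorsion hΩ hp hβ hv.1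

/-- If `v = 0` a.e., its gradient vanishes as well, and the equation forces every test function to
have integral `0`. -/
theorem IsResolventSolution.integral_rpow_pos (hΩ : IsOpen Ω) (hne : Ω.Nonempty) (hp : 1 < p)
    (hv : IsResolventSolution p Ω 0 α v v g) : 0 < ∫ x in Ω, ‖v x‖ ^ p ∂(gaussMeasure N) := by
  refine integral_norm_rpow_nonneg.lt_of_ne' fun h0 => ?_
  have hv0 := (integral_norm_rpow_eq_zero_iff hp hv.1.1).1 h0
  have hvi : ∫ x in Ω, v x ∂(gaussMeasure N) = 0 := integral_eq_zero_of_ae hv0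
  have hg : ∫ x in Ω, ‖g x‖ ^ p ∂(gaussMeasure N) = 0 := by
    have h1 := hv.torsionFunctional_eq hp
    simp only [Real.norm_eq_abs] at h0
    rw [torsionFunctional, h0, hvi] at h1
    linarith
  have hg0 := (integral_norm_rpow_eq_zero_iff hp hv.1.2.1).1 hg
  obtain ⟨φ, hφ, hpos⟩ := exists_isTestFunction_integral_pos hΩ hne
  have h1 := hv.2 φ (gradient φ) (hφ.approxBy hp hφ)
  rw [integral_eq_zero_of_ae (hg0.mono fun x hx => by simp [hx, pFlux_zero]),
    integral_eq_zero_of_ae (hv0.mono fun x hx => by simp [hx, pFlux_zero])] at h1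
  linarith

theorem strictMonoOn_genTorsion (hΩ : IsOpen Ω) (hne : Ω.Nonempty) (hp : 1 < p) :
    StrictMonoOn (fun α : ℝ => genTorsion p α Ω) (Iio (lambdaOne p Ω)) := by
  intro α hα β hβ hαβ
  obtain ⟨v, g, hv, -⟩ := exists_minimal_solution hΩ hp hα
  have h1 := hv.genTorsion_add_le hΩ hp hα hβ
  have h2 := mul_pos (sub_pos.2 hαβ) (hv.integral_rpow_pos hΩ hne hp)
  simp only
  linarith

theorem IsResolventSolution.integral_rpow_le (hΩ : IsOpen Ω) (hp : 1 < p) (hαβ : α ≤ β)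
    (hβ : β < lambdaOne p Ω) (hv : IsResolventSolution p Ω 0 α v v g)
    (hw : IsResolventSolution p Ω 0 β w w h) :
    ∫ x in Ω, ‖v x‖ ^ p ∂(gaussMeasure N) ≤ ∫ x in Ω, ‖w x‖ ^ p ∂(gaussMeasure N) := by
  refine integral_mono_ae (integrable_rpow_of_memLp hp hv.1.1)
    (integrable_rpow_of_memLp hp hw.1.1) ?_
  filter_upwards [hv.nonneg hΩ hp (hαβ.trans_lt hβ), hv.ae_le hΩ hp hαβ hβ hw] with x h0 hx
  refine Real.rpow_le_rpow (norm_nonneg _) ?_ (by linarith)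
  rwa [Real.norm_of_nonneg h0, Real.norm_of_nonneg (h0.trans hx)]

/-- Continuity of `β ↦ ∫ |v_β|^p` along sequences. -/
theorem tendsto_integral_rpow_of_tendsto (hΩ : IsOpen Ω) (hp : 1 < p) (hα : α < lambdaOne p Ω)
    {b : ℕ → ℝ} (hb : Tendsto b atTop (𝓝 α)) {β : ℝ} (hβ : β < lambdaOne p Ω) (hαβ : α ≤ β)
    (hbβ : ∀ n, b n ≤ β) {V : ℕ → EuclideanSpace ℝ (Fin N) → ℝ}
    {G : ℕ → EuclideanSpace ℝ (Fin N) → EuclideanSpace ℝ (Fin N)}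
    (hV : ∀ n, IsResolventSolution p Ω 0 (b n) (V n) (V n) (G n))
    (hv : IsResolventSolution p Ω 0 α v v g) :
    ∃ ns : ℕ → ℕ, Tendsto (fun n => ∫ x in Ω, ‖V (ns n) x‖ ^ p ∂(gaussMeasure N)) atTop
      (𝓝 (∫ x in Ω, ‖v x‖ ^ p ∂(gaussMeasure N))) := by
  obtain ⟨w, h, hw, -⟩ := exists_minimal_solution hΩ hp hβ
  have hbl : ∀ n, b n < lambdaOne p Ω := fun n => (hbβ n).trans_lt hβ
  set M := ∫ x in Ω, ‖w x‖ ^ p ∂(gaussMeasure N) with hM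
  -- Ordered solutions have `L^1` distance equal to the difference of integrals, that is `|Q_p(b n)
  -- - Q_p(α)| / (p - 1)`, and the subgradients up to level `β` are at most `M`.
  have hint : ∀ n, ∫ x in Ω, ‖V n x - v x‖ ∂(gaussMeasure N) ≤ |b n - α| * M / (p - 1) := by
    intro n
    have e1 := (hV n).genTorsion_eq hΩ hp (hbl n)
    have e2 := hv.genTorsion_eq hΩ hp hα
    have e3 := (hV n).genTorsion_add_le hΩ hp (hbl n) hα
    have e4 := hv.genTorsion_add_le hΩ hp hα (hbl n)
    have e5 := (hV n).integral_rpow_le hΩ hp (hbβ n) hβ hw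
    have e6 := hv.integral_rpow_le hΩ hp hαβ hβ hw
    have hi1 := (hV n).integrable hp
    have hi2 := hv.integrable hp
    rw [le_div_iff₀ (by linarith)]
    rcases le_total α (b n) with hc | hc
    · have h1 : ∫ x in Ω, ‖V n x - v x‖ ∂(gaussMeasure N) =
          ∫ x in Ω, (V n x - v x) ∂(gaussMeasure N) := integral_congr_ae <| by
        filter_upwards [hv.ae_le hΩ hp hc (hbl n) (hV n)] with x hx
        exact Real.norm_of_nonneg (sub_nonneg.2 hx)
      rw [h1, integral_sub hi1 hi2, abs_of_nonneg (sub_nonneg.2 hc)]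
      have h2 := mul_le_mul_of_nonneg_left e5 (sub_nonneg.2 hc)
      linarith
    · have h1 : ∫ x in Ω, ‖V n x - v x‖ ∂(gaussMeasure N) =
          ∫ x in Ω, (v x - V n x) ∂(gaussMeasure N) := integral_congr_ae <| by
        filter_upwards [(hV n).ae_le hΩ hp hc hα hv] with x hx
        rw [norm_sub_rev, Real.norm_of_nonneg (sub_nonneg.2 hx)]
      rw [h1, integral_sub hi2 hi1, abs_of_nonpos (sub_nonpos.2 hc)]
      have h2 := mul_le_mul_of_nonneg_left e6 (sub_nonneg.2 hc)
      linarith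
  have hlim : Tendsto (fun n => ∫ x in Ω, ‖V n x - v x‖ ∂(gaussMeasure N)) atTop (𝓝 0) := by
    refine squeeze_zero (fun n => integral_nonneg fun x => norm_nonneg _) hint ?_
    have h1 := (((hb.sub_const α).abs.mul_const M).div_const (p - 1))
    simpa using h1
  obtain ⟨ns, -, hns⟩ := exists_subseq_tendsto_ae_of_integral (fun n => (hV n).integrable hp)
    (hv.integrable hp) hlim
  -- The solution at the higher level `β` dominates all the others.
  refine ⟨ns, tendsto_integral_of_dominated_convergence (fun x => ‖w x‖ ^ p)
    (fun n => (integrable_rpow_of_memLp hp (hV (ns n)).1.1).1)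
    (integrable_rpow_of_memLp hp hw.1.1) (fun n => ?_) ?_⟩
  · filter_upwards [(hV (ns n)).nonneg hΩ hp (hbl _), (hV (ns n)).ae_le hΩ hp (hbβ _) hβ hw]
      with x h0 hx
    rw [Real.norm_of_nonneg (by positivity)]
    refine Real.rpow_le_rpow (norm_nonneg _) ?_ (by linarith)
    rwa [Real.norm_of_nonneg h0, Real.norm_of_nonneg (h0.trans hx)]
  · filter_upwards [hns] with x hx
    exact (continuous_norm_rpow hp).continuousAt.tendsto.comp hx

theorem IsResolventSolution.hasDerivAt_genTorsion (hΩ : IsOpen Ω) (hp : 1 < p)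
    (hα : α < lambdaOne p Ω) (hv : IsResolventSolution p Ω 0 α v v g) :
    HasDerivAt (fun a : ℝ => genTorsion p a Ω) (∫ x in Ω, ‖v x‖ ^ p ∂(gaussMeasure N)) α := by
  have hex : ∀ β : ℝ, ∃ (z : EuclideanSpace ℝ (Fin N) → ℝ)
      (k : EuclideanSpace ℝ (Fin N) → EuclideanSpace ℝ (Fin N)),
      β < lambdaOne p Ω → IsResolventSolution p Ω 0 β z z k := by
    intro β
    by_cases hβ : β < lambdaOne p Ω
    · obtain ⟨z, k, hz, -⟩ := exists_minimal_solution hΩ hp hβ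
      exact ⟨z, k, fun _ => hz⟩
    · exact ⟨v, g, fun h => absurd h hβ⟩
  choose V G hV using hex
  set A := ∫ x in Ω, ‖v x‖ ^ p ∂(gaussMeasure N) with hA
  obtain ⟨β, hαβ, hβ⟩ := exists_between hα
  have hP : Tendsto (fun b => ∫ x in Ω, ‖V b x‖ ^ p ∂(gaussMeasure N)) (𝓝 α) (𝓝 A) := by
    refine tendsto_of_subseq_tendsto fun b hb => ?_
    obtain ⟨n₀, hn₀⟩ := eventually_atTop.1 (hb.eventually (Iic_mem_nhds hαβ))
    have hb' : Tendsto (fun n => b (n + n₀)) atTop (𝓝 α) := (tendsto_add_atTop_iff_nat n₀).2 hb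
    obtain ⟨ns, hns⟩ := tendsto_integral_rpow_of_tendsto hΩ hp hα hb' hβ hαβ.le
      (fun n => hn₀ _ (Nat.le_add_left _ _))
      (fun n => hV _ ((hn₀ _ (Nat.le_add_left _ _)).trans_lt hβ)) hv
    exact ⟨fun n => ns n + n₀, hns⟩
  rw [hasDerivAt_iff_isLittleO, Asymptotics.isLittleO_iff]
  intro c hc
  filter_upwards [Metric.tendsto_nhds.1 hP c hc, Iio_mem_nhds hα] with b hb hbl
  have e1 := hv.genTorsion_add_le hΩ hp hα hbl
  have e2 := (hV b hbl).genTorsion_add_le hΩ hp hbl hα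
  rw [Real.dist_eq] at hb
  -- The subgradient inequalities at `α` and at `b` trap the remainder between `0` and `(b - α)`
  -- times the change of slope, which tends to `0` by continuity of the slope.
  have e3 : |genTorsion p b Ω - genTorsion p α Ω - (b - α) * A| ≤
      |(b - α) * (∫ x in Ω, ‖V b x‖ ^ p ∂(gaussMeasure N) - A)| := by
    rw [abs_of_nonneg (by linarith)]
    refine le_trans ?_ (le_abs_self _)
    linarith
  rw [smul_eq_mul, Real.norm_eq_abs, Real.norm_eq_abs]
  refine e3.trans ?_
  rw [abs_mul, mul_comm]
  exact mul_le_mul_of_nonneg_right hb.le (abs_nonneg _)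

theorem genTorsion_nonneg (hΩ : IsOpen Ω) (hp : 1 < p) (hα : α < lambdaOne p Ω) :
    0 ≤ genTorsion p α Ω := by
  obtain ⟨v, g, hv, -⟩ := exists_minimal_solution hΩ hp hα
  rw [hv.genTorsion_eq hΩ hp hα]
  exact mul_nonneg (by linarith) (integral_nonneg_of_ae (hv.nonneg hΩ hp hα))

/-- Below the threshold `|t| = ε / p` the constant suffices; above it `|t| ≤ (ε / p) ^ (1 - p) |t| ^
p`. -/
theorem exists_mul_le_add_rpow (hp : 1 < p) {ε : ℝ} (hε : 0 < ε) :
    ∃ C : ℝ, 0 ≤ C ∧ ∀ t : ℝ, p * t ≤ ε + C * ‖t‖ ^ p := by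
  have hp0 : 0 < p := by linarith
  refine ⟨p * (ε / p) ^ (1 - p), by positivity, fun t => ?_⟩
  rcases le_or_gt |t| (ε / p) with ht | ht
  · have h1 : p * t ≤ ε := by
      have := (le_abs_self t).trans ht
      rwa [le_div_iff₀ hp0, mul_comm] at this
    have h2 : 0 ≤ p * (ε / p) ^ (1 - p) * ‖t‖ ^ p := by positivity
    linarith
  · have hd : 0 < ε / p := by positivity
    have ht0 : 0 < |t| := hd.trans ht
    have h1 : |t| ^ (1 - p) ≤ (ε / p) ^ (1 - p) :=
      Real.rpow_le_rpow_of_nonpos hd ht.le (by linarith)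
    have h2 : |t| = |t| ^ (1 - p) * |t| ^ p := by
      rw [← Real.rpow_add ht0, sub_add_cancel, Real.rpow_one]
    calc p * t ≤ p * (|t| ^ (1 - p) * |t| ^ p) := by
          rw [← h2]
          exact mul_le_mul_of_nonneg_left (le_abs_self t) hp0.le
      _ ≤ p * ((ε / p) ^ (1 - p) * |t| ^ p) := by gcongr
      _ ≤ ε + p * (ε / p) ^ (1 - p) * ‖t‖ ^ p := by
          rw [Real.norm_eq_abs, mul_assoc]
          linarith

theorem tendsto_genTorsion_atBot (hΩ : IsOpen Ω) (hp : 1 < p) :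
    Tendsto (fun α : ℝ => genTorsion p α Ω) atBot (𝓝 0) := by
  set m := (gaussMeasure N).real Ω with hm
  refine Metric.tendsto_nhds.2 fun ε hε => ?_
  -- Integrated over `Ω`, of mass `m`, this constant contributes less than `ε`; the power term is
  -- absorbed once `α ≤ -C`.
  obtain ⟨C, hC, hCt⟩ := exists_mul_le_add_rpow hp (ε := ε / (2 * (m + 1))) (by positivity)
  filter_upwards [Iic_mem_atBot (-C), Iio_mem_atBot (lambdaOne p Ω)] with α hαC hα
  rw [Real.dist_0_eq_abs, abs_of_nonneg (genTorsion_nonneg hΩ hp hα)]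
  obtain ⟨v, g, hv, -⟩ := exists_minimal_solution hΩ hp hα
  rw [hv.genTorsion_eq hΩ hp hα, ← hv.torsionFunctional_eq hp]
  have hi := integrable_rpow_of_memLp hp hv.1.1
  have h1 : p * ∫ x in Ω, v x ∂(gaussMeasure N) ≤
      ε / (2 * (m + 1)) * m + C * ∫ x in Ω, ‖v x‖ ^ p ∂(gaussMeasure N) := by
    have h2 := integral_mono ((hv.integrable hp).const_mul p)
      ((integrable_const (ε / (2 * (m + 1)))).add (hi.const_mul C)) fun x => hCt (v x)
    have h3 := integral_add (integrable_const (μ := (gaussMeasure N).restrict Ω)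
      (ε / (2 * (m + 1)))) (hi.const_mul C)
    simp only [Pi.add_apply] at h2 h3
    rw [h3, integral_const_mul, integral_const_mul, integral_const, measureReal_restrict_apply_univ,
      smul_eq_mul, mul_comm _ (ε / _)] at h2
    exact h2
  have h2 : (0 : ℝ) ≤ ∫ x in Ω, ‖g x‖ ^ p ∂(gaussMeasure N) := integral_norm_rpow_nonneg
  have h3 : (α + C) * ∫ x in Ω, ‖v x‖ ^ p ∂(gaussMeasure N) ≤ 0 :=
    mul_nonpos_of_nonpos_of_nonneg (by have : α ≤ -C := hαC; linarith) integral_norm_rpow_nonneg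
  have hm0 : 0 ≤ m := measureReal_nonneg
  have h4 : ε / (2 * (m + 1)) * m < ε := by
    rw [div_mul_eq_mul_div, div_lt_iff₀ (by positivity)]
    nlinarith
  simp only [Real.norm_eq_abs (v _)] at h1 h3
  rw [torsionFunctional]
  linarith

/-- Nonnegative normalized functions almost realizing `λ₁`. -/
theorem exists_normalized_almost_minimizer (hΩ : IsOpen Ω) (hne : Ω.Nonempty) (hp : 1 < p)
    {η : ℝ} (hη : 0 < η) : ∃ w h, SobolevZero p Ω w h ∧ (∀ x, 0 ≤ w x) ∧
      ∫ x in Ω, ‖w x‖ ^ p ∂(gaussMeasure N) = 1 ∧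
      ∫ x in Ω, ‖h x‖ ^ p ∂(gaussMeasure N) ≤ lambdaOne p Ω + η := by
  have hnon : {r : ℝ | ∃ w g, MemW1pZero p Ω w g ∧ ¬ (∀ᵐ x ∂(volume.restrict Ω), w x = 0) ∧
      r = (∫ x in Ω, ‖g x‖ ^ p ∂(gaussMeasure N)) /
        (∫ x in Ω, |w x| ^ p ∂(gaussMeasure N))}.Nonempty := by
    obtain ⟨φ, hφ, hpos⟩ := exists_isTestFunction_integral_pos hΩ hne
    refine ⟨_, φ, gradient φ, (memW1pZero_iff hΩ hp).2 (hφ.approxBy hp hφ), fun h0 => ?_, rfl⟩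
    exact hpos.ne' (integral_eq_zero_of_ae (ae_restrict_gaussMeasure_iff.2 h0))
  obtain ⟨r, ⟨u, g, hu, hu0, rfl⟩, hr⟩ := exists_lt_of_csInf_lt hnon
    (show lambdaOne p Ω < lambdaOne p Ω + η by linarith)
  rw [memW1pZero_iff hΩ hp] at hu
  have hW : 0 < ∫ x in Ω, ‖u x‖ ^ p ∂(gaussMeasure N) :=
    integral_norm_rpow_nonneg.lt_of_ne' fun h0 =>
      hu0 (ae_restrict_gaussMeasure_iff.1 ((integral_norm_rpow_eq_zero_iff hp hu.1).1 h0))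
  change _ / (∫ x in Ω, ‖u x‖ ^ p ∂(gaussMeasure N)) < _ at hr
  set W := ∫ x in Ω, ‖u x‖ ^ p ∂(gaussMeasure N) with hWdef
  obtain ⟨h, hh, hle⟩ := SobolevZero.abs hp hu
  -- Normalizes the `p`-th power integral to `1`.
  set t : ℝ := W ^ (-(1 / p)) with ht
  have ht0 : 0 ≤ t := by positivity
  have htp : t ^ p = 1 / W := by
    rw [ht, ← Real.rpow_mul hW.le, neg_mul, one_div_mul_cancel (by linarith), Real.rpow_neg hW.le,
      Real.rpow_one, one_div]
  refine ⟨_, _, hh.const_mul hp t, fun x => by positivity, ?_, ?_⟩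
  · simp only [norm_mul, Real.norm_of_nonneg ht0, norm_abs_eq_norm,
      Real.mul_rpow ht0 (norm_nonneg _), integral_const_mul, htp]
    rw [← hWdef]
    field_simp
  · simp only [norm_smul, Real.norm_of_nonneg ht0, Real.mul_rpow ht0 (norm_nonneg _),
      integral_const_mul, htp]
    have h1 : ∫ x in Ω, ‖h x‖ ^ p ∂(gaussMeasure N) ≤ ∫ x in Ω, ‖g x‖ ^ p ∂(gaussMeasure N) :=
      integral_mono (integrable_rpow_of_memLp hp hh.2.1) (integrable_rpow_of_memLp hp hu.2.1)
        fun x => Real.rpow_le_rpow (norm_nonneg _) (hle x) (by linarith)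
    rw [one_div_mul_eq_div]
    exact (div_le_div_of_nonneg_right h1 hW.le).trans hr.le

theorem exists_lt_genTorsion (hΩ : IsOpen Ω) (hne : Ω.Nonempty) (hp : 1 < p) {C : ℝ}
    (hC : 0 ≤ C) : ∃ α < lambdaOne p Ω, C ≤ genTorsion p α Ω := by
  by_contra! hcon
  set L := lambdaOne p Ω with hL
  have hL0 : 0 ≤ L := lambdaOne_nonneg p Ω
  -- For fixed `w` the functional is continuous in the level, so the assumed bound passes to `λ₁`
  -- itself.
  have hF : ∀ w h, SobolevZero p Ω w h → torsionFunctional p L Ω w h ≤ C := by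
    intro w h hw
    have h1 : Tendsto (fun a => torsionFunctional p a Ω w h) (𝓝[<] L)
        (𝓝 (torsionFunctional p L Ω w h)) := by
      refine tendsto_nhdsWithin_of_tendsto_nhds (Continuous.tendsto ?_ L)
      unfold torsionFunctional
      fun_prop
    refine le_of_tendsto h1 ?_
    filter_upwards [self_mem_nhdsWithin] with a ha
    exact (torsionFunctional_le_genTorsion hΩ hp ha hw).trans (hcon a ha).le
  -- For a normalized `w` with gradient energy at most `L + 1`, this choice makes the energy term at
  -- most `1 / 2`; the remaining half of the mass `1` forces `∫w ≥ m₀`.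
  obtain ⟨D, hD, hDu⟩ := SobolevZero.exists_integral_norm_rpow_le hΩ.measurableSet hp
    (Ω := Ω) (ε := 1 / (2 * (L + 2))) (by positivity)
  set m₀ : ℝ := 1 / (2 * (D + 1) * (L + 3)) with hm₀
  have hm0 : 0 < m₀ := by positivity
  have hp0 : 0 < p := by linarith
  -- Along the multiple `t w` the linear term is then at least `C + 1`, while `η ≤ 1 / (2 t ^ p)`
  -- limits the loss from the homogeneous part to `1 / 2`, so the functional exceeds `C`.
  set t : ℝ := (C + 1) / (p * m₀) with ht
  have ht0 : 0 < t := by positivity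
  set η : ℝ := min 1 (1 / (2 * t ^ p)) with hη
  have hη0 : 0 < η := by positivity
  obtain ⟨w, h, hw, hw0, hw1, hh⟩ := exists_normalized_almost_minimizer hΩ hne hp hη0
  have h1 := hDu w h hw
  simp only [abs_of_nonneg (hw0 _)] at h1
  have h2 := hF _ _ (hw.const_mul hp t)
  rw [torsionFunctional_const_mul ht0.le] at h2
  rw [hw1] at h1 h2
  set m := ∫ x in Ω, w x ∂(gaussMeasure N) with hm
  set H := ∫ x in Ω, ‖h x‖ ^ p ∂(gaussMeasure N) with hH
  have hmn : 0 ≤ m := integral_nonneg hw0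
  have hH1 : H ≤ L + 1 := hh.trans (by linarith [min_le_left 1 (1 / (2 * t ^ p))])
  have hm1 : m₀ ≤ m := by
    have e1 : 1 / (2 * (L + 2)) * (1 + H) ≤ 1 / 2 := by
      calc 1 / (2 * (L + 2)) * (1 + H) ≤ 1 / (2 * (L + 2)) * (L + 2) := by
            refine mul_le_mul_of_nonneg_left ?_ (by positivity)
            linarith
        _ = 1 / 2 := by field_simp
    have e2 : D * (1 + (1 + H)) * m ≤ (D + 1) * (L + 3) * m := by
      have : (0 : ℝ) ≤ H := integral_norm_rpow_nonneg
      exact mul_le_mul_of_nonneg_right (mul_le_mul (by linarith) (by linarith) (by linarith)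
        (by linarith)) hmn
    rw [hm₀, div_le_iff₀ (by positivity)]
    linarith
  have h3 : t ^ p * (H - L) ≤ 1 / 2 := by
    calc t ^ p * (H - L) ≤ t ^ p * (1 / (2 * t ^ p)) := by
          refine mul_le_mul_of_nonneg_left ?_ (by positivity)
          linarith [min_le_right 1 (1 / (2 * t ^ p))]
      _ = 1 / 2 := by
          have : t ^ p ≠ 0 := by positivity
          field_simp
  have h4 : C + 1 ≤ p * (t * m) := by
    calc C + 1 = p * (t * m₀) := by
          rw [ht]
          field_simp
      _ ≤ p * (t * m) := by gcongr
  linarith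

theorem tendsto_genTorsion_lambdaOne (hΩ : IsOpen Ω) (hne : Ω.Nonempty) (hp : 1 < p) :
    Tendsto (fun α : ℝ => genTorsion p α Ω) (𝓝[<] (lambdaOne p Ω)) atTop := by
  refine tendsto_atTop.2 fun C => ?_
  obtain ⟨α, hα, hC⟩ := exists_lt_genTorsion hΩ hne hp (le_max_right C 0)
  filter_upwards [Ioo_mem_nhdsLT hα] with b hb
  exact (le_max_left C 0).trans (hC.trans (strictMonoOn_genTorsion hΩ hne hp hα hb.2 hb.1).le)

end GeneralizedTorsion

theorem mainTheorem7 (N : ℕ) (p : ℝ) (hp : 1 < p)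
    (Ω : Set (EuclideanSpace ℝ (Fin N))) (hΩ : IsOpen Ω) (hΩne : Ω.Nonempty)
    (hΩγ : gaussMeasure N Ω < 1) :
    (∀ α : ℝ, α < lambdaOne p Ω →
      (∃ v, IsTorsionFunction p α Ω v) ∧
      (∀ v w, IsTorsionFunction p α Ω v → IsTorsionFunction p α Ω w →
        ∀ᵐ x ∂(volume.restrict Ω), v x = w x) ∧
      BddAbove (torsionValues p α Ω)) ∧
    (∀ α β : ℝ, α < β → β < lambdaOne p Ω →
      ∀ v w, IsTorsionFunction p α Ω v → IsTorsionFunction p β Ω w →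
        ∀ᵐ x ∂(volume.restrict Ω), v x ≤ w x) ∧
    (StrictMonoOn (fun α : ℝ => genTorsion p α Ω) (Iio (lambdaOne p Ω)) ∧
      ∀ α : ℝ, α < lambdaOne p Ω → ∀ v, IsTorsionFunction p α Ω v →
        HasDerivAt (fun a : ℝ => genTorsion p a Ω)
          (∫ x in Ω, |v x| ^ p ∂(gaussMeasure N)) α) ∧
    Tendsto (fun α : ℝ => genTorsion p α Ω) atBot (𝓝 0) ∧
    Tendsto (fun α : ℝ => genTorsion p α Ω) (𝓝[<] (lambdaOne p Ω)) atTop := by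
  have : IsFiniteMeasure ((gaussMeasure N).restrict Ω) :=
    ⟨by rw [Measure.restrict_apply_univ]; exact hΩγ.trans ENNReal.one_lt_top⟩
  refine ⟨fun α hα => ⟨?_, fun v w hv hw => ?_, ?_⟩, fun α β hαβ hβ v w hv hw => ?_,
    ⟨strictMonoOn_genTorsion hΩ hΩne hp, fun α hα v hv => ?_⟩,
    tendsto_genTorsion_atBot hΩ hp, tendsto_genTorsion_lambdaOne hΩ hΩne hp⟩
  · obtain ⟨v, g, hv, -⟩ := exists_minimal_solution hΩ hp hα
    exact ⟨v, (isTorsionFunction_iff hΩ hp).2 ⟨g, hv⟩⟩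
  · obtain ⟨g, hv⟩ := (isTorsionFunction_iff hΩ hp).1 hv
    obtain ⟨h, hw⟩ := (isTorsionFunction_iff hΩ hp).1 hw
    refine ae_restrict_gaussMeasure_iff.1 ?_
    filter_upwards [hv.ae_le hΩ hp le_rfl hα hw, hw.ae_le hΩ hp le_rfl hα hv] with x h1 h2
    exact le_antisymm h1 h2
  · obtain ⟨v, g, hv, -⟩ := exists_minimal_solution hΩ hp hα
    exact (hv.isGreatest hΩ hp hα).bddAbove
  · obtain ⟨g, hv⟩ := (isTorsionFunction_iff hΩ hp).1 hv
    obtain ⟨h, hw⟩ := (isTorsionFunction_iff hΩ hp).1 hw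
    exact ae_restrict_gaussMeasure_iff.1 (hv.ae_le hΩ hp hαβ.le hβ hw)
  · obtain ⟨g, hv⟩ := (isTorsionFunction_iff hΩ hp).1 hv
    exact hv.hasDerivAt_genTorsion hΩ hp hα
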